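/- Work over $\mathbb{C}$ and write $\mathbb{P}^2=\mathbb{P}^2_{\mathbb{C}}$. For labeled points $\mathcal{X}=(x_1,\dots,x_5)$ and $\mathcal{Y}=(y_1,\dots,y_5)$ of $\mathbb{P}^2$, the camera centers variety $E_5=E_{\mathcal{X},\mathcal{Y}}\subset\mathbb{P}^2\times\mathbb{P}^2$ is the set of all pairs $(a,b)$ for which there is a nonzero $3\times 3$ matrix $F$ with $$Fa=0,\qquad F^{\top}b=0,\qquad y_i^{\top}Fx_i=0\quad(i=1,\dots,5).$$ Let $\pi_x(a,b)=a$ and $\pi_y(a,b)=b$. A rational map $\mathbb{P}^2\dashrightarrow\mathbb{P}^2$ has degree $n$ if it is given by three forms of degree $n$ without a common factor; a Cremona transformation is a birational map $\mathbb{P}^2\dashrightarrow\mathbb{P}^2$. For $i+j=\dim E_5$, the multidegree $d_{(i,j)}(E_5)$ is the number of points $(a,b)\in E_5$ such that $a$ lies on $i$ generic lines and $b$ lies on $j$ generic lines of $\mathbb{P}^2$. "Generic" means: on a dense Zariski-open subset of the parameter space. **Theorem.** For generic $(\mathcal{X},\mathcal{Y})\in(\mathbb{P}^2)^5\times(\mathbb{P}^2)^5$,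 the set $E_5$ is an irreducible Zariski-closed surface (of dimension $2$) in $\mathbb{P}^2\times\mathbb{P}^2$. Furthermore: 1. Both projections $\pi_x,\pi_y:E_5\to\mathbb{P}^2$ are surjective and have rational inverses $\pi_x^{-1},\pi_y^{-1}:\mathbb{P}^2\dashrightarrow E_5$. The composite $\pi_y\circ\pi_x^{-1}:\mathbb{P}^2\dashrightarrow\mathbb{P}^2$, $a\mapsto b$, is a Cremona transformation of degree $5$. Explicitly, choose projective coordinates on the two planes in which $x_1,\dots,x_4$, and likewise $y_1,\dots,y_4$, are $[1:0:0],[0:1:0],[0:0:1],[1:1:1]$, and let $x_5=[\xi_1:\xi_2:\xi_3]$ and $y_5=[\eta_1:\eta_2:\eta_3]$ in these coordinates. Then the map is $$[a_1:a_2:a_3]\longmapsto[a_1q_2q_3:a_2q_1q_3:a_3q_1q_2],$$ where $$\begin{aligned} q_1&=\eta_2(a_1-a_2)(a_3\xi_1-a_1\xi_3)-\eta_3(a_3-a_1)(a_1\xi_2-a_2\xi_1),\\ q_2&=\eta_3(a_2-a_3)(a_1\xi_2-a_2\xi_1)-\eta_1(a_1-a_2)(a_2\xi_3-a_3\xi_2),\\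 q_3&=\eta_1(a_3-a_1)(a_2\xi_3-a_3\xi_2)-\eta_2(a_2-a_3)(a_3\xi_1-a_1\xi_3), \end{aligned}$$ and these three quintic forms have no common factor. 2. The multidegrees are $d_{(2,0)}(E_5)=d_{(0,2)}(E_5)=1$ and $d_{(1,1)}(E_5)=5$. -/

import Mathlib

open MvPolynomial

/-- The complex projective plane. -/
abbrev P2 : Type := Projectivization ℂ (Fin 3 → ℂ)

/-- The vector `v` is a vector of homogeneous coordinates of the point `p`. -/
def Represents (p : P2) (v : Fin 3 → ℂ) : Prop :=
  ∃ h : v ≠ 0, Projectivization.mk ℂ v h = p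

/-- The product `(ℙ²)^κ` of complex projective planes, one factor for each `k : κ`. -/
def MultiP2 (κ : Type) : Type := κ → P2

/-- `f`, a polynomial in one triple of variables for each factor, is homogeneous of degree `δ k`
in the `k`-th triple of variables, for every `k`. -/
def IsMultihomogeneous {κ : Type} (f : MvPolynomial (κ × Fin 3) ℂ) (δ : κ → ℕ) : Prop :=
  ∀ m ∈ f.support, ∀ k, ∑ i, m (k, i) = δ k

/-- Evaluation at the chosen homogeneous coordinates of the points `p k`. For multihomogeneous `f`
the vanishing of the result does not depend on the choice. -/
noncomputable def evalAt {κ : Type} (f : MvPolynomial (κ × Fin 3) ℂ) (p : MultiP2 κ) : ℂ :=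
  eval (fun ki : κ × Fin 3 => (p ki.1).rep ki.2) f

/-- The Zariski topology: the non-vanishing loci of multihomogeneous polynomials form a basis. -/
instance zariskiTopology (κ : Type) : TopologicalSpace (MultiP2 κ) :=
  TopologicalSpace.generateFrom
    {U | ∃ f δ, IsMultihomogeneous f δ ∧ U = {p : MultiP2 κ | evalAt f p ≠ 0}}

/-- `P` holds for generic points of `(ℙ²)^κ`: on a dense Zariski-open subset. -/
def Generically {κ : Type} (P : MultiP2 κ → Prop) : Prop :=
  ∃ U : Set (MultiP2 κ), IsOpen U ∧ Dense U ∧ ∀ p ∈ U, P p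

/-- The camera centers variety of `x` and `y`: all pairs `(a, b) = (e 0, e 1)` for which there is a
nonzero matrix `F` (up to scale, a point of `ℙ⁸`) with `F a = 0`, `Fᵀ b = 0` and `yᵢᵀ F xᵢ = 0`. -/
def cameraCentersVariety {n : ℕ} (x y : Fin n → P2) : Set (MultiP2 (Fin 2)) :=
  {e | ∃ F : Matrix (Fin 3) (Fin 3) ℂ, F ≠ 0 ∧
    F.mulVec (e 0).rep = 0 ∧ F.transpose.mulVec (e 1).rep = 0 ∧
    ∀ i, dotProduct (y i).rep (F.mulVec (x i).rep) = 0}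

/-- A rational map `ℙ² ⇢ ℙ²`, given by its reduced representative: three forms of the same degree
without a common factor (in particular not all zero). -/
structure PlaneRationalMap where
  degree : ℕ
  form : Fin 3 → MvPolynomial (Fin 3) ℂ
  homogeneous : ∀ i, (form i).IsHomogeneous degree
  reduced : ∀ q, (∀ i, q ∣ form i) → IsUnit q

namespace PlaneRationalMap

/-- The vector of values of the three forms. -/
noncomputable def evalVec (φ : PlaneRationalMap) (v : Fin 3 → ℂ) : Fin 3 → ℂ :=
  fun i => eval v (φ.form i)

/-- The domain of definition: the complement of the base points. -/
def domain (φ : PlaneRationalMap) : Set P2 := {p | φ.evalVec p.rep ≠ 0}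

/-- `φ` is defined at `p` and takes the value `q` there. -/
def Sends (φ : PlaneRationalMap) (p q : P2) : Prop := Represents q (φ.evalVec p.rep)

/-- `ψ ∘ φ` is the identity as a rational map: the composite is defined somewhere, and it is the
identity wherever it is defined. -/
def IsLeftInverse (ψ φ : PlaneRationalMap) : Prop :=
  (∃ p q, φ.Sends p q ∧ q ∈ ψ.domain) ∧
    ∀ p q, φ.Sends p q → q ∈ ψ.domain → ψ.Sends q p

/-- A Cremona transformation of the plane is a birational self-map of `ℙ²`. -/
def IsCremona (φ : PlaneRationalMap) : Prop :=
  ∃ ψ : PlaneRationalMap, ψ.IsLeftInverse φ ∧ φ.IsLeftInverse ψ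

end PlaneRationalMap

/-- The rational map `σ = (σ 0, σ 1) : ℙ² ⇢ ℙ² × ℙ²` takes values in `E` and is a rational inverse
of the `k`-th coordinate projection `π : E → ℙ²`: `π ∘ σ` is the identity where `σ` is defined, and
`σ ∘ π` is defined on a dense (open) subset of `E` and is the identity there. -/
def IsRationalInverse (E : Set (MultiP2 (Fin 2))) (k : Fin 2) (σ : Fin 2 → PlaneRationalMap) :
    Prop :=
  (∀ (p : P2) (e : MultiP2 (Fin 2)), (∀ j, (σ j).Sends p (e j)) → e ∈ E ∧ e k = p) ∧
  E ⊆ closure {e ∈ E | ∀ j, e k ∈ (σ j).domain} ∧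
  ∀ e ∈ E, (∀ j, e k ∈ (σ j).domain) → ∀ j, (σ j).Sends (e k) (e j)

/-- The point `p` lies on the line whose dual coordinates are `l`. -/
def OnLine (l p : P2) : Prop := dotProduct l.rep p.rep = 0

/-- The multidegree `d_(i,j)` of `E` is `d`: `E` meets `i` generic lines in the first plane and `j`
generic lines in the second one in exactly `d` points. (To be used for `i + j = dim E`.) -/
def HasMultidegree (E : Set (MultiP2 (Fin 2))) (i j d : ℕ) : Prop :=
  Generically fun l : MultiP2 (Fin i ⊕ Fin j) =>
    {e ∈ E | (∀ s, OnLine (l (Sum.inl s)) (e 0)) ∧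
      ∀ t, OnLine (l (Sum.inr t)) (e 1)}.encard = d

/-- The points `e₁, e₂, e₃` and `e₄ = e₁ + e₂ + e₃` of the standard projective frame. -/
def frame : Fin 4 → Fin 3 → ℂ :=
  ![![1, 0, 0], ![0, 1, 0], ![0, 0, 1], ![1, 1, 1]]

/-- In the projective coordinates given by the invertible matrix `G`, the first four points of `x`
are the standard frame, and `ξ` is a coordinate vector of the fifth point. -/
def StandardPosition (x : Fin 5 → P2) (G : Matrix (Fin 3) (Fin 3) ℂ) (ξ : Fin 3 → ℂ) : Prop :=
  G.det ≠ 0 ∧ (∀ i : Fin 4, Represents (x i.castSucc) (G.mulVec (frame i))) ∧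
    Represents (x 4) (G.mulVec ξ)

/-- The explicit quintic forms `(a₁ q₂ q₃, a₂ q₁ q₃, a₃ q₁ q₂)`, with quadratic forms `qᵢ` in `a`
that depend on the fifth points `ξ` and `η`. -/
def quinticMap (ξ η a : Fin 3 → ℂ) : Fin 3 → ℂ :=
  let q₁ := η 1 * (a 0 - a 1) * (a 2 * ξ 0 - a 0 * ξ 2) -
    η 2 * (a 2 - a 0) * (a 0 * ξ 1 - a 1 * ξ 0)
  let q₂ := η 2 * (a 1 - a 2) * (a 0 * ξ 1 - a 1 * ξ 0) -
    η 0 * (a 0 - a 1) * (a 1 * ξ 2 - a 2 * ξ 1)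
  let q₃ := η 0 * (a 2 - a 0) * (a 1 * ξ 2 - a 2 * ξ 1) -
    η 1 * (a 1 - a 2) * (a 2 * ξ 0 - a 0 * ξ 2)
  ![a 0 * q₂ * q₃, a 1 * q₁ * q₃, a 2 * q₁ * q₂]

/-!
Put the first four points of both configurations in standard position. A matrix `F ≠ 0` with
`F a = 0` that satisfies the conditions at the three vertices of the frame has rows `pᵢ (eᵢ × a)`,
unless `a` is itself a vertex, and the conditions at the fourth and fifth points are two linear
equations for `p`. Hence `p` is proportional to a cross product, whose entries are the quadrics
`q₁, q₂, q₃` in `a`, and the left kernel of `F` is spanned by `(a₁ q₂ q₃, a₂ q₃ q₁, a₃ q₁ q₂)`. By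
symmetry `E₅` is, away from the base points on either side, the graph of a birational map and of its
inverse.

For configurations in general position these quintics have exactly six common zeros, namely the five
given points and one more, so they have no common factor. The conditions on `F` are linear and few
enough that over a base point each solution moves in a curve inside `E₅`. Such a curve contains
points of the graph of the inverse map arbitrarily close (in the Zariski sense) to the given point,
so `E₅` is the closure of the graph. It is therefore irreducible of dimension two.

A generic line avoids the base points and its image meets a second generic line in the zeros of a
form of degree five in two variables, a general member of a pencil without base points; such a form
has five simple zeros, which gives `d_(1,1) = 5`.
-/

section HomogeneousCoordinates

theorem represents_rep (p : P2) : Represents p p.rep :=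
  ⟨p.rep_nonzero, p.mk_rep⟩

theorem represents_mk {v : Fin 3 → ℂ} (h : v ≠ 0) : Represents (Projectivization.mk ℂ v h) v :=
  ⟨h, rfl⟩

namespace Represents

variable {p q : P2} {v w : Fin 3 → ℂ} {t : ℂ}

theorem ne_zero (h : Represents p v) : v ≠ 0 := h.1

theorem smul (h : Represents p v) (ht : t ≠ 0) : Represents p (t • v) := by
  obtain ⟨hv, rfl⟩ := h
  exact ⟨smul_ne_zero ht hv, (Projectivization.mk_eq_mk_iff' ℂ _ _ _ _).2 ⟨t, rfl⟩⟩

theorem exists_smul (hv : Represents p v) (hw : Represents p w) :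
    ∃ t : ℂ, t ≠ 0 ∧ w = t • v := by
  obtain ⟨_, rfl⟩ := hv
  obtain ⟨hw0, hwv⟩ := hw
  obtain ⟨t, rfl⟩ := (Projectivization.mk_eq_mk_iff' ℂ _ _ _ _).1 hwv
  exact ⟨t, left_ne_zero_of_smul hw0, rfl⟩

theorem unique (hp : Represents p v) (hq : Represents q v) : p = q := by
  obtain ⟨_, rfl⟩ := hp
  obtain ⟨_, rfl⟩ := hq
  rfl

theorem smul_iff (ht : t ≠ 0) : Represents p (t • v) ↔ Represents p v :=
  ⟨fun h => by simpa only [inv_smul_smul₀ ht] using h.smul (inv_ne_zero ht), fun h => h.smul ht⟩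

end Represents

/-- `v k` is a vector of homogeneous coordinates of `p k`, for every `k`. -/
def RepresentsTuple {κ : Type} (p : MultiP2 κ) (v : κ → Fin 3 → ℂ) : Prop :=
  ∀ k, Represents (p k) (v k)

section Tuples

variable {κ : Type} {p q : MultiP2 κ} {v w : κ → Fin 3 → ℂ}

theorem representsTuple_rep (p : MultiP2 κ) : RepresentsTuple p fun k => (p k).rep :=
  fun k => represents_rep (p k)

theorem exists_representsTuple (h : ∀ k, v k ≠ 0) : ∃ p : MultiP2 κ, RepresentsTuple p v :=
  ⟨fun k => Projectivization.mk ℂ (v k) (h k), fun k => represents_mk (h k)⟩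

namespace RepresentsTuple

theorem exists_smul (hv : RepresentsTuple p v) (hw : RepresentsTuple p w) :
    ∃ t : κ → ℂ, (∀ k, t k ≠ 0) ∧ w = fun k => t k • v k := by
  choose t ht h using fun k => (hv k).exists_smul (hw k)
  exact ⟨t, ht, funext h⟩

theorem smul (hv : RepresentsTuple p v) {t : κ → ℂ} (ht : ∀ k, t k ≠ 0) :
    RepresentsTuple p fun k => t k • v k :=
  fun k => (hv k).smul (ht k)

theorem unique (hp : RepresentsTuple p v) (hq : RepresentsTuple q v) : p = q :=
  funext fun k => (hp k).unique (hq k)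

end RepresentsTuple

end Tuples

end HomogeneousCoordinates

section PolynomialFunctions

theorem eval_aeval_eq_eval {R σ τ : Type*} [CommSemiring R] (f : MvPolynomial σ R)
    (a : σ → MvPolynomial τ R) (v : τ → R) :
    eval v (aeval a f) = eval (fun i => eval v (a i)) f := by
  simp only [← coe_aeval_eq_eval, RingHom.coe_coe]
  exact comp_aeval_apply a (aeval v) f

variable {R κ ι : Type*} [CommRing R]

/-- `g` is a polynomial function of a tuple of vectors. -/
def IsPolyFun (g : (κ → ι → R) → R) : Prop :=
  ∃ f : MvPolynomial (κ × ι) R, ∀ v, eval (Function.uncurry v) f = g v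

namespace IsPolyFun

variable {g h : (κ → ι → R) → R}

theorem const (c : R) : IsPolyFun fun _ : κ → ι → R => c := ⟨C c, fun _ => eval_C _⟩

theorem coord (k : κ) (i : ι) : IsPolyFun fun v : κ → ι → R => v k i :=
  ⟨X (k, i), fun _ => eval_X _⟩

theorem add (hg : IsPolyFun g) (hh : IsPolyFun h) : IsPolyFun fun v => g v + h v := by
  obtain ⟨a, ha⟩ := hg
  obtain ⟨b, hb⟩ := hh
  exact ⟨a + b, fun v => by rw [map_add, ha, hb]⟩

theorem sub (hg : IsPolyFun g) (hh : IsPolyFun h) : IsPolyFun fun v => g v - h v := by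
  obtain ⟨a, ha⟩ := hg
  obtain ⟨b, hb⟩ := hh
  exact ⟨a - b, fun v => by rw [map_sub, ha, hb]⟩

theorem mul (hg : IsPolyFun g) (hh : IsPolyFun h) : IsPolyFun fun v => g v * h v := by
  obtain ⟨a, ha⟩ := hg
  obtain ⟨b, hb⟩ := hh
  exact ⟨a * b, fun v => by rw [map_mul, ha, hb]⟩

theorem sum {τ : Type*} (s : Finset τ) {g : τ → (κ → ι → R) → R}
    (hg : ∀ i ∈ s, IsPolyFun (g i)) : IsPolyFun fun v => ∑ i ∈ s, g i v := by
  choose! f hf using hg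
  exact ⟨∑ i ∈ s, f i, fun v => by rw [map_sum, Finset.sum_congr rfl fun i hi => hf i hi v]⟩

theorem prod {τ : Type*} (s : Finset τ) {g : τ → (κ → ι → R) → R}
    (hg : ∀ i ∈ s, IsPolyFun (g i)) : IsPolyFun fun v => ∏ i ∈ s, g i v := by
  choose! f hf using hg
  exact ⟨∏ i ∈ s, f i, fun v => by rw [map_prod, Finset.prod_congr rfl fun i hi => hf i hi v]⟩

theorem det {n : Type*} [Fintype n] [DecidableEq n] {M : (κ → ι → R) → Matrix n n R}
    (hM : ∀ i j, IsPolyFun fun v => M v i j) : IsPolyFun fun v => (M v).det := by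
  simp only [Matrix.det_apply']
  exact sum _ fun σ _ => (const _).mul (prod _ fun i _ => hM _ _)

theorem eval {τ : Type*} (f : MvPolynomial τ R) {φ : (κ → ι → R) → τ → R}
    (hφ : ∀ i, IsPolyFun fun v => φ v i) : IsPolyFun fun v => MvPolynomial.eval (φ v) f := by
  choose a ha using hφ
  exact ⟨aeval a f, fun v => by simp only [eval_aeval_eq_eval, ha]⟩

theorem comp {κ' ι' : Type*} {g : (κ' → ι' → R) → R} (hg : IsPolyFun g)
    {Φ : (κ → ι → R) → κ' → ι' → R} (hΦ : ∀ k i, IsPolyFun fun v => Φ v k i) :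
    IsPolyFun fun v => g (Φ v) := by
  obtain ⟨f, hf⟩ := hg
  simp only [← hf]
  exact eval f fun ki => hΦ ki.1 ki.2

section Nonvanishing

variable [IsDomain R] [Infinite R]

theorem exists_ne_zero_and (hg : IsPolyFun g) (hh : IsPolyFun h) (hg0 : ∃ v, g v ≠ 0)
    (hh0 : ∃ v, h v ≠ 0) : ∃ v, g v ≠ 0 ∧ h v ≠ 0 := by
  obtain ⟨a, ha⟩ := hg
  obtain ⟨b, hb⟩ := hh
  obtain ⟨v, hv⟩ := hg0
  obtain ⟨w, hw⟩ := hh0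
  have ha0 : a ≠ 0 := by rintro rfl; exact hv (by rw [← ha, map_zero])
  have hb0 : b ≠ 0 := by rintro rfl; exact hw (by rw [← hb, map_zero])
  by_contra! hgh
  refine mul_ne_zero ha0 hb0 (MvPolynomial.funext fun x => ?_)
  rw [← Function.uncurry_curry x, map_mul, map_zero, ha, hb]
  exact mul_eq_zero.2 (or_iff_not_imp_left.2 (hgh _))

theorem exists_ne_zero_forall {τ : Type*} (s : Finset τ) {g : τ → (κ → ι → R) → R}
    (hg : ∀ i ∈ s, IsPolyFun (g i)) (h : ∀ i ∈ s, ∃ v, g i v ≠ 0) :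
    ∃ v, ∀ i ∈ s, g i v ≠ 0 := by
  classical
  induction s using Finset.induction_on with
  | empty => exact ⟨0, by simp⟩
  | insert a s _ ih =>
    simp only [Finset.forall_mem_insert] at hg h ⊢
    obtain ⟨v, hv⟩ := ih hg.2 h.2
    obtain ⟨w, hwa, hws⟩ := hg.1.exists_ne_zero_and (prod s hg.2) h.1
      ⟨v, Finset.prod_ne_zero_iff.2 hv⟩
    exact ⟨w, hwa, Finset.prod_ne_zero_iff.1 hws⟩

theorem exists_ne_zero_and_forall_ne_zero {κ' ι' : Type*} [Finite κ'] (hg : IsPolyFun g)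
    {Φ : (κ → ι → R) → κ' → ι' → R} (hΦ : ∀ k i, IsPolyFun fun v => Φ v k i)
    (hg0 : ∃ v, g v ≠ 0) (hΦ0 : ∃ v, ∀ k, Φ v k ≠ 0) :
    ∃ v, g v ≠ 0 ∧ ∀ k, Φ v k ≠ 0 := by
  cases nonempty_fintype κ'
  obtain ⟨w, hw⟩ := hΦ0
  choose i hi using fun k => Function.ne_iff.1 (hw k)
  obtain ⟨v, hgv, hΦv⟩ := hg.exists_ne_zero_and (prod Finset.univ fun k _ => hΦ k (i k)) hg0
    ⟨w, Finset.prod_ne_zero_iff.2 fun k _ => hi k⟩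
  exact ⟨v, hgv, fun k => Function.ne_iff.2
    ⟨i k, Finset.prod_ne_zero_iff.1 hΦv k (Finset.mem_univ k)⟩⟩

end Nonvanishing

theorem dotProduct [Fintype ι] {g h : (κ → ι → R) → ι → R} (hg : ∀ i, IsPolyFun fun v => g v i)
    (hh : ∀ i, IsPolyFun fun v => h v i) : IsPolyFun fun v => _root_.dotProduct (g v) (h v) :=
  sum _ fun i _ => (hg i).mul (hh i)

theorem crossProduct {g h : (κ → ι → R) → Fin 3 → R} (hg : ∀ i, IsPolyFun fun v => g v i)
    (hh : ∀ i, IsPolyFun fun v => h v i) (i : Fin 3) :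
    IsPolyFun fun v => _root_.crossProduct (g v) (h v) i := by
  simp only [cross_apply]
  fin_cases i
  · exact ((hg 1).mul (hh 2)).sub ((hg 2).mul (hh 1))
  · exact ((hg 2).mul (hh 0)).sub ((hg 0).mul (hh 2))
  · exact ((hg 0).mul (hh 1)).sub ((hg 1).mul (hh 0))

end IsPolyFun

end PolynomialFunctions

section ZariskiTopology

variable {κ : Type}

/-- The `ℕ^κ`-grading whose weighted homogeneous polynomials are the multihomogeneous ones. -/
noncomputable def factorWeight (ki : κ × Fin 3) : κ →₀ ℕ := Finsupp.single ki.1 1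

theorem weight_factorWeight_apply (m : κ × Fin 3 →₀ ℕ) (k : κ) :
    Finsupp.weight factorWeight m k = ∑ i, m (k, i) := by
  classical
  induction m using Finsupp.induction_linear with
  | zero => simp
  | add m n hm hn => simp [Finset.sum_add_distrib, hm, hn]
  | single ki n =>
    obtain ⟨l, j⟩ := ki
    by_cases hlk : l = k <;> simp [factorWeight, Finsupp.weight_single, Finsupp.single_apply, hlk]

theorem isMultihomogeneous_iff_isWeightedHomogeneous {f : MvPolynomial (κ × Fin 3) ℂ}
    {δ : κ →₀ ℕ} : IsMultihomogeneous f δ ↔ IsWeightedHomogeneous factorWeight f δ := by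
  simp only [IsMultihomogeneous, IsWeightedHomogeneous, mem_support_iff, DFunLike.ext_iff,
    weight_factorWeight_apply]

namespace IsMultihomogeneous

theorem one : IsMultihomogeneous (1 : MvPolynomial (κ × Fin 3) ℂ) 0 :=
  isMultihomogeneous_iff_isWeightedHomogeneous.2 (isWeightedHomogeneous_one ℂ factorWeight)

variable {f g : MvPolynomial (κ × Fin 3) ℂ} {δ ε : κ → ℕ}

theorem mul (hf : IsMultihomogeneous f δ) (hg : IsMultihomogeneous g ε) :
    IsMultihomogeneous (f * g) (δ + ε) := by
  classical
  intro m hm k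
  obtain ⟨a, ha, b, hb, rfl⟩ := Finset.mem_add.1 (support_mul f g hm)
  simp only [Finsupp.add_apply, Finset.sum_add_distrib, hf a ha k, hg b hb k, Pi.add_apply]

theorem eval_smul [Fintype κ] (hf : IsMultihomogeneous f δ) (v : κ → Fin 3 → ℂ) (t : κ → ℂ) :
    eval (Function.uncurry fun k => t k • v k) f =
      (∏ k, t k ^ δ k) * eval (Function.uncurry v) f := by
  rw [eval_eq', eval_eq', Finset.mul_sum]
  refine Finset.sum_congr rfl fun m hm => ?_
  have hscale : ∏ k, t k ^ δ k = ∏ ki : κ × Fin 3, t ki.1 ^ m ki := by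
    simp only [Fintype.prod_prod_type, Finset.prod_pow_eq_pow_sum, hf m hm]
  rw [mul_left_comm, hscale, ← Finset.prod_mul_distrib]
  simp only [Function.uncurry, Pi.smul_apply, smul_eq_mul, mul_pow]

theorem evalAt_ne_zero_iff [Finite κ] (hf : IsMultihomogeneous f δ) {p : MultiP2 κ}
    {v : κ → Fin 3 → ℂ} (hv : RepresentsTuple p v) :
    evalAt f p ≠ 0 ↔ eval (Function.uncurry v) f ≠ 0 := by
  cases nonempty_fintype κ
  obtain ⟨t, ht, rfl⟩ := (representsTuple_rep p).exists_smul hv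
  rw [hf.eval_smul, mul_ne_zero_iff_left
    (Finset.prod_ne_zero_iff.2 fun k _ => pow_ne_zero _ (ht k))]
  rfl

end IsMultihomogeneous

theorem isTopologicalBasis_zariskiTopology : TopologicalSpace.IsTopologicalBasis
    {U | ∃ f δ, IsMultihomogeneous f δ ∧ U = {p : MultiP2 κ | evalAt f p ≠ 0}} where
  exists_subset_inter := by
    rintro _ ⟨f, δ, hf, rfl⟩ _ ⟨g, ε, hg, rfl⟩ x ⟨hfx, hgx⟩
    have hmul (p : MultiP2 κ) : evalAt (f * g) p = evalAt f p * evalAt g p := map_mul _ _ _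
    refine ⟨_, ⟨f * g, δ + ε, hf.mul hg, rfl⟩, ?_, fun p hp => ?_⟩
    · exact (hmul x).trans_ne (mul_ne_zero hfx hgx)
    · exact mul_ne_zero_iff.1 ((hmul p).symm.trans_ne hp)
  sUnion_eq := Set.eq_univ_of_forall fun _ =>
    ⟨_, ⟨1, 0, .one, rfl⟩, (map_one _).trans_ne one_ne_zero⟩
  eq_generateFrom := rfl

/-- The polynomial `t ↦ f (t • v)` on the torus of scalings. Its coefficients are the values at
`v` of the multihomogeneous components of `f`, which reduces the vanishing of arbitrary polynomials
on the multicone over a point to that of multihomogeneous ones. -/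
noncomputable def scalingPoly (f : MvPolynomial (κ × Fin 3) ℂ) (v : κ → Fin 3 → ℂ) :
    MvPolynomial κ ℂ :=
  aeval (fun ki : κ × Fin 3 => C (v ki.1 ki.2) * X ki.1) f

theorem eval_scalingPoly (f : MvPolynomial (κ × Fin 3) ℂ) (v : κ → Fin 3 → ℂ) (t : κ → ℂ) :
    eval t (scalingPoly f v) = eval (Function.uncurry fun k => t k • v k) f := by
  rw [scalingPoly, eval_aeval_eq_eval]
  congr 2
  funext ki
  simp [Function.uncurry, mul_comm]

theorem scalingPoly_monomial (m : κ × Fin 3 →₀ ℕ) (c : ℂ) (v : κ → Fin 3 → ℂ) :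
    scalingPoly (monomial m c) v =
      monomial (Finsupp.weight factorWeight m) (eval (Function.uncurry v) (monomial m c)) := by
  have hX : (m.prod fun ki n => (X ki.1 : MvPolynomial κ ℂ) ^ n) =
      monomial (Finsupp.weight factorWeight m) 1 := by
    rw [Finsupp.weight_apply, monomial_finsupp_sum_index, C_1, one_mul]
    simp only [factorWeight, Finsupp.smul_single, smul_eq_mul, mul_one, X_pow_eq_monomial]
  rw [scalingPoly, aeval_monomial, eval_monomial, ← mul_one (c * _), ← C_mul_monomial, ← hX,
    algebraMap_eq, C_mul, mul_assoc]
  simp only [mul_pow, Finset.prod_mul_distrib, Finsupp.prod, map_prod, map_pow, Function.uncurry]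

theorem coeff_scalingPoly (f : MvPolynomial (κ × Fin 3) ℂ) (v : κ → Fin 3 → ℂ) (δ : κ →₀ ℕ) :
    coeff δ (scalingPoly f v) =
      eval (Function.uncurry v) (weightedHomogeneousComponent factorWeight δ f) := by
  classical
  induction f using MvPolynomial.induction_on' with
  | monomial m c =>
    have hmem : monomial m c ∈ weightedHomogeneousSubmodule ℂ factorWeight
        (Finsupp.weight factorWeight m) := isWeightedHomogeneous_monomial _ _ _ rfl
    rw [scalingPoly_monomial, coeff_monomial, weightedHomogeneousComponent_of_mem hmem,
      apply_ite (eval _), map_zero]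
    simp only [eq_comm]
  | add p q hp hq =>
    have hadd : scalingPoly (p + q) v = scalingPoly p v + scalingPoly q v := map_add _ _ _
    rw [hadd, coeff_add, hp, hq, map_add, map_add]

theorem exists_smul_eval_ne_zero [Finite κ] {f : MvPolynomial (κ × Fin 3) ℂ}
    {v : κ → Fin 3 → ℂ} (h : scalingPoly f v ≠ 0) :
    ∃ t : κ → ℂ, (∀ k, t k ≠ 0) ∧ eval (Function.uncurry fun k => t k • v k) f ≠ 0 := by
  cases nonempty_fintype κ
  have hprod : scalingPoly f v * ∏ k, X k ≠ 0 :=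
    mul_ne_zero h (Finset.prod_ne_zero_iff.2 fun k _ => X_ne_zero k)
  obtain ⟨t, ht⟩ : ∃ t, eval t (scalingPoly f v * ∏ k, X k) ≠ 0 := by
    by_contra! hzero
    exact hprod (MvPolynomial.funext fun t => by rw [hzero, map_zero])
  rw [map_mul, map_prod, eval_scalingPoly] at ht
  refine ⟨t, fun k => ?_, left_ne_zero_of_mul ht⟩
  rw [← eval_X (f := t) k]
  exact Finset.prod_ne_zero_iff.1 (right_ne_zero_of_mul ht) k (Finset.mem_univ k)

theorem eval_eq_zero_of_scalingPoly_eq_zero {f : MvPolynomial (κ × Fin 3) ℂ} {p : MultiP2 κ}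
    {v w : κ → Fin 3 → ℂ} (hv : RepresentsTuple p v) (h : scalingPoly f v = 0)
    (hw : RepresentsTuple p w) : eval (Function.uncurry w) f = 0 := by
  obtain ⟨t, _, rfl⟩ := hv.exists_smul hw
  rw [← eval_scalingPoly, h, map_zero]

namespace IsPolyFun

variable [Finite κ] {g : (κ → Fin 3 → ℂ) → ℂ}

theorem isOpen_setOf_exists_ne_zero (hg : IsPolyFun g) :
    IsOpen {p : MultiP2 κ | ∃ v, RepresentsTuple p v ∧ g v ≠ 0} := by
  classical
  obtain ⟨f, hf⟩ := hg
  rw [isTopologicalBasis_zariskiTopology.isOpen_iff]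
  rintro p ⟨v, hv, hgv⟩
  have hscaling : scalingPoly f v ≠ 0 := fun h0 =>
    hgv (hf v ▸ eval_eq_zero_of_scalingPoly_eq_zero hv h0 hv)
  obtain ⟨δ, hδ⟩ := ne_zero_iff.1 hscaling
  have hhom : IsMultihomogeneous (weightedHomogeneousComponent factorWeight δ f) δ :=
    isMultihomogeneous_iff_isWeightedHomogeneous.2
      (weightedHomogeneousComponent_isWeightedHomogeneous δ f)
  rw [coeff_scalingPoly] at hδ
  refine ⟨_, ⟨_, _, hhom, rfl⟩, (hhom.evalAt_ne_zero_iff hv).2 hδ, fun q hq => ?_⟩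
  obtain ⟨t, ht, hft⟩ := exists_smul_eval_ne_zero
    (ne_zero_iff.2 ⟨δ, (coeff_scalingPoly f (fun k => (q k).rep) δ).trans_ne hq⟩)
  exact ⟨_, (representsTuple_rep q).smul ht, hf _ ▸ hft⟩

theorem isClosed_setOf_forall_eq_zero (hg : IsPolyFun g) :
    IsClosed {p : MultiP2 κ | ∀ v, RepresentsTuple p v → g v = 0} := by
  rw [← isOpen_compl_iff]
  convert hg.isOpen_setOf_exists_ne_zero using 1
  ext p
  simp only [Set.mem_compl_iff, Set.mem_ofPred_eq, not_forall, exists_prop, ne_eq]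

end IsPolyFun

theorem isIrreducible_setOf_exists_representsTuple {κ' ι : Type} [Finite κ']
    {Φ : (κ → ι → ℂ) → κ' → Fin 3 → ℂ} (hΦ : ∀ k i, IsPolyFun fun w => Φ w k i)
    (hne : ∃ w, ∀ k, Φ w k ≠ 0) :
    IsIrreducible {p : MultiP2 κ' | ∃ w, RepresentsTuple p (Φ w)} := by
  refine ⟨?_, ?_⟩
  · obtain ⟨w, hw⟩ := hne
    obtain ⟨p, hp⟩ := exists_representsTuple hw
    exact ⟨p, w, hp⟩
  · rintro U V hU hV ⟨p, ⟨w₁, hp⟩, hpU⟩ ⟨q, ⟨w₂, hq⟩, hqV⟩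
    obtain ⟨_, ⟨f, δ, hf, rfl⟩, hpf, hfU⟩ :=
      isTopologicalBasis_zariskiTopology.isOpen_iff.1 hU p hpU
    obtain ⟨_, ⟨g, ε, hg, rfl⟩, hqg, hgV⟩ :=
      isTopologicalBasis_zariskiTopology.isOpen_iff.1 hV q hqV
    have hfΦ : IsPolyFun fun w => eval (Function.uncurry (Φ w)) f :=
      IsPolyFun.eval f fun ki => hΦ ki.1 ki.2
    have hgΦ : IsPolyFun fun w => eval (Function.uncurry (Φ w)) g :=
      IsPolyFun.eval g fun ki => hΦ ki.1 ki.2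
    obtain ⟨w₀, hw₀⟩ := hfΦ.exists_ne_zero_and hgΦ
      ⟨w₁, (hf.evalAt_ne_zero_iff hp).1 hpf⟩ ⟨w₂, (hg.evalAt_ne_zero_iff hq).1 hqg⟩
    obtain ⟨w, hfg, hw⟩ := (hfΦ.mul hgΦ).exists_ne_zero_and_forall_ne_zero hΦ
      ⟨w₀, mul_ne_zero_iff.2 hw₀⟩ hne
    obtain ⟨r, hr⟩ := exists_representsTuple hw
    exact ⟨r, ⟨w, hr⟩, hfU ((hf.evalAt_ne_zero_iff hr).2 (left_ne_zero_of_mul hfg)),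
      hgV ((hg.evalAt_ne_zero_iff hr).2 (right_ne_zero_of_mul hfg))⟩

variable [Finite κ]

instance irreducibleSpace_multiP2 : IrreducibleSpace (MultiP2 κ) := by
  have hirr := isIrreducible_setOf_exists_representsTuple (Φ := fun w : κ → Fin 3 → ℂ => w)
    IsPolyFun.coord ⟨1, fun _ => one_ne_zero⟩
  have huniv : {p : MultiP2 κ | ∃ w, RepresentsTuple p w} = Set.univ :=
    Set.eq_univ_of_forall fun p => ⟨_, representsTuple_rep p⟩
  rw [huniv] at hirr
  exact { isPreirreducible_univ := hirr.2, toNonempty := ⟨hirr.1.some⟩ }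

theorem IsPolyFun.generically {g : (κ → Fin 3 → ℂ) → ℂ} (hg : IsPolyFun g)
    (hne : ∃ v, g v ≠ 0) {P : MultiP2 κ → Prop}
    (h : ∀ p v, RepresentsTuple p v → g v ≠ 0 → P p) : Generically P := by
  obtain ⟨v, hgv, hv⟩ := hg.exists_ne_zero_and_forall_ne_zero IsPolyFun.coord hne
    ⟨1, fun _ => one_ne_zero⟩
  obtain ⟨p, hp⟩ := exists_representsTuple hv
  exact ⟨_, hg.isOpen_setOf_exists_ne_zero, hg.isOpen_setOf_exists_ne_zero.dense ⟨p, v, hp, hgv⟩,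
    fun q ⟨w, hw, hgw⟩ => h q w hw hgw⟩

theorem continuous_of_isPolyFun {κ' : Type} [Finite κ'] {S : Set (MultiP2 κ)}
    {F : S → MultiP2 κ'} {Φ : (κ → Fin 3 → ℂ) → κ' → Fin 3 → ℂ}
    (hΦ : ∀ k i, IsPolyFun fun w => Φ w k i)
    (hF : ∀ (p : S) w, RepresentsTuple p.1 w → RepresentsTuple (F p) (Φ w)) :
    Continuous F := by
  rw [isTopologicalBasis_zariskiTopology.continuous_iff]
  rintro _ ⟨f, δ, hf, rfl⟩
  have hfΦ : IsPolyFun fun w => eval (Function.uncurry (Φ w)) f :=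
    IsPolyFun.eval f fun ki => hΦ ki.1 ki.2
  convert hfΦ.isOpen_setOf_exists_ne_zero.preimage
    (continuous_subtype_val (p := (· ∈ S))) using 1
  ext p
  exact ⟨fun hp => ⟨_, representsTuple_rep _,
      (hf.evalAt_ne_zero_iff (hF p _ (representsTuple_rep _))).1 hp⟩,
    fun ⟨v, hv, hne⟩ => (hf.evalAt_ne_zero_iff (hF p v hv)).2 hne⟩

end ZariskiTopology

section Curves

theorem exists_eval_eq_zero_and_ne_zero_of_not_dvd {K σ : Type*} [Field K] [IsAlgClosed K]
    [Finite σ] {Q f : MvPolynomial σ K} (hQ : Irreducible Q) (h : ¬ Q ∣ f) :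
    ∃ v, eval v Q = 0 ∧ eval v f ≠ 0 := by
  have hprime : (Ideal.span {Q}).IsPrime :=
    (Ideal.span_singleton_prime hQ.ne_zero).2 hQ.prime
  by_contra! hf
  refine h (Ideal.mem_span_singleton.1 ?_)
  rw [← IsPrime.vanishingIdeal_zeroLocus (K := K) (Ideal.span {Q}), mem_vanishingIdeal_iff]
  intro v hv
  have hQv : aeval v Q = 0 := mem_zeroLocus_iff.1 hv Q (Ideal.mem_span_singleton_self Q)
  simp only [aeval_eq_eval] at hQv ⊢
  exact hf v hQv

theorem exists_irreducible_dvd_eval_eq_zero {K σ : Type*} [Field K] {Q : MvPolynomial σ K}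
    (hQ : Q ≠ 0) {v : σ → K} (hv : eval v Q = 0) :
    ∃ P, Irreducible P ∧ P ∣ Q ∧ eval v P = 0 := by
  induction Q using WfDvdMonoid.induction_on_irreducible with
  | zero => exact absurd rfl hQ
  | unit u hu => exact absurd hv (hu.map (eval v)).ne_zero
  | mul a i ha hi ih =>
    rw [map_mul, mul_eq_zero] at hv
    rcases hv with hiv | hav
    · exact ⟨i, hi, dvd_mul_right _ _, hiv⟩
    · obtain ⟨P, hP, hPa, hPv⟩ := ih ha hav
      exact ⟨P, hP, hPa.mul_left _, hPv⟩

variable {K σ : Type*} [Fintype σ]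

section LinearForms

/-- The linear form with coefficient vector `l`. -/
noncomputable def linForm [CommSemiring K] (l : σ → K) : MvPolynomial σ K := ∑ i, C (l i) * X i

theorem eval_linForm [CommSemiring K] (l v : σ → K) : eval v (linForm l) = l ⬝ᵥ v := by
  simp [linForm, dotProduct]

theorem linForm_smul [CommSemiring K] (c : K) (l : σ → K) :
    linForm (c • l) = C c * linForm l := by
  simp [linForm, Finset.mul_sum, mul_assoc]

theorem linForm_injective [CommSemiring K] :
    Function.Injective (linForm : (σ → K) → MvPolynomial σ K) := by
  intro l m h
  refine dotProduct_eq l m fun v => ?_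
  rw [← eval_linForm, ← eval_linForm, h]

theorem totalDegree_linForm_le [CommSemiring K] [Nontrivial K] (l : σ → K) :
    (linForm l).totalDegree ≤ 1 := by
  refine totalDegree_finsetSum_le fun i _ => (totalDegree_mul _ _).trans ?_
  rw [totalDegree_C, totalDegree_X, zero_add]

theorem exists_linForm_eq_C_mul_of_dvd [Field K] {Q : MvPolynomial σ K} (hQ : Irreducible Q)
    {l : σ → K} (hl : l ≠ 0) (h : Q ∣ linForm l) : ∃ c : K, c ≠ 0 ∧ linForm l = C c * Q := by
  obtain ⟨r, hr⟩ := h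
  have hlin : linForm l ≠ 0 := fun h0 =>
    hl (linForm_injective (h0.trans (by simp [linForm])))
  have hr0 : r ≠ 0 := right_ne_zero_of_mul (hr ▸ hlin)
  have hdeg := totalDegree_mul_of_isDomain hQ.ne_zero hr0
  have hQdeg : Q.totalDegree ≠ 0 := fun h0 => by
    rw [totalDegree_eq_zero_iff_eq_C] at h0
    refine hQ.not_isUnit (h0 ▸ IsUnit.map C (isUnit_iff_ne_zero.2 fun hc => hQ.ne_zero ?_))
    rw [h0, hc, C_0]
  have hrC : r = C (coeff 0 r) := by
    rw [← totalDegree_eq_zero_iff_eq_C]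
    have := totalDegree_linForm_le l
    rw [hr] at this
    omega
  refine ⟨coeff 0 r, fun hc => hr0 (by rw [hrC, hc, C_0]), ?_⟩
  rw [hr, mul_comm, ← hrC]

theorem exists_dotProduct_eq_zero_and_not_dvd_linForm [Field K] (hσ : 3 ≤ Fintype.card σ)
    {Q : MvPolynomial σ K} (hQ : Irreducible Q) (v : σ → K) :
    ∃ l, l ⬝ᵥ v = 0 ∧ ¬ Q ∣ linForm l := by
  let φ : (σ → K) →ₗ[K] K := (dotProductBilin K K).flip v
  have hker : 1 < Module.finrank K φ.ker := by
    have hrank := φ.finrank_range_add_finrank_ker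
    have hrange : Module.finrank K φ.range ≤ 1 :=
      φ.range.finrank_le.trans_eq (Module.finrank_self K)
    rw [Module.finrank_fintype_fun_eq_card] at hrank
    omega
  have : Nontrivial φ.ker := Module.nontrivial_of_finrank_pos (zero_lt_one.trans hker)
  obtain ⟨l, hl⟩ := exists_ne (0 : φ.ker)
  obtain ⟨m, hlm⟩ := exists_linearIndependent_pair_of_one_lt_finrank hker hl
  have hm : m ≠ 0 := hlm.ne_zero 1
  by_contra! hdvd
  obtain ⟨c, hc, hlQ⟩ := exists_linForm_eq_C_mul_of_dvd hQ (Subtype.coe_ne_coe.2 hl) (hdvd l l.2)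
  obtain ⟨d, -, hmQ⟩ := exists_linForm_eq_C_mul_of_dvd hQ (Subtype.coe_ne_coe.2 hm) (hdvd m m.2)
  have hsmul : linForm (d • (l : σ → K)) = linForm (c • (m : σ → K)) := by
    rw [linForm_smul, linForm_smul, hlQ, hmQ, mul_left_comm]
  refine hc (neg_eq_zero.1 (LinearIndependent.pair_iff.1 hlm d (-c) ?_).2)
  rw [neg_smul, ← sub_eq_add_neg, sub_eq_zero]
  exact Subtype.ext (linForm_injective hsmul)

end LinearForms

variable [Field K] [IsAlgClosed K] (hσ : 3 ≤ Fintype.card σ) {S : Set (Projectivization K (σ → K))}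
include hσ

theorem exists_eval_eq_zero_mk_notMem_of_irreducible (hS : S.Finite) {Q h : MvPolynomial σ K}
    (hQ : Irreducible Q) (hh : ¬ Q ∣ h) :
    ∃ (v : σ → K) (hv : v ≠ 0), eval v Q = 0 ∧ eval v h ≠ 0 ∧
      Projectivization.mk K v hv ∉ S := by
  choose l hl hlQ using exists_dotProduct_eq_zero_and_not_dvd_linForm hσ hQ
  -- A product of linear forms, none divisible by `Q`, vanishes at `0` and over `S`.
  have hnd : ¬ Q ∣ h * linForm (l 0) * ∏ p ∈ hS.toFinset, linForm (l p.rep) := by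
    rw [hQ.prime.dvd_mul, hQ.prime.dvd_mul, hQ.prime.dvd_finsetProd_iff]
    rintro ((hd | hd) | ⟨p, -, hd⟩)
    exacts [hh hd, hlQ _ hd, hlQ _ hd]
  obtain ⟨v, hQv, hv⟩ := exists_eval_eq_zero_and_ne_zero_of_not_dvd hQ hnd
  simp only [map_mul, map_prod, eval_linForm, mul_ne_zero_iff, Finset.prod_ne_zero_iff] at hv
  obtain ⟨⟨hhv, hv0⟩, hvS⟩ := hv
  have hv : v ≠ 0 := by rintro rfl; exact hv0 (dotProduct_zero _)
  refine ⟨v, hv, hQv, hhv, fun hmem => hvS _ (hS.mem_toFinset.2 hmem) ?_⟩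
  obtain ⟨a, ha⟩ := Projectivization.exists_smul_eq_mk_rep K v hv
  rw [← smul_eq_zero_iff_eq a, ← dotProduct_smul, ha, hl]

theorem exists_eval_eq_zero_mk_notMem (hS : S.Finite) {Q h : MvPolynomial σ K} {v : σ → K}
    (hQv : eval v Q = 0) (hhv : eval v h ≠ 0) :
    ∃ (w : σ → K) (hw : w ≠ 0), eval w Q = 0 ∧ eval w h ≠ 0 ∧
      Projectivization.mk K w hw ∉ S := by
  wlog hQ : Q ≠ 0 generalizing Q
  · obtain ⟨i⟩ : Nonempty σ := Fintype.card_pos_iff.1 (by omega)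
    have hX : (X i - C (v i) : MvPolynomial σ K) ≠ 0 := fun h0 => by
      have := congrArg (eval fun _ => v i + 1) h0
      simp at this
    obtain ⟨w, hw, -, h2⟩ := this (Q := X i - C (v i)) (by simp) hX
    exact ⟨w, hw, by rw [not_not.1 hQ, map_zero], h2⟩
  obtain ⟨P, hP, ⟨r, rfl⟩, hPv⟩ := exists_irreducible_dvd_eval_eq_zero hQ hQv
  have hnd : ¬ P ∣ h := by
    rintro ⟨s, rfl⟩
    exact hhv (by rw [map_mul, hPv, zero_mul])
  obtain ⟨w, hw, hPw, hwh⟩ := exists_eval_eq_zero_mk_notMem_of_irreducible hσ hS hP hnd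
  exact ⟨w, hw, by rw [map_mul, hPw, zero_mul], hwh⟩

theorem isUnit_of_forall_dvd_of_finite {τ : Type*} {f : τ → MvPolynomial σ K}
    (hf : ∃ i, f i ≠ 0) (hS : S.Finite)
    (h : ∀ v (hv : v ≠ 0), (∀ i, eval v (f i) = 0) → Projectivization.mk K v hv ∈ S)
    {q : MvPolynomial σ K} (hq : ∀ i, q ∣ f i) : IsUnit q := by
  by_contra hu
  obtain ⟨i, hi⟩ := hf
  obtain ⟨Q, hQ, hQq⟩ := WfDvdMonoid.exists_irreducible_factor hu (ne_zero_of_dvd_ne_zero hi (hq i))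
  obtain ⟨v, hv, hQv, -, hvS⟩ := exists_eval_eq_zero_mk_notMem_of_irreducible hσ hS hQ
    (fun hd => hQ.not_isUnit (isUnit_of_dvd_one hd))
  refine hvS (h v hv fun j => ?_)
  obtain ⟨r, hr⟩ := hQq.trans (hq j)
  rw [hr, map_mul, hQv, zero_mul]

end Curves

section Dimension

variable {κ : Type}

/-- The ideal of the polynomials that vanish at all coordinate vectors of the points of `Z`. -/
noncomputable def coneIdeal (Z : Set (MultiP2 κ)) : Ideal (MvPolynomial (κ × Fin 3) ℂ) :=
  vanishingIdeal ℂ (Function.uncurry '' {v | ∃ p ∈ Z, RepresentsTuple p v})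

theorem mem_coneIdeal {Z : Set (MultiP2 κ)} {f : MvPolynomial (κ × Fin 3) ℂ} :
    f ∈ coneIdeal Z ↔ ∀ p ∈ Z, ∀ v, RepresentsTuple p v → eval (Function.uncurry v) f = 0 := by
  simp only [coneIdeal, mem_vanishingIdeal_iff, aeval_eq_eval, Set.forall_mem_image]
  exact ⟨fun h p hp v hv => h ⟨p, hp, hv⟩, fun h v ⟨p, hp, hv⟩ => h p hp v hv⟩

variable [Finite κ]

theorem scalingPoly_eq_zero_of_forall {f : MvPolynomial (κ × Fin 3) ℂ} {p : MultiP2 κ}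
    {v : κ → Fin 3 → ℂ} (hv : RepresentsTuple p v)
    (h : ∀ w, RepresentsTuple p w → eval (Function.uncurry w) f = 0) : scalingPoly f v = 0 := by
  by_contra hne
  obtain ⟨t, ht, hft⟩ := exists_smul_eval_ne_zero hne
  exact hft (h _ (hv.smul ht))

theorem isPrime_coneIdeal {Z : Set (MultiP2 κ)} (hZ : IsIrreducible Z) :
    (coneIdeal Z).IsPrime := by
  refine ⟨fun htop => ?_, fun {f g} hfg => ?_⟩
  · obtain ⟨p, hp⟩ := hZ.nonempty
    have hone := mem_coneIdeal.1 ((Ideal.eq_top_iff_one _).1 htop) p hp _ (representsTuple_rep p)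
    rw [map_one] at hone
    exact one_ne_zero hone
  · have hclosed (f : MvPolynomial (κ × Fin 3) ℂ) :
        IsClosed {p : MultiP2 κ | ∀ v, RepresentsTuple p v → eval (Function.uncurry v) f = 0} :=
      IsPolyFun.isClosed_setOf_forall_eq_zero ⟨f, fun _ => rfl⟩
    have hcover : Z ⊆ {p | ∀ v, RepresentsTuple p v → eval (Function.uncurry v) f = 0} ∪
        {p | ∀ v, RepresentsTuple p v → eval (Function.uncurry v) g = 0} := by
      intro p hp
      have hv := representsTuple_rep p
      have hprod := scalingPoly_eq_zero_of_forall hv (mem_coneIdeal.1 hfg p hp)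
      rw [scalingPoly, map_mul, mul_eq_zero] at hprod
      exact hprod.imp (fun h w hw => eval_eq_zero_of_scalingPoly_eq_zero hv h hw)
        fun h w hw => eval_eq_zero_of_scalingPoly_eq_zero hv h hw
    exact (isPreirreducible_iff_isClosed_union_isClosed.1 hZ.2 _ _ (hclosed f) (hclosed g)
      hcover).imp mem_coneIdeal.2 mem_coneIdeal.2

theorem coneIdeal_lt_coneIdeal {Z W : Set (MultiP2 κ)} (hZ : IsClosed Z) (h : Z ⊂ W) :
    coneIdeal W < coneIdeal Z := by
  refine SetLike.lt_iff_le_and_exists.2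
    ⟨fun f hf => mem_coneIdeal.2 fun p hp => mem_coneIdeal.1 hf p (h.subset hp), ?_⟩
  obtain ⟨p, hpW, hpZ⟩ := Set.exists_of_ssubset h
  obtain ⟨_, ⟨f, δ, hf, rfl⟩, hpf, hfZ⟩ :=
    isTopologicalBasis_zariskiTopology.isOpen_iff.1 hZ.isOpen_compl p hpZ
  refine ⟨f, mem_coneIdeal.2 fun q hq v hv => ?_, fun hfW => ?_⟩
  · exact not_not.1 fun hfv => hfZ ((hf.evalAt_ne_zero_iff hv).2 hfv) hq
  · have hp := representsTuple_rep p
    exact (hf.evalAt_ne_zero_iff hp).1 hpf (mem_coneIdeal.1 hfW p hpW _ hp)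

theorem coneIdeal_lt_ker_eval_zero [Nonempty κ] {Z : Set (MultiP2 κ)} (hZ : Z.Nonempty) :
    coneIdeal Z < RingHom.ker (eval (0 : κ × Fin 3 → ℂ)) := by
  obtain ⟨p, hp⟩ := hZ
  have hv := representsTuple_rep p
  refine SetLike.lt_iff_le_and_exists.2 ⟨fun f hf => ?_, ?_⟩
  · have hscaling := eval_scalingPoly f (fun k => (p k).rep) 0
    rw [scalingPoly_eq_zero_of_forall hv (mem_coneIdeal.1 hf p hp), map_zero] at hscaling
    have hzero : (Function.uncurry fun k => (0 : κ → ℂ) k • (p k).rep) = 0 :=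
      funext fun _ => zero_mul _
    rw [hzero] at hscaling
    exact hscaling.symm
  · obtain ⟨k⟩ := ‹Nonempty κ›
    obtain ⟨i, hi⟩ := Function.ne_iff.1 (p k).rep_nonzero
    refine ⟨X (k, i), by rw [RingHom.mem_ker, eval_X, Pi.zero_apply], fun hX => hi ?_⟩
    have hki := mem_coneIdeal.1 hX p hp _ hv
    rwa [eval_X] at hki

theorem topologicalKrullDim_multiP2_unit_le : topologicalKrullDim (MultiP2 Unit) ≤ 2 := by
  let R := MvPolynomial (Unit × Fin 3) ℂ
  have hdim : ringKrullDim R = 3 := by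
    rw [MvPolynomial.ringKrullDim_of_isNoetherianRing, ringKrullDim_eq_zero_of_field]
    simp
  let F : TopologicalSpace.IrreducibleCloseds (MultiP2 Unit) → (PrimeSpectrum R)ᵒᵈ := fun Z =>
    OrderDual.toDual ⟨coneIdeal (Z : Set (MultiP2 Unit)), isPrime_coneIdeal Z.isIrreducible⟩
  have hF : StrictMono F := fun Z W h => coneIdeal_lt_coneIdeal Z.isClosed h
  let m : (PrimeSpectrum R)ᵒᵈ := OrderDual.toDual ⟨RingHom.ker (eval (0 : Unit × Fin 3 → ℂ)),
    RingHom.ker_isPrime _⟩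
  refine iSup_le fun s => ?_
  -- The ideal of the vertex of the cone makes a chain in the plane one step longer in the ring.
  have hm : m < (s.map F hF).head := coneIdeal_lt_ker_eval_zero s.head.isIrreducible.nonempty
  have hlength := Order.LTSeries.length_le_krullDim ((s.map F hF).cons m hm)
  rw [Order.krullDim_orderDual, ← ringKrullDim, hdim, RelSeries.cons_length] at hlength
  have : s.length + 1 ≤ 3 := by exact_mod_cast hlength
  exact_mod_cast (by omega : s.length ≤ 2)

end Dimension

theorem exists_eq_smul_of_crossProduct_eq_zero {K : Type*} [Field K] {v w : Fin 3 → K}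
    (hv : v ≠ 0) (h : crossProduct v w = 0) : ∃ t : K, w = t • v := by
  by_contra! hw
  have hli : LinearIndependent K ![v, w] := (LinearIndependent.pair_iff' hv).2 fun t => (hw t).symm
  exact crossProduct_ne_zero_iff_linearIndependent.2 hli h

theorem exists_eq_smul_crossProduct_of_dotProduct_eq_zero {K : Type*} [Field K]
    {u v w : Fin 3 → K} (huv : crossProduct u v ≠ 0) (hu : u ⬝ᵥ w = 0) (hv : v ⬝ᵥ w = 0) :
    ∃ t : K, w = t • crossProduct u v := by
  refine exists_eq_smul_of_crossProduct_eq_zero huv ?_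
  rw [cross_cross_eq_smul_sub_smul, hu, hv, zero_smul, zero_smul, sub_zero]

theorem eval_smul_of_isHomogeneous {R σ : Type*} [CommSemiring R] {f : MvPolynomial σ R} {n : ℕ}
    (hf : f.IsHomogeneous n) (t : R) (v : σ → R) : eval (t • v) f = t ^ n * eval v f := by
  rw [eval_eq, eval_eq, Finset.mul_sum]
  refine Finset.sum_congr rfl fun m hm => ?_
  simp only [hf.degree_eq_sum_deg_support hm, Pi.smul_apply, smul_eq_mul, mul_pow,
    Finset.prod_mul_distrib, Finset.prod_pow_eq_pow_sum]
  rw [mul_left_comm]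

namespace Represents

variable {p : P2} {v w : Fin 3 → ℂ}

theorem crossProduct_eq_zero (hv : Represents p v) (hw : Represents p w) :
    crossProduct v w = 0 := by
  obtain ⟨t, -, rfl⟩ := hv.exists_smul hw
  rw [map_smul, cross_self, smul_zero]

theorem of_crossProduct_eq_zero (hv : Represents p v) (hw : w ≠ 0) (h : crossProduct v w = 0) :
    Represents p w := by
  obtain ⟨t, rfl⟩ := exists_eq_smul_of_crossProduct_eq_zero hv.ne_zero h
  exact hv.smul (left_ne_zero_of_smul hw)

end Represents

namespace PlaneRationalMap

variable {φ : PlaneRationalMap} {p q : P2} {v : Fin 3 → ℂ}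

theorem evalVec_smul (φ : PlaneRationalMap) (t : ℂ) (v : Fin 3 → ℂ) :
    φ.evalVec (t • v) = t ^ φ.degree • φ.evalVec v :=
  funext fun i => eval_smul_of_isHomogeneous (φ.homogeneous i) t v

theorem mem_domain_iff (hv : Represents p v) : p ∈ φ.domain ↔ φ.evalVec v ≠ 0 := by
  obtain ⟨t, ht, rfl⟩ := (represents_rep p).exists_smul hv
  rw [evalVec_smul, smul_ne_zero_iff, and_iff_right (pow_ne_zero _ ht)]
  rfl

theorem sends_iff (hv : Represents p v) : φ.Sends p q ↔ Represents q (φ.evalVec v) := by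
  obtain ⟨t, ht, rfl⟩ := (represents_rep p).exists_smul hv
  rw [evalVec_smul, Represents.smul_iff (pow_ne_zero _ ht)]
  rfl

theorem Sends.mem_domain (h : φ.Sends p q) : p ∈ φ.domain := h.ne_zero

theorem isPolyFun_evalVec (φ : PlaneRationalMap) {κ : Type} {g : (κ → Fin 3 → ℂ) → Fin 3 → ℂ}
    (hg : ∀ i, IsPolyFun fun v => g v i) (i : Fin 3) : IsPolyFun fun v => φ.evalVec (g v) i :=
  IsPolyFun.eval (φ.form i) hg

/-- The identity of the plane. -/
noncomputable def identity : PlaneRationalMap where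
  degree := 1
  form := X
  homogeneous := isHomogeneous_X ℂ
  reduced _ hq := isUnit_of_forall_dvd_of_finite (by simp) ⟨0, X_ne_zero 0⟩ Set.finite_empty
    (fun v hv h => hv (funext fun i => (eval_X i).symm.trans (h i))) hq

theorem evalVec_identity (v : Fin 3 → ℂ) : identity.evalVec v = v :=
  funext fun i => eval_X i

theorem identity_sends : identity.Sends p q ↔ p = q := by
  rw [Sends, evalVec_identity]
  exact ⟨fun h => (represents_rep p).unique h, fun h => h ▸ represents_rep p⟩

theorem mem_identity_domain (p : P2) : p ∈ identity.domain := (identity_sends.2 rfl).mem_domain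

end PlaneRationalMap

instance t1Space_multiP2 {κ : Type} [Finite κ] : T1Space (MultiP2 κ) where
  t1 p := by
    have hsingleton : ({p} : Set (MultiP2 κ)) = ⋂ (k : κ) (i : Fin 3),
        {q | ∀ v, RepresentsTuple q v → crossProduct (p k).rep (v k) i = 0} := by
      ext q
      simp only [Set.mem_singleton_iff, Set.mem_iInter, Set.mem_ofPred_eq]
      refine ⟨?_, fun h => funext fun k => (represents_rep (q k)).unique ?_⟩
      · rintro rfl k i v hv
        rw [(represents_rep (q k)).crossProduct_eq_zero (hv k), Pi.zero_apply]
      · exact (represents_rep (p k)).of_crossProduct_eq_zero (q k).rep_nonzero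
          (funext fun i => h k i _ (representsTuple_rep q))
    rw [hsingleton]
    exact isClosed_iInter fun k => isClosed_iInter fun i =>
      (IsPolyFun.crossProduct (fun j => .const ((p k).rep j)) (.coord k) i)
        |>.isClosed_setOf_forall_eq_zero

theorem isOpen_setOf_mem_domain {κ : Type} [Finite κ] (φ : PlaneRationalMap) (k : κ) :
    IsOpen {e : MultiP2 κ | e k ∈ φ.domain} := by
  have hunion : {e : MultiP2 κ | e k ∈ φ.domain} =
      ⋃ i, {e | ∃ v, RepresentsTuple e v ∧ φ.evalVec (v k) i ≠ 0} := by
    ext e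
    simp only [Set.mem_ofPred_eq, Set.mem_iUnion]
    refine ⟨fun he => ?_, fun ⟨i, v, hv, hi⟩ => ?_⟩
    · obtain ⟨i, hi⟩ := Function.ne_iff.1 he
      exact ⟨i, _, representsTuple_rep e, hi⟩
    · exact (PlaneRationalMap.mem_domain_iff (hv k)).2 (Function.ne_iff.2 ⟨i, hi⟩)
  rw [hunion]
  exact isOpen_iUnion fun i =>
    (φ.isPolyFun_evalVec (IsPolyFun.coord k) i).isOpen_setOf_exists_ne_zero

theorem exists_eval_eq_zero_notMem_of_isOpen {U : Set (MultiP2 (Fin 2))} (hU : IsOpen U) {a b : P2}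
    (hab : (![a, b] : MultiP2 (Fin 2)) ∈ U) {Q : MvPolynomial (Fin 3) ℂ} (hQ : eval b.rep Q = 0)
    {S : Set P2} (hS : S.Finite) :
    ∃ c w, Represents c w ∧ eval w Q = 0 ∧ c ∉ S ∧ (![a, c] : MultiP2 (Fin 2)) ∈ U := by
  obtain ⟨_, ⟨f, δ, hf, rfl⟩, hfab, hfU⟩ :=
    isTopologicalBasis_zariskiTopology.isOpen_iff.1 hU _ hab
  have hrep {c : P2} {w : Fin 3 → ℂ} (hw : Represents c w) :
      RepresentsTuple (![a, c] : MultiP2 (Fin 2)) ![a.rep, w] :=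
    Fin.forall_fin_two.2 ⟨represents_rep a, hw⟩
  obtain ⟨h, hh⟩ : ∃ h : MvPolynomial (Fin 3) ℂ,
      ∀ w, eval w h = eval (Function.uncurry ![a.rep, w]) f := by
    refine ⟨aeval (Function.uncurry ![fun i => C (a.rep i), X]) f, fun w => ?_⟩
    rw [eval_aeval_eq_eval]
    congr 2
    funext ⟨k, i⟩
    fin_cases k <;> simp [Function.uncurry]
  have hhb : eval b.rep h ≠ 0 := by
    rw [hh]
    exact (hf.evalAt_ne_zero_iff (hrep (represents_rep b))).1 hfab
  obtain ⟨w, hw, hQw, hhw, hwS⟩ := exists_eval_eq_zero_mk_notMem (by simp) hS hQ hhb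
  have hmk := represents_mk hw
  exact ⟨_, w, hmk, hQw, hwS, hfU ((hf.evalAt_ne_zero_iff (hrep hmk)).2 (hh w ▸ hhw))⟩

/-- `E` is a correspondence between two planes that is, up to finitely many points of each plane,
the graph of `φ 0` and of `φ 1`, and whose fibres over the base points of `φ 0` contain a curve
through each of their points. The last condition forces `E` to be the closure of that graph. -/
structure IsBirationalCorrespondence (E : Set (MultiP2 (Fin 2))) (φ : Fin 2 → PlaneRationalMap) :
    Prop where
  isClosed : IsClosed E
  mem_iff : ∀ k (e : MultiP2 (Fin 2)), e k ∈ (φ k).domain →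
    (e ∈ E ↔ (φ k).Sends (e k) (e k.rev))
  finite : ∀ k, ((φ k).domain)ᶜ.Finite
  curve : ∀ e ∈ E, e 0 ∉ (φ 0).domain → ∃ Q : MvPolynomial (Fin 3) ℂ, eval (e 1).rep Q = 0 ∧
    ∀ (w : Fin 3 → ℂ) (b : P2), Represents b w → eval w Q = 0 →
      (![e 0, b] : MultiP2 (Fin 2)) ∈ E
  exists_common : ∃ e ∈ E, ∀ k, e k ∈ (φ k).domain

namespace IsBirationalCorrespondence

variable {E : Set (MultiP2 (Fin 2))} {φ : Fin 2 → PlaneRationalMap}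

/-- The lift to coordinates of the map sending `p` to the pair with `k`-th entry `p` and other entry
`φ k p`. -/
noncomputable def graphLift (φ : Fin 2 → PlaneRationalMap) (k : Fin 2) (w : Fin 3 → ℂ) :
    Fin 2 → Fin 3 → ℂ := fun j => if j = k then w else (φ k).evalVec w

theorem isPolyFun_graphLift (φ : Fin 2 → PlaneRationalMap) (k : Fin 2) {κ : Type}
    {g : (κ → Fin 3 → ℂ) → Fin 3 → ℂ} (hg : ∀ i, IsPolyFun fun v => g v i) (j : Fin 2)
    (i : Fin 3) : IsPolyFun fun v => graphLift φ k (g v) j i := by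
  unfold graphLift
  split_ifs
  · exact hg i
  · exact (φ k).isPolyFun_evalVec hg i

theorem representsTuple_graphLift {k : Fin 2} {w : Fin 3 → ℂ} {e : MultiP2 (Fin 2)} :
    RepresentsTuple e (graphLift φ k w) ↔
      Represents (e k) w ∧ (φ k).Sends (e k) (e k.rev) := by
  have hpair : RepresentsTuple e (graphLift φ k w) ↔
      Represents (e k) w ∧ Represents (e k.rev) ((φ k).evalVec w) := by
    unfold RepresentsTuple graphLift
    rw [Fin.forall_fin_two]
    fin_cases k
    · rfl
    · exact and_comm
  rw [hpair]
  exact and_congr_right fun hw => (PlaneRationalMap.sends_iff hw).symm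

/-- The part of `E` that is the graph of `φ k`. -/
def graphPart (E : Set (MultiP2 (Fin 2))) (φ : Fin 2 → PlaneRationalMap) (k : Fin 2) :
    Set (MultiP2 (Fin 2)) := {e ∈ E | e k ∈ (φ k).domain}

variable (hE : IsBirationalCorrespondence E φ)
include hE

theorem graphPart_eq (k : Fin 2) :
    graphPart E φ k = {e | ∃ w : Unit → Fin 3 → ℂ, RepresentsTuple e (graphLift φ k (w ()))} := by
  ext e
  simp only [graphPart, Set.mem_ofPred_eq, representsTuple_graphLift]
  exact ⟨fun ⟨he, hdom⟩ => ⟨fun _ => (e k).rep, represents_rep _, (hE.mem_iff k e hdom).1 he⟩,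
    fun ⟨_, _, hsends⟩ => ⟨(hE.mem_iff k e hsends.mem_domain).2 hsends, hsends.mem_domain⟩⟩

theorem isIrreducible_graphPart (k : Fin 2) : IsIrreducible (graphPart E φ k) := by
  obtain ⟨e, he, hdom⟩ := hE.exists_common
  have hmem : e ∈ graphPart E φ k := ⟨he, hdom k⟩
  rw [hE.graphPart_eq k] at hmem ⊢
  obtain ⟨w, hw⟩ := hmem
  exact isIrreducible_setOf_exists_representsTuple
    (isPolyFun_graphLift φ k (IsPolyFun.coord ())) ⟨w, fun j => (hw j).ne_zero⟩

theorem graphPart_subset_closure (k j : Fin 2) : graphPart E φ k ⊆ closure (graphPart E φ j) := by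
  obtain ⟨e, he, hdom⟩ := hE.exists_common
  refine (subset_closure_inter_of_isPreirreducible_of_isOpen
    (hE.isIrreducible_graphPart k).isPreirreducible (isOpen_setOf_mem_domain (φ j) j)
    ⟨e, ⟨he, hdom k⟩, hdom j⟩).trans (closure_mono fun e he => ⟨he.1.1, he.2⟩)

theorem subset_closure_graphPart (k : Fin 2) : E ⊆ closure (graphPart E φ k) := by
  suffices E ⊆ closure (graphPart E φ 1) from
    this.trans (closure_minimal (hE.graphPart_subset_closure 1 k) isClosed_closure)
  intro e he
  by_cases hdom : e 0 ∈ (φ 0).domain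
  · exact hE.graphPart_subset_closure 0 1 ⟨he, hdom⟩
  · obtain ⟨Q, hQe, hQE⟩ := hE.curve e he hdom
    refine mem_closure_iff.2 fun U hU heU => ?_
    have hpair : (![e 0, e 1] : MultiP2 (Fin 2)) = e :=
      _root_.funext (Fin.forall_fin_two.2 ⟨rfl, rfl⟩)
    obtain ⟨c, w, hw, hQw, hc, hcU⟩ :=
      exists_eval_eq_zero_notMem_of_isOpen hU (hpair ▸ heU) hQe (hE.finite 1)
    exact ⟨_, hcU, hQE w c hw hQw, not_not.1 hc⟩

theorem eq_closure_graphPart (k : Fin 2) : E = closure (graphPart E φ k) :=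
  (hE.subset_closure_graphPart k).antisymm (closure_minimal (fun _ he => he.1) hE.isClosed)

theorem isIrreducible : IsIrreducible E := by
  rw [hE.eq_closure_graphPart 0]
  exact (hE.isIrreducible_graphPart 0).closure

theorem isRationalInverse (k : Fin 2) : IsRationalInverse E k
    (fun j => if j = k then PlaneRationalMap.identity else φ k) := by
  have hrev : ∀ j : Fin 2, j ≠ k → j = k.rev := by revert k; decide
  have hne : k.rev ≠ k := by revert k; decide
  refine ⟨fun p e hsends => ?_, ?_, fun e he hdom j => ?_⟩
  · have hk := hsends k
    have hkrev := hsends k.rev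
    simp only [if_true, PlaneRationalMap.identity_sends] at hk
    simp only [if_neg hne, hk] at hkrev
    exact ⟨(hE.mem_iff k e hkrev.mem_domain).2 hkrev, hk.symm⟩
  · refine (hE.subset_closure_graphPart k).trans (closure_mono fun e he => ⟨he.1, fun j => ?_⟩)
    dsimp only
    split_ifs
    · exact PlaneRationalMap.mem_identity_domain _
    · exact he.2
  · have hkrev := hdom k.rev
    simp only [if_neg hne] at hkrev
    dsimp only
    split_ifs with hj
    · rw [hj, PlaneRationalMap.identity_sends]
    · rw [hrev j hj]
      exact (hE.mem_iff k e hkrev).1 he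

theorem isLeftInverse (k : Fin 2) : (φ k.rev).IsLeftInverse (φ k) := by
  refine ⟨?_, fun p q hpq hq => ?_⟩
  · obtain ⟨e, he, hdom⟩ := hE.exists_common
    exact ⟨e k, e k.rev, (hE.mem_iff k e (hdom k)).1 he, hdom k.rev⟩
  · obtain ⟨e, rfl, rfl⟩ : ∃ e : MultiP2 (Fin 2), e k = p ∧ e k.rev = q := by
      fin_cases k
      · exact ⟨(![p, q] : Fin 2 → P2), rfl, rfl⟩
      · exact ⟨(![q, p] : Fin 2 → P2), rfl, rfl⟩
    have hsends := (hE.mem_iff k.rev e hq).1 ((hE.mem_iff k e hpq.mem_domain).2 hpq)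
    rwa [Fin.rev_rev] at hsends

theorem isCremona : (φ 0).IsCremona := ⟨φ 1, hE.isLeftInverse 0, hE.isLeftInverse 1⟩

end IsBirationalCorrespondence

section KrullDimension

open TopologicalSpace Topology

variable {X : Type*} [TopologicalSpace X] [T1Space X]

theorem infinite_of_irreducibleCloseds_lt {Z W : IrreducibleCloseds X} (hZW : Z < W) :
    (W : Set X).Infinite := by
  intro hfin
  obtain ⟨x, hxW, hxZ⟩ := Set.exists_of_ssubset (SetLike.coe_ssubset_coe.2 hZW)
  obtain ⟨z, hz⟩ := Z.isIrreducible.nonempty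
  have hsub : (W : Set X).Subsingleton :=
    hfin.isDiscrete.subsingleton_of_isPreirreducible W.isIrreducible.isPreirreducible
  exact hxZ (hsub hxW (hZW.le hz) ▸ hz)

theorem topologicalKrullDim_le_of_isOpen_of_finite_compl_iUnion {ι : Type*} {U : ι → Set X}
    (hU : ∀ i, IsOpen (U i)) (hfin : (⋃ i, U i)ᶜ.Finite) {n : ℕ}
    (hdim : ∀ i, topologicalKrullDim (U i) ≤ n) : topologicalKrullDim X ≤ n := by
  classical
  refine iSup_le fun s => ?_
  rcases Nat.eq_zero_or_pos s.length with hlen | hlen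
  · simp [hlen]
  let one : Fin (s.length + 1) := ⟨1, by omega⟩
  have hone : s 0 < s one := s.strictMono (Fin.lt_def.2 one_pos)
  have hinf := infinite_of_irreducibleCloseds_lt hone
  obtain ⟨e, he, hecompl⟩ := hinf.exists_notMem_finite hfin
  obtain ⟨i, hei⟩ := Set.mem_iUnion.1 (not_not.1 hecompl)
  have hle : ∀ j, j ≠ 0 → s one ≤ s j := fun j hj =>
    s.monotone (Fin.le_def.2 (Nat.one_le_iff_ne_zero.2 (Fin.val_ne_zero_iff.2 hj)))
  have hlt : ({e} : IrreducibleCloseds X) < s one := by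
    refine lt_of_le_of_ne (fun x hx => IrreducibleCloseds.mem_singleton.1 hx ▸ he) fun heq => ?_
    exact hinf (heq ▸ Set.finite_singleton e)
  -- Replacing the smallest term by the point `e` gives a chain all of whose terms meet `U i`.
  let t : Fin (s.length + 1) → IrreducibleCloseds X := fun j => if j = 0 then {e} else s j
  have ht : StrictMono t := by
    intro j k hjk
    have hk : k ≠ 0 := (Fin.zero_le j |>.trans_lt hjk).ne'
    simp only [t, if_neg hk]
    split_ifs
    · exact hlt.trans_le (hle k hk)
    · exact s.strictMono hjk
  have het : ∀ j, e ∈ t j := by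
    intro j
    simp only [t]
    split_ifs with hj
    · exact IrreducibleCloseds.mem_singleton.2 rfl
    · exact hle j hj he
  let I := IrreducibleCloseds.orderIsoOfIsOpenEmbedding _ (hU i).isOpenEmbedding_subtypeVal
  let c : LTSeries (IrreducibleCloseds (U i)) :=
    LTSeries.mk s.length (fun j => I.symm ⟨t j, ⟨e, hei⟩, het j⟩) fun j k hjk =>
      I.symm.strictMono (ht hjk)
  exact (Order.LTSeries.length_le_krullDim c).trans (hdim i)

theorem two_le_topologicalKrullDim_of_ssubset {Y Z : Set X} (hY : IsIrreducible Y) (hZY : Z ⊂ Y)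
    (hZ : IsIrreducible Z) (hclosed : IsClosed Z) (hnontrivial : Z.Nontrivial) :
    2 ≤ topologicalKrullDim Y := by
  obtain ⟨z, hz, w, hw, hwz⟩ := hnontrivial
  obtain ⟨y, hy, hyZ⟩ := Set.exists_of_ssubset hZY
  have := Subtype.irreducibleSpace hY
  have := Subtype.irreducibleSpace hZ
  have hirr : IsIrreducible {y : Y | (y : X) ∈ Z} := by
    rw [← Set.range_inclusion hZY.subset, ← Set.image_univ]
    exact (IrreducibleSpace.isIrreducible_univ Z).image _
      (continuous_inclusion hZY.subset).continuousOn
  let C₁ : IrreducibleCloseds Y := ⟨_, hirr, hclosed.preimage continuous_subtype_val⟩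
  let C₂ : IrreducibleCloseds Y := ⟨_, IrreducibleSpace.isIrreducible_univ Y, isClosed_univ⟩
  let C₀ : IrreducibleCloseds Y := {⟨z, hZY.subset hz⟩}
  have h₀₁ : C₀ < C₁ := by
    refine SetLike.lt_iff_le_and_exists.2
      ⟨fun x hx => ?_, ⟨w, hZY.subset hw⟩, hw, fun hwz' => hwz ?_⟩
    · rw [IrreducibleCloseds.mem_singleton.1 hx]
      exact hz
    · exact (congrArg Subtype.val (IrreducibleCloseds.mem_singleton.1 hwz')).symm
  have h₁₂ : C₁ < C₂ :=
    SetLike.lt_iff_le_and_exists.2 ⟨fun _ _ => trivial, ⟨y, hy⟩, trivial, hyZ⟩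
  let c : LTSeries (IrreducibleCloseds Y) := (RelSeries.singleton _ C₂).cons C₁ h₁₂
  exact Order.LTSeries.length_le_krullDim (c.cons C₀ h₀₁)

end KrullDimension

theorem exists_crossProduct_ne_zero {R : Type*} [CommRing R] {a : Fin 3 → R} (ha : a ≠ 0) :
    ∃ c, crossProduct a c ≠ 0 := by
  by_contra! h
  have he₀ := h (Pi.single 0 1)
  have he₁ := h (Pi.single 1 1)
  rw [cross_apply] at he₀ he₁
  refine ha (funext fun i => ?_)
  fin_cases i
  · simpa using congrFun he₁ 2
  · simpa using congrFun he₀ 2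
  · simpa using congrFun he₀ 1

theorem exists_dotProduct_crossProduct_ne_zero {R : Type*} [CommRing R] {a : Fin 3 → R}
    (ha : a ≠ 0) : ∃ c d, a ⬝ᵥ crossProduct c d ≠ 0 := by
  obtain ⟨c, hc⟩ := exists_crossProduct_ne_zero ha
  obtain ⟨i, hi⟩ := Function.ne_iff.1 hc
  refine ⟨c, Pi.single i 1, ?_⟩
  rw [← triple_product_permutation, single_one_dotProduct]
  exact hi

theorem onLine_iff {l p : P2} {u v : Fin 3 → ℂ} (hu : Represents l u) (hv : Represents p v) :
    OnLine l p ↔ u ⬝ᵥ v = 0 := by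
  obtain ⟨s, hs, rfl⟩ := (represents_rep l).exists_smul hu
  obtain ⟨t, ht, rfl⟩ := (represents_rep p).exists_smul hv
  simp [OnLine, hs, ht]

theorem onLine_and_onLine_iff {l m p : P2} {u v : Fin 3 → ℂ} (hu : Represents l u)
    (hv : Represents m v) (huv : crossProduct u v ≠ 0) :
    OnLine l p ∧ OnLine m p ↔ Represents p (crossProduct u v) := by
  have hp := represents_rep p
  rw [onLine_iff hu hp, onLine_iff hv hp]
  refine ⟨fun ⟨hup, hvp⟩ => ?_, fun hcross => ?_⟩
  · obtain ⟨t, ht⟩ := exists_eq_smul_crossProduct_of_dotProduct_eq_zero huv hup hvp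
    have ht0 : t ≠ 0 := left_ne_zero_of_smul (ht ▸ hp.ne_zero)
    rwa [ht, Represents.smul_iff ht0] at hp
  · obtain ⟨c, -, hc⟩ := hcross.exists_smul hp
    simp [hc]

namespace IsBirationalCorrespondence

open TopologicalSpace Topology

variable {E : Set (MultiP2 (Fin 2))} {φ : Fin 2 → PlaneRationalMap}

theorem exists_representsTuple_graphLift {k : Fin 2} {w : Fin 3 → ℂ} (hw : w ≠ 0)
    (hφw : (φ k).evalVec w ≠ 0) : ∃ e, RepresentsTuple e (graphLift φ k w) :=
  exists_representsTuple fun j => by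
    unfold graphLift
    split_ifs
    · exact hw
    · exact hφw

theorem exists_representsTuple_graphLift_dotProduct_ne_zero {k : Fin 2} {κ : Type}
    {g : (κ → Fin 3 → ℂ) → Fin 3 → ℂ} (hg : ∀ i, IsPolyFun fun v => g v i)
    (hφg : ∃ v, (φ k).evalVec (g v) ≠ 0) {l : Fin 3 → ℂ} (hlg : ∃ v, l ⬝ᵥ g v ≠ 0) :
    ∃ v e, RepresentsTuple e (graphLift φ k (g v)) ∧ l ⬝ᵥ g v ≠ 0 := by
  obtain ⟨v₀, hv₀⟩ := hφg
  obtain ⟨i, hi⟩ := Function.ne_iff.1 hv₀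
  obtain ⟨v, hφv, hlv⟩ := ((φ k).isPolyFun_evalVec hg i).exists_ne_zero_and
    (IsPolyFun.dotProduct (fun j => .const (l j)) hg) ⟨v₀, hi⟩ hlg
  obtain ⟨e, he⟩ := exists_representsTuple_graphLift (φ := φ) (k := k) (w := g v)
    (fun h => hlv (by rw [h, dotProduct_zero])) (Function.ne_iff.2 ⟨i, hφv⟩)
  exact ⟨v, e, he, hlv⟩

/-- The graph of `φ k` over the line through `a` and `c`. -/
def lineGraph (φ : Fin 2 → PlaneRationalMap) (k : Fin 2) (a c : Fin 3 → ℂ) :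
    Set (MultiP2 (Fin 2)) :=
  {p | ∃ w : Unit → Fin 3 → ℂ, RepresentsTuple p (graphLift φ k (w () 0 • a + w () 1 • c))}

theorem isPolyFun_line (a c : Fin 3 → ℂ) (i : Fin 3) :
    IsPolyFun fun w : Unit → Fin 3 → ℂ => (w () 0 • a + w () 1 • c) i :=
  ((IsPolyFun.coord () 0).mul (.const (a i))).add ((IsPolyFun.coord () 1).mul (.const (c i)))

theorem isIrreducible_lineGraph {k : Fin 2} {a c : Fin 3 → ℂ}
    (hne : (lineGraph φ k a c).Nonempty) : IsIrreducible (lineGraph φ k a c) :=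
  let ⟨_, w, hw⟩ := hne
  isIrreducible_setOf_exists_representsTuple (isPolyFun_graphLift φ k (isPolyFun_line a c))
    ⟨w, fun j => (hw j).ne_zero⟩

theorem dotProduct_eq_zero_of_mem_closure_lineGraph {k : Fin 2} {a c l : Fin 3 → ℂ}
    (hla : l ⬝ᵥ a = 0) (hlc : l ⬝ᵥ c = 0) {e : MultiP2 (Fin 2)}
    (he : e ∈ closure (lineGraph φ k a c)) {v : Fin 3 → ℂ} (hv : Represents (e k) v) :
    l ⬝ᵥ v = 0 := by
  have hclosed := (IsPolyFun.dotProduct (fun i => .const (l i))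
    (IsPolyFun.coord k)).isClosed_setOf_forall_eq_zero
  have hline : ∀ u, RepresentsTuple e u → l ⬝ᵥ u k = 0 := by
    refine closure_minimal ?_ hclosed he
    rintro p ⟨w, hw⟩ u hu
    obtain ⟨t, -, ht⟩ := (representsTuple_graphLift.1 hw).1.exists_smul (hu k)
    simp [ht, dotProduct_add, hla, hlc]
  obtain ⟨t, -, rfl⟩ := (represents_rep (e k)).exists_smul hv
  rw [dotProduct_smul, hline _ (representsTuple_rep e), smul_zero]

variable (hE : IsBirationalCorrespondence E φ)
include hE

theorem exists_evalVec_ne_zero (k : Fin 2) : ∃ v, (φ k).evalVec v ≠ 0 :=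
  let ⟨_, _, hdom⟩ := hE.exists_common
  ⟨_, hdom k⟩

theorem mem_graphPart_of_representsTuple {k : Fin 2} {w : Fin 3 → ℂ} {e : MultiP2 (Fin 2)}
    (he : RepresentsTuple e (graphLift φ k w)) : e ∈ graphPart E φ k := by
  rw [hE.graphPart_eq]
  exact ⟨fun _ => w, he⟩

theorem topologicalKrullDim_graphPart_le (k : Fin 2) :
    topologicalKrullDim (graphPart E φ k) ≤ 2 := by
  let proj : graphPart E φ k → {p : MultiP2 Unit | p () ∈ (φ k).domain} :=
    fun e => ⟨fun _ => e.1 k, e.2.2⟩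
  have hproj : Continuous proj :=
    (continuous_of_isPolyFun (Φ := fun w _ => w k) (fun _ => IsPolyFun.coord k)
      fun _ _ hw _ => hw k).subtype_mk _
  choose lift hlift using fun p : {p : MultiP2 Unit | p () ∈ (φ k).domain} =>
    exists_representsTuple_graphLift (p.1 ()).rep_nonzero p.2
  have hlift_continuous : Continuous lift := by
    refine continuous_of_isPolyFun (isPolyFun_graphLift φ k (IsPolyFun.coord ())) fun p w hw => ?_
    obtain ⟨hk, hsends⟩ := representsTuple_graphLift.1 (hlift p)
    exact representsTuple_graphLift.2 ⟨hk.unique (represents_rep _) ▸ hw (), hsends⟩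
  have hinv : Function.LeftInverse
      (fun p => ⟨lift p, hE.mem_graphPart_of_representsTuple (hlift p)⟩) proj := fun e =>
    Subtype.ext <| (hlift (proj e)).unique <| representsTuple_graphLift.2
      ⟨represents_rep _, (hE.mem_iff k e.1 e.2.2).1 e.2.1⟩
  have hinducing : IsInducing (Subtype.val ∘ proj) :=
    .comp .subtypeVal (hinv.isEmbedding (hlift_continuous.subtype_mk _) hproj).isInducing
  exact hinducing.topologicalKrullDim_le.trans topologicalKrullDim_multiP2_unit_le

theorem finite_setOf_forall_notMem_domain : {e ∈ E | ∀ k, e k ∉ (φ k).domain}.Finite := by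
  refine ((Set.Finite.pi' hE.finite).subset fun e he => ?_ :
    {e ∈ E | ∀ k, e k ∉ (φ k).domain}.Finite)
  exact he.2

theorem topologicalKrullDim_le : topologicalKrullDim E ≤ 2 := by
  refine topologicalKrullDim_le_of_isOpen_of_finite_compl_iUnion
    (U := fun k => {e : E | (e : MultiP2 (Fin 2)) k ∈ (φ k).domain})
    (fun k => (isOpen_setOf_mem_domain (φ k) k).preimage continuous_subtype_val) ?_ fun k => ?_
  · refine (hE.finite_setOf_forall_notMem_domain.preimage
      Subtype.val_injective.injOn).subset fun e he => ⟨e.2, ?_⟩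
    simpa using he
  · have hinducing : IsInducing
        fun e : {e : E | (e : MultiP2 (Fin 2)) k ∈ (φ k).domain} =>
          (⟨e.1.1, e.1.2, e.2⟩ : graphPart E φ k) :=
      .of_comp (by fun_prop) continuous_subtype_val
        (IsInducing.subtypeVal (t := E) |>.comp .subtypeVal)
    exact hinducing.topologicalKrullDim_le.trans (hE.topologicalKrullDim_graphPart_le k)

theorem lineGraph_subset_graphPart (k : Fin 2) (a c : Fin 3 → ℂ) :
    lineGraph φ k a c ⊆ graphPart E φ k :=
  fun _ ⟨_, hw⟩ => hE.mem_graphPart_of_representsTuple hw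

theorem exists_isIrreducible_isClosed_nontrivial_ssubset :
    ∃ Z ⊂ E, IsIrreducible Z ∧ IsClosed Z ∧ Z.Nontrivial := by
  obtain ⟨e, he, hdom⟩ := hE.exists_common
  obtain ⟨a, ha⟩ : ∃ a, a = (e 0).rep := ⟨_, rfl⟩
  have hea : Represents (e 0) a := ha ▸ represents_rep _
  have hφa : (φ 0).evalVec a ≠ 0 := ha ▸ hdom 0
  obtain ⟨c, d, hacd⟩ := exists_dotProduct_crossProduct_ne_zero hea.ne_zero
  have hdac : crossProduct a c ⬝ᵥ d ≠ 0 := by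
    rwa [dotProduct_comm, triple_product_permutation]
  have hcda : crossProduct d a ⬝ᵥ c ≠ 0 := by
    rwa [dotProduct_comm, ← triple_product_permutation]
  have heline : e ∈ lineGraph φ 0 a c := by
    refine ⟨fun _ => ![1, 0, 0], ?_⟩
    simpa using representsTuple_graphLift.2 ⟨hea, (hE.mem_iff 0 e (hdom 0)).1 he⟩
  obtain ⟨w, p, hp, hpda⟩ := exists_representsTuple_graphLift_dotProduct_ne_zero (k := 0)
    (isPolyFun_line a c) ⟨fun _ => ![1, 0, 0], by simpa using hφa⟩
    ⟨fun _ => ![0, 1, 0], by simpa using hcda⟩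
  obtain ⟨u, q, hq, hqac⟩ := exists_representsTuple_graphLift_dotProduct_ne_zero (k := 0)
    (IsPolyFun.coord ()) ⟨fun _ => a, hφa⟩ ⟨fun _ => d, hdac⟩
  refine ⟨closure (lineGraph φ 0 a c),
    ⟨closure_minimal (fun p hp => (hE.lineGraph_subset_graphPart 0 a c hp).1) hE.isClosed,
      fun hsub => hqac ?_⟩,
    (isIrreducible_lineGraph ⟨e, heline⟩).closure, isClosed_closure,
    e, subset_closure heline, p, subset_closure ⟨w, hp⟩, ?_⟩
  · exact dotProduct_eq_zero_of_mem_closure_lineGraph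
      (by rw [dotProduct_comm, dot_self_cross]) (by rw [dotProduct_comm, dot_cross_self])
      (hsub (hE.mem_graphPart_of_representsTuple hq).1) (representsTuple_graphLift.1 hq).1
  · rintro rfl
    obtain ⟨t, -, ht⟩ := hea.exists_smul (representsTuple_graphLift.1 hp).1
    exact hpda (by rw [ht, dotProduct_smul, dotProduct_comm, dot_cross_self, smul_zero])

theorem topologicalKrullDim_eq : topologicalKrullDim E = 2 := by
  obtain ⟨Z, hZE, hirr, hclosed, hnontrivial⟩ := hE.exists_isIrreducible_isClosed_nontrivial_ssubset
  exact hE.topologicalKrullDim_le.antisymm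
    (two_le_topologicalKrullDim_of_ssubset hE.isIrreducible hZE hirr hclosed hnontrivial)

theorem encard_setOf_represents_eq_one {k : Fin 2} {a : Fin 3 → ℂ} (ha : a ≠ 0)
    (hφa : (φ k).evalVec a ≠ 0) : {e ∈ E | Represents (e k) a}.encard = 1 := by
  obtain ⟨e, he⟩ := exists_representsTuple_graphLift ha hφa
  refine Set.encard_eq_one.2 ⟨e, Set.eq_singleton_iff_unique_mem.2
    ⟨⟨(hE.mem_graphPart_of_representsTuple he).1, (representsTuple_graphLift.1 he).1⟩, ?_⟩⟩
  rintro e' ⟨he', hae'⟩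
  have hsends := (hE.mem_iff k e' ((PlaneRationalMap.mem_domain_iff hae').2 hφa)).1 he'
  exact (representsTuple_graphLift.2 ⟨hae', hsends⟩).unique he

theorem generically_encard_eq_one {κ : Type} [Finite κ] {s t : κ} (hst : s ≠ t) (k : Fin 2) :
    Generically fun l : MultiP2 κ =>
      {e ∈ E | OnLine (l s) (e k) ∧ OnLine (l t) (e k)}.encard = 1 := by
  classical
  obtain ⟨v, hv⟩ := hE.exists_evalVec_ne_zero k
  obtain ⟨r, hr⟩ := Function.ne_iff.1 hv
  have hcross : ∀ i, IsPolyFun fun l : κ → Fin 3 → ℂ => crossProduct (l s) (l t) i :=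
    IsPolyFun.crossProduct (IsPolyFun.coord s) (IsPolyFun.coord t)
  refine (((φ k).isPolyFun_evalVec hcross r).mul (hcross 0)).generically ?_ ?_
  · obtain ⟨a, hφa, ha⟩ := ((φ k).isPolyFun_evalVec (IsPolyFun.coord ()) r).exists_ne_zero_and
      (IsPolyFun.coord () 0) ⟨fun _ => v, hr⟩ ⟨fun _ _ => 1, one_ne_zero⟩
    have hmeet : crossProduct ![a () 1, -a () 0, 0] ![a () 2, 0, -a () 0] = a () 0 • a () := by
      rw [cross_apply]
      funext i
      fin_cases i <;> simp
      ring
    refine ⟨Function.update (fun _ => ![a () 1, -a () 0, 0]) t ![a () 2, 0, -a () 0], ?_⟩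
    simp only [Function.update_self, Function.update_of_ne hst, hmeet,
      PlaneRationalMap.evalVec_smul]
    exact mul_ne_zero (mul_ne_zero (pow_ne_zero _ ha) hφa) (mul_ne_zero ha ha)
  · intro l v hlv hne
    have hmeet : crossProduct (v s) (v t) ≠ 0 :=
      Function.ne_iff.2 ⟨0, right_ne_zero_of_mul hne⟩
    simp only [onLine_and_onLine_iff (hlv s) (hlv t) hmeet]
    exact hE.encard_setOf_represents_eq_one hmeet
      (Function.ne_iff.2 ⟨r, left_ne_zero_of_mul hne⟩)

theorem hasMultidegree_two_zero : HasMultidegree E 2 0 1 := by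
  simpa [HasMultidegree, Fin.forall_fin_two] using
    hE.generically_encard_eq_one (κ := Fin 2 ⊕ Fin 0) (s := .inl 0) (t := .inl 1) (by simp) 0

theorem hasMultidegree_zero_two : HasMultidegree E 0 2 1 := by
  simpa [HasMultidegree, Fin.forall_fin_two] using
    hE.generically_encard_eq_one (κ := Fin 0 ⊕ Fin 2) (s := .inr 0) (t := .inr 1) (by simp) 1

end IsBirationalCorrespondence

section CameraCenters

variable {K : Type*} [Field K] {ι : Type*} {X Y : ι → Fin 3 → K} {a b : Fin 3 → K}
  {F G : Matrix (Fin 3) (Fin 3) K}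

/-- The linear conditions on a fundamental matrix `F` of the camera centers variety that do not
involve the second center: `F` has kernel `a` and is compatible with the correspondences
`X i ↔ Y i`. -/
def IsEpipolar (X Y : ι → Fin 3 → K) (a : Fin 3 → K) (F : Matrix (Fin 3) (Fin 3) K) : Prop :=
  F.mulVec a = 0 ∧ ∀ i, Y i ⬝ᵥ F.mulVec (X i) = 0

/-- The defining condition of the camera centers variety, in terms of coordinate vectors. -/
def HasEpipolar (X Y : ι → Fin 3 → K) (a b : Fin 3 → K) : Prop :=
  ∃ F, F ≠ 0 ∧ IsEpipolar X Y a F ∧ F.transpose.mulVec b = 0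

theorem dotProduct_mulVec_comm {m n : Type*} [Fintype m] [Fintype n] (M : Matrix m n K) (u : m → K)
    (v : n → K) : u ⬝ᵥ M.mulVec v = v ⬝ᵥ M.transpose.mulVec u := by
  rw [Matrix.mulVec_transpose, dotProduct_comm v, Matrix.dotProduct_mulVec]

theorem IsEpipolar.transpose (hF : IsEpipolar X Y a F) (hb : F.transpose.mulVec b = 0) :
    IsEpipolar Y X b F.transpose :=
  ⟨hb, fun i => by rw [← dotProduct_mulVec_comm, hF.2 i]⟩

theorem IsEpipolar.sub_smul (hG : IsEpipolar X Y a G) (hF : IsEpipolar X Y a F) (t : K) :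
    IsEpipolar X Y a (G - t • F) := by
  constructor
  · rw [Matrix.sub_mulVec, Matrix.smul_mulVec, hF.1, hG.1, smul_zero, sub_zero]
  · intro i
    rw [Matrix.sub_mulVec, Matrix.smul_mulVec, dotProduct_sub, dotProduct_smul, hF.2, hG.2,
      smul_zero, sub_zero]

theorem HasEpipolar.symm (h : HasEpipolar X Y a b) : HasEpipolar Y X b a := by
  obtain ⟨F, hF0, hF, hFb⟩ := h
  refine ⟨F.transpose, fun h => hF0 (Matrix.transpose_eq_zero.1 h), hF.transpose hFb, ?_⟩
  rw [Matrix.transpose_transpose]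
  exact hF.1

theorem HasEpipolar.smul (h : HasEpipolar X Y a b) (s t : ι → K) (c d : K) :
    HasEpipolar (fun i => s i • X i) (fun i => t i • Y i) (c • a) (d • b) := by
  obtain ⟨F, hF0, hF, hFb⟩ := h
  refine ⟨F, hF0, ⟨?_, fun i => ?_⟩, ?_⟩
  · rw [Matrix.mulVec_smul, hF.1, smul_zero]
  · rw [Matrix.mulVec_smul, dotProduct_smul, smul_dotProduct, hF.2, smul_zero, smul_zero]
  · rw [Matrix.mulVec_smul, hFb, smul_zero]

theorem HasEpipolar.of_mulVec {G H : Matrix (Fin 3) (Fin 3) K} (hG : IsUnit G.det)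
    (hH : IsUnit H.det) (h : HasEpipolar (fun i => G.mulVec (X i)) (fun i => H.mulVec (Y i))
      (G.mulVec a) (H.mulVec b)) : HasEpipolar X Y a b := by
  obtain ⟨F, hF0, ⟨hFa, hFXY⟩, hFb⟩ := h
  refine ⟨H.transpose * F * G, fun hzero => hF0 ?_, ⟨?_, fun i => ?_⟩, ?_⟩
  · have hGu := (Matrix.isUnit_iff_isUnit_det G).2 hG
    have hHu := (Matrix.isUnit_iff_isUnit_det H.transpose).2 (by rwa [Matrix.det_transpose])
    rwa [hGu.mul_left_eq_zero, hHu.mul_right_eq_zero] at hzero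
  · rw [← Matrix.mulVec_mulVec, ← Matrix.mulVec_mulVec, hFa, Matrix.mulVec_zero]
  · rw [← Matrix.mulVec_mulVec, ← Matrix.mulVec_mulVec, dotProduct_mulVec_comm,
      Matrix.transpose_transpose, dotProduct_comm, hFXY i]
  · rw [Matrix.transpose_mul, Matrix.transpose_mul, Matrix.transpose_transpose,
      ← Matrix.mulVec_mulVec, ← Matrix.mulVec_mulVec, hFb, Matrix.mulVec_zero]

theorem hasEpipolar_mulVec_iff {G H : Matrix (Fin 3) (Fin 3) K} (hG : IsUnit G.det)
    (hH : IsUnit H.det) :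
    HasEpipolar (fun i => G.mulVec (X i)) (fun i => H.mulVec (Y i)) (G.mulVec a) (H.mulVec b) ↔
      HasEpipolar X Y a b := by
  refine ⟨HasEpipolar.of_mulVec hG hH, fun h => ?_⟩
  refine HasEpipolar.of_mulVec (Matrix.isUnit_nonsing_inv_det _ hG)
    (Matrix.isUnit_nonsing_inv_det _ hH) ?_
  simpa only [Matrix.mulVec_mulVec, Matrix.nonsing_inv_mul _ hG, Matrix.nonsing_inv_mul _ hH,
    Matrix.one_mulVec] using h

theorem hasEpipolar_of_crossProduct_eq_zero (hF0 : F ≠ 0) (hF : IsEpipolar X Y a F)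
    (hG : IsEpipolar X Y a G) (hGF : ∀ c : K, G ≠ c • F) {w : Fin 3 → K}
    (hw : crossProduct (F.transpose.mulVec w) (G.transpose.mulVec w) = 0) :
    HasEpipolar X Y a w := by
  by_cases hFw : F.transpose.mulVec w = 0
  · exact ⟨F, hF0, hF, hFw⟩
  · obtain ⟨t, ht⟩ := exists_eq_smul_of_crossProduct_eq_zero hFw hw
    refine ⟨G - t • F, fun h => hGF t (sub_eq_zero.1 h), hG.sub_smul hF t, ?_⟩
    rw [Matrix.transpose_sub, Matrix.transpose_smul, Matrix.sub_mulVec, Matrix.smul_mulVec, ht,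
      sub_self]

/- For `F`, `G` in the pencil, `Fᵀ w` and `Gᵀ w` are orthogonal to `a`, so that their cross product
is a multiple of `a`; it vanishes if one suitable coordinate does. -/
theorem exists_conic_of_pencil (ha : a ≠ 0) (hF0 : F ≠ 0) (hF : IsEpipolar X Y a F)
    (hFb : F.transpose.mulVec b = 0) (hG : IsEpipolar X Y a G) (hGF : ∀ c : K, G ≠ c • F) :
    ∃ Q : MvPolynomial (Fin 3) K, eval b Q = 0 ∧ ∀ w, eval w Q = 0 → HasEpipolar X Y a w := by
  obtain ⟨i, hi⟩ := Function.ne_iff.1 ha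
  let rowForms : Matrix (Fin 3) (Fin 3) K → Fin 3 → MvPolynomial (Fin 3) K := fun F j =>
    linForm (F.transpose j)
  have heval : ∀ w, eval w (crossProduct (rowForms F) (rowForms G) i) =
      crossProduct (F.transpose.mulVec w) (G.transpose.mulVec w) i := by
    have hrow : ∀ F w j, F.transpose.mulVec w j = eval w (rowForms F j) := fun F w j =>
      (eval_linForm _ _).symm
    intro w
    simp only [cross_apply, hrow]
    fin_cases i <;> simp
  have horthogonal : ∀ {F : Matrix (Fin 3) (Fin 3) K} (w), F.mulVec a = 0 →
      a ⬝ᵥ F.transpose.mulVec w = 0 := fun w hFa => by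
    rw [← dotProduct_mulVec_comm, hFa, dotProduct_zero]
  refine ⟨crossProduct (rowForms F) (rowForms G) i, by simp [heval, hFb], fun w hw => ?_⟩
  refine hasEpipolar_of_crossProduct_eq_zero hF0 hF hG hGF ?_
  have hparallel : crossProduct a
      (crossProduct (F.transpose.mulVec w) (G.transpose.mulVec w)) = 0 := by
    rw [cross_cross_eq_smul_sub_smul', dotProduct_comm _ a, horthogonal w hF.1,
      horthogonal w hG.1, zero_smul, zero_smul, sub_zero]
  obtain ⟨t, ht⟩ := exists_eq_smul_of_crossProduct_eq_zero ha hparallel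
  rw [heval, ht, Pi.smul_apply, smul_eq_mul] at hw
  rw [ht, (mul_eq_zero.1 hw).resolve_right hi, zero_smul]

/-- The linear map whose kernel consists of the matrices `F` with `IsEpipolar X Y a F`. -/
def epipolarMap (X Y : ι → Fin 3 → K) (a : Fin 3 → K) :
    Matrix (Fin 3) (Fin 3) K →ₗ[K] (Fin 3 → K) × (ι → K) where
  toFun F := (F.mulVec a, fun i => Y i ⬝ᵥ F.mulVec (X i))
  map_add' F G := by ext <;> simp [Matrix.add_mulVec]
  map_smul' c F := by ext <;> simp [Matrix.smul_mulVec]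

theorem mem_ker_epipolarMap : F ∈ (epipolarMap X Y a).ker ↔ IsEpipolar X Y a F := by
  rw [LinearMap.mem_ker, Prod.ext_iff, IsEpipolar]
  exact and_congr_right fun _ => funext_iff

theorem le_finrank_ker_epipolarMap [Fintype ι] (X Y : ι → Fin 3 → K) (a : Fin 3 → K) :
    9 ≤ 3 + Fintype.card ι + Module.finrank K (epipolarMap X Y a).ker := by
  have hrank := LinearMap.finrank_range_add_finrank_ker (epipolarMap X Y a)
  have hrange := Submodule.finrank_le (epipolarMap X Y a).range
  simp only [Module.finrank_matrix, Module.finrank_prod, Module.finrank_pi, Module.finrank_self,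
    Fintype.card_fin] at hrank hrange
  lia

theorem exists_hasEpipolar [Fintype ι] (hι : Fintype.card ι ≤ 5) (X Y : ι → Fin 3 → K)
    (ha : a ≠ 0) : ∃ b ≠ 0, HasEpipolar X Y a b := by
  have hker : 0 < Module.finrank K (epipolarMap X Y a).ker := by
    have := le_finrank_ker_epipolarMap X Y a
    lia
  obtain ⟨⟨F, hF⟩, hF0⟩ := Module.finrank_pos_iff_exists_ne_zero.1 hker
  rw [mem_ker_epipolarMap] at hF
  have hdet : F.transpose.det = 0 := by
    rw [Matrix.det_transpose, ← Matrix.exists_mulVec_eq_zero_iff]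
    exact ⟨a, ha, hF.1⟩
  obtain ⟨b, hb, hFb⟩ := Matrix.exists_mulVec_eq_zero_iff.2 hdet
  exact ⟨b, hb, F, fun h => hF0 (Subtype.ext h), hF, hFb⟩

/- For `a` proportional to `X i`, the `i`-th condition follows from `F a = 0`. -/
theorem exists_isEpipolar_not_smul_of_eq_smul [Fintype ι] (hι : Fintype.card ι ≤ 5) {i : ι} {t : K}
    (hi : X i = t • a) (F : Matrix (Fin 3) (Fin 3) K) :
    ∃ G, IsEpipolar X Y a G ∧ ∀ c : K, G ≠ c • F := by
  classical
  let V := (epipolarMap (fun j : {j // j ≠ i} => X j) (fun j => Y j) a).ker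
  have hV : Module.finrank K (K ∙ F) < Module.finrank K V := by
    have hdim : 9 ≤ 3 + Fintype.card {j // j ≠ i} + Module.finrank K V :=
      le_finrank_ker_epipolarMap _ _ a
    have hspan := finrank_span_le_card (R := K) {F}
    simp only [Set.toFinset_singleton, Finset.card_singleton] at hspan
    rw [Fintype.card_subtype_compl, Fintype.card_subtype_eq] at hdim
    have := Fintype.card_pos_iff.2 ⟨i⟩
    lia
  obtain ⟨G, hG, hGF⟩ := SetLike.not_le_iff_exists.1 fun h => hV.not_ge (Submodule.finrank_mono h)
  obtain ⟨hGa, hGXY⟩ := mem_ker_epipolarMap.1 hG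
  refine ⟨G, ⟨hGa, fun j => ?_⟩, fun c hc => hGF (Submodule.mem_span_singleton.2 ⟨c, hc.symm⟩)⟩
  by_cases hj : j = i
  · rw [hj, hi, Matrix.mulVec_smul, hGa, smul_zero, dotProduct_zero]
  · exact hGXY ⟨j, hj⟩

theorem exists_mulVec_eq_zero_iff_forall_det_mul_eq_zero {m n : Type*} [Fintype m] [Fintype n]
    [DecidableEq n] (M : Matrix m n K) :
    (∃ v ≠ 0, M.mulVec v = 0) ↔ ∀ N : Matrix n m K, (N * M).det = 0 := by
  classical
  refine ⟨fun ⟨v, hv, hMv⟩ N => Matrix.exists_mulVec_eq_zero_iff.1 ⟨v, hv, ?_⟩, fun h => ?_⟩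
  · rw [← Matrix.mulVec_mulVec, hMv, Matrix.mulVec_zero]
  · by_contra! hinj
    have hker : M.mulVecLin.ker = ⊥ :=
      LinearMap.ker_eq_bot'.2 fun v hv => not_not.1 fun hv0 => hinj v hv0 hv
    obtain ⟨g, hg⟩ := M.mulVecLin.exists_leftInverse_of_injective hker
    have hone : LinearMap.toMatrix' g * M = 1 := by
      rw [← LinearMap.toMatrix'_id, ← hg, LinearMap.toMatrix'_comp, ← Matrix.toLin'_apply',
        LinearMap.toMatrix'_toLin']
    have hdet := h (LinearMap.toMatrix' g)
    rw [hone, Matrix.det_one] at hdet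
    exact one_ne_zero hdet

/-- The matrix of the linear system, in the entries of `F`, that defines `HasEpipolar X Y a b`. -/
def epipolarSystem (X Y : ι → Fin 3 → K) (a b : Fin 3 → K) :
    Matrix (Fin 3 ⊕ Fin 3 ⊕ ι) (Fin 3 × Fin 3) K := Matrix.of fun r ij =>
  Sum.elim (fun k => if ij.1 = k then a ij.2 else 0)
    (Sum.elim (fun k => if ij.2 = k then b ij.1 else 0) (fun k => Y k ij.1 * X k ij.2)) r

theorem epipolarSystem_mulVec_eq_zero_iff :
    (epipolarSystem X Y a b).mulVec (Function.uncurry F) = 0 ↔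
      IsEpipolar X Y a F ∧ F.transpose.mulVec b = 0 := by
  have hinl : ∀ k, (epipolarSystem X Y a b).mulVec (Function.uncurry F) (.inl k) =
      F.mulVec a k := fun k => by
    simp [epipolarSystem, Matrix.mulVec, dotProduct, Fintype.sum_prod_type, Function.uncurry,
      mul_comm]
  have hmid : ∀ k, (epipolarSystem X Y a b).mulVec (Function.uncurry F) (.inr (.inl k)) =
      F.transpose.mulVec b k := fun k => by
    simp [epipolarSystem, Matrix.mulVec, dotProduct, Fintype.sum_prod_type, Function.uncurry,
      mul_comm]
  have hinr : ∀ k, (epipolarSystem X Y a b).mulVec (Function.uncurry F) (.inr (.inr k)) =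
      Y k ⬝ᵥ F.mulVec (X k) := fun k => by
    simp [epipolarSystem, Matrix.mulVec, dotProduct, Fintype.sum_prod_type, Function.uncurry,
      Finset.mul_sum, mul_comm, mul_left_comm]
  rw [_root_.funext_iff, Sum.forall, Sum.forall, IsEpipolar, _root_.funext_iff, _root_.funext_iff]
  simp only [hinl, hmid, hinr]
  tauto

theorem hasEpipolar_iff_exists_epipolarSystem_mulVec_eq_zero :
    HasEpipolar X Y a b ↔ ∃ f ≠ 0, (epipolarSystem X Y a b).mulVec f = 0 := by
  constructor
  · rintro ⟨F, hF0, hF⟩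
    refine ⟨Function.uncurry F, fun h => hF0 ?_, epipolarSystem_mulVec_eq_zero_iff.2 hF⟩
    ext i j
    exact congrFun h (i, j)
  · rintro ⟨f, hf0, hf⟩
    refine ⟨Matrix.of (Function.curry f), fun h => hf0 ?_,
      epipolarSystem_mulVec_eq_zero_iff.1 hf⟩
    funext ⟨i, j⟩
    exact congrFun (congrFun h i) j

theorem isPolyFun_epipolarSystem (X Y : ι → Fin 3 → ℂ) (r : Fin 3 ⊕ Fin 3 ⊕ ι)
    (ij : Fin 3 × Fin 3) :
    IsPolyFun fun v : Fin 2 → Fin 3 → ℂ => epipolarSystem X Y (v 0) (v 1) r ij := by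
  rcases r with k | k | k <;>
    simp only [epipolarSystem, Matrix.of_apply, Sum.elim_inl, Sum.elim_inr]
  · split_ifs
    exacts [.coord 0 _, .const 0]
  · split_ifs
    exacts [.coord 1 _, .const 0]
  · exact .const _

variable {n : ℕ} {x y : Fin n → P2} {e : MultiP2 (Fin 2)}

theorem HasEpipolar.of_represents {X Y X' Y' : Fin n → Fin 3 → ℂ} {a b a' b' : Fin 3 → ℂ}
    {p q : P2} (h : HasEpipolar X Y a b) (hX : ∀ i, Represents (x i) (X i))
    (hY : ∀ i, Represents (y i) (Y i)) (ha : Represents p a) (hb : Represents q b)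
    (hX' : ∀ i, Represents (x i) (X' i)) (hY' : ∀ i, Represents (y i) (Y' i))
    (ha' : Represents p a') (hb' : Represents q b') : HasEpipolar X' Y' a' b' := by
  choose s _ hs using fun i => (hX i).exists_smul (hX' i)
  choose t _ ht using fun i => (hY i).exists_smul (hY' i)
  obtain ⟨c, _, rfl⟩ := ha.exists_smul ha'
  obtain ⟨d, _, rfl⟩ := hb.exists_smul hb'
  rw [funext hs, funext ht]
  exact h.smul s t c d

theorem mem_cameraCentersVariety_iff {X Y : Fin n → Fin 3 → ℂ} {a b : Fin 3 → ℂ}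
    (hX : ∀ i, Represents (x i) (X i)) (hY : ∀ i, Represents (y i) (Y i))
    (ha : Represents (e 0) a) (hb : Represents (e 1) b) :
    e ∈ cameraCentersVariety x y ↔ HasEpipolar X Y a b := by
  have hx := fun i => represents_rep (x i)
  have hy := fun i => represents_rep (y i)
  have he := fun k => represents_rep (e k)
  calc
    e ∈ cameraCentersVariety x y ↔
        HasEpipolar (fun i => (x i).rep) (fun i => (y i).rep) (e 0).rep (e 1).rep := by
      refine exists_congr fun F => and_congr_right fun _ => ?_
      rw [IsEpipolar, and_assoc, and_comm (a := ∀ i, _)]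
    _ ↔ HasEpipolar X Y a b :=
      ⟨fun h => h.of_represents hx hy (he 0) (he 1) hX hY ha hb,
        fun h => h.of_represents hX hY ha hb hx hy (he 0) (he 1)⟩

theorem isClosed_setOf_exists_mulVec_eq_zero {κ : Type} {m n : Type*} [Finite κ] [Finite m]
    [Fintype n] {A : (κ → Fin 3 → ℂ) → Matrix m n ℂ} (hA : ∀ i j, IsPolyFun fun v => A v i j) :
    IsClosed {p : MultiP2 κ | ∀ v, RepresentsTuple p v → ∃ w ≠ 0, (A v).mulVec w = 0} := by
  classical
  have := Fintype.ofFinite m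
  have hdet : ∀ N : Matrix n m ℂ, IsPolyFun fun v => (N * A v).det := fun N =>
    IsPolyFun.det fun i j => by
      simp only [Matrix.mul_apply]
      exact .sum _ fun r _ => (IsPolyFun.const _).mul (hA r j)
  convert isClosed_iInter fun N => (hdet N).isClosed_setOf_forall_eq_zero
  ext p
  simp only [exists_mulVec_eq_zero_iff_forall_det_mul_eq_zero, Set.mem_iInter, Set.mem_ofPred_eq]
  exact ⟨fun h N v hv => h v hv N, fun h v hv N => h N v hv⟩

theorem isClosed_cameraCentersVariety (x y : Fin n → P2) :
    IsClosed (cameraCentersVariety x y) := by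
  let A : (Fin 2 → Fin 3 → ℂ) → Matrix (Fin 3 ⊕ Fin 3 ⊕ Fin n) (Fin 3 × Fin 3) ℂ := fun v =>
    epipolarSystem (fun i => (x i).rep) (fun i => (y i).rep) (v 0) (v 1)
  have hmem : ∀ e v, RepresentsTuple e v →
      (e ∈ cameraCentersVariety x y ↔ ∃ w ≠ 0, (A v).mulVec w = 0) := fun e v hv => by
    rw [mem_cameraCentersVariety_iff (fun i => represents_rep (x i))
      (fun i => represents_rep (y i)) (hv 0) (hv 1),
      hasEpipolar_iff_exists_epipolarSystem_mulVec_eq_zero]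
  have heq : cameraCentersVariety x y =
      {e | ∀ v, RepresentsTuple e v → ∃ w ≠ 0, (A v).mulVec w = 0} := by
    clear_value A
    ext e
    exact ⟨fun he v hv => (hmem e v hv).1 he,
      fun h => (hmem e _ (representsTuple_rep e)).2 (h _ (representsTuple_rep e))⟩
  rw [heq]
  exact isClosed_setOf_exists_mulVec_eq_zero (isPolyFun_epipolarSystem _ _)

theorem exists_mem_cameraCentersVariety_apply_zero_eq (x y : Fin n → P2) (hn : n ≤ 5) (p : P2) :
    ∃ e ∈ cameraCentersVariety x y, e 0 = p := by
  obtain ⟨b, hb, h⟩ := exists_hasEpipolar (by simpa using hn) (fun i => (x i).rep)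
    (fun i => (y i).rep) p.rep_nonzero
  exact ⟨(![p, Projectivization.mk ℂ b hb] : Fin 2 → P2),
    (mem_cameraCentersVariety_iff (fun i => represents_rep _) (fun i => represents_rep _)
      (represents_rep p) (represents_mk hb)).2 h, rfl⟩

theorem exists_mem_cameraCentersVariety_apply_one_eq (x y : Fin n → P2) (hn : n ≤ 5) (p : P2) :
    ∃ e ∈ cameraCentersVariety x y, e 1 = p := by
  obtain ⟨b, hb, h⟩ := exists_hasEpipolar (by simpa using hn) (fun i => (y i).rep)
    (fun i => (x i).rep) p.rep_nonzero
  exact ⟨(![Projectivization.mk ℂ b hb, p] : Fin 2 → P2),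
    (mem_cameraCentersVariety_iff (fun i => represents_rep _) (fun i => represents_rep _)
      (represents_mk hb) (represents_rep p)).2 h.symm, rfl⟩

end CameraCenters

section QuinticForms

variable {R S : Type*} [CommRing R] [CommRing S]

/-- The quadratic forms `q₁, q₂, q₃` in `a`. Both factors of the cross product are orthogonal to
the vectors `p` for which `rowMatrix p a` is a fundamental matrix. -/
def quadrics (ξ η a : Fin 3 → R) : Fin 3 → R :=
  crossProduct (η * crossProduct a ξ) (crossProduct a 1)

/-- The forms `(a₁ q₂ q₃, a₂ q₃ q₁, a₃ q₁ q₂)`; the indices are taken modulo 3. -/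
def quintics (ξ η a : Fin 3 → R) : Fin 3 → R := fun i =>
  a i * quadrics ξ η a (i + 1) * quadrics ξ η a (i + 2)

theorem crossProduct_apply (u v : Fin 3 → R) (i : Fin 3) :
    crossProduct u v i = u (i + 1) * v (i + 2) - u (i + 2) * v (i + 1) := by
  rw [cross_apply]
  fin_cases i <;> rfl

theorem quadrics_apply (ξ η a : Fin 3 → R) (i : Fin 3) :
    quadrics ξ η a i =
      η (i + 1) * (a (i + 2) * ξ i - a i * ξ (i + 2)) * (a i - a (i + 1)) -
        η (i + 2) * (a i * ξ (i + 1) - a (i + 1) * ξ i) * (a (i + 2) - a i) := by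
  fin_cases i <;> simp [quadrics, crossProduct_apply]

theorem quinticMap_eq_quintics (ξ η a : Fin 3 → ℂ) : quinticMap ξ η a = quintics ξ η a := by
  funext i
  fin_cases i <;> simp [quinticMap, quintics, quadrics_apply] <;> ring

theorem map_quintics (f : R →+* S) (ξ η a : Fin 3 → R) (i : Fin 3) :
    f (quintics ξ η a i) = quintics (f ∘ ξ) (f ∘ η) (f ∘ a) i := by
  simp [quintics, quadrics_apply]

theorem quintics_smul (r s t : R) (ξ η a : Fin 3 → R) :
    quintics (r • ξ) (s • η) (t • a) = (r ^ 2 * s ^ 2 * t ^ 5) • quintics ξ η a := by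
  funext i
  simp only [quintics, quadrics_apply, Pi.smul_apply, smul_eq_mul]
  ring

theorem quintics_zero (ξ η : Fin 3 → R) : quintics ξ η 0 = 0 := by
  funext i
  simp [quintics]

theorem quadrics_mul_quintics (ξ η a : Fin 3 → R) :
    quadrics ξ η a * quintics ξ η a = (∏ i, quadrics ξ η a i) • a := by
  funext i
  fin_cases i <;> simp [quintics, Fin.prod_univ_three] <;> ring

theorem crossProduct_quintics (ξ η a b : Fin 3 → R) :
    crossProduct (quintics ξ η a) b =
      quadrics ξ η a * crossProduct a (quadrics ξ η a * b) := by
  funext i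
  fin_cases i <;> simp [crossProduct_apply, quintics] <;> ring

end QuinticForms

section RowMatrix

variable {K : Type*} [Field K] {ξ η a p : Fin 3 → K}

/-- The standard frame together with a fifth point. -/
def framePoints (ξ : Fin 3 → K) : Fin 5 → Fin 3 → K :=
  ![Pi.single 0 1, Pi.single 1 1, Pi.single 2 1, 1, ξ]

/-- The matrix with rows `pᵢ (eᵢ × a)`. Off the vertices of the frame, the fundamental matrices of
the standard frame with kernel `a` have this form. -/
def rowMatrix (p a : Fin 3 → K) : Matrix (Fin 3) (Fin 3) K :=
  Matrix.of fun i => p i • crossProduct (Pi.single i 1) a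

/-- `a` is not a multiple of a coordinate vector. -/
def OffVertices (a : Fin 3 → K) : Prop := ∀ i, crossProduct (Pi.single i 1) a ≠ 0

theorem rowMatrix_mulVec (p a v : Fin 3 → K) :
    (rowMatrix p a).mulVec v = p * crossProduct a v := by
  funext i
  change (p i • crossProduct (Pi.single i 1) a) ⬝ᵥ v = p i * crossProduct a v i
  rw [smul_dotProduct, smul_eq_mul, dotProduct_comm, triple_product_permutation,
    single_one_dotProduct]

theorem rowMatrix_transpose_mulVec (p a b : Fin 3 → K) :
    (rowMatrix p a).transpose.mulVec b = crossProduct (p * b) a := by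
  refine dotProduct_eq _ _ fun v => ?_
  rw [dotProduct_comm, ← dotProduct_mulVec_comm, rowMatrix_mulVec, dotProduct_comm _ v,
    triple_product_permutation]
  simp [dotProduct, mul_assoc, mul_left_comm]

theorem rowMatrix_smul (c : K) (p a : Fin 3 → K) : rowMatrix (c • p) a = c • rowMatrix p a := by
  ext i j
  simp [rowMatrix, mul_assoc]

theorem rowMatrix_injective (ha : OffVertices a) : Function.Injective fun p => rowMatrix p a :=
  fun _ _ h => funext fun i => smul_left_injective K (ha i) (congrFun h i)

theorem rowMatrix_eq_zero_iff (ha : OffVertices a) : rowMatrix p a = 0 ↔ p = 0 := by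
  have hzero : rowMatrix 0 a = 0 := by
    ext i j
    simp [rowMatrix]
  rw [← hzero]
  exact (rowMatrix_injective ha).eq_iff

theorem isEpipolar_framePoints_iff {F : Matrix (Fin 3) (Fin 3) K} :
    IsEpipolar (framePoints ξ) (framePoints η) a F ↔
      F.mulVec a = 0 ∧ (∀ i, F i i = 0) ∧ 1 ⬝ᵥ F.mulVec 1 = 0 ∧ η ⬝ᵥ F.mulVec ξ = 0 := by
  simp [IsEpipolar, framePoints, Fin.forall_fin_succ, Matrix.col]
  tauto

theorem isEpipolar_rowMatrix_iff :
    IsEpipolar (framePoints ξ) (framePoints η) a (rowMatrix p a) ↔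
      crossProduct a 1 ⬝ᵥ p = 0 ∧ (η * crossProduct a ξ) ⬝ᵥ p = 0 := by
  have hdiag : ∀ i, rowMatrix p a i i = 0 := fun i => by simp [rowMatrix, crossProduct_apply]
  rw [isEpipolar_framePoints_iff, rowMatrix_mulVec, rowMatrix_mulVec, rowMatrix_mulVec]
  simp only [cross_self, mul_zero, hdiag, implies_true, true_and]
  refine and_congr (Eq.congr_left ?_) (Eq.congr_left ?_)
  · simp [dotProduct, mul_comm]
  · simp [dotProduct, mul_comm, mul_left_comm]

theorem IsEpipolar.exists_rowMatrix {F : Matrix (Fin 3) (Fin 3) K}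
    (hF : IsEpipolar (framePoints ξ) (framePoints η) a F) (ha : OffVertices a) :
    ∃ p, F = rowMatrix p a := by
  obtain ⟨hFa, hdiag, -, -⟩ := isEpipolar_framePoints_iff.1 hF
  choose p hp using fun i => exists_eq_smul_crossProduct_of_dotProduct_eq_zero (ha i)
    ((single_one_dotProduct i _).trans (hdiag i)) ((dotProduct_comm _ _).trans (congrFun hFa i))
  exact ⟨p, funext hp⟩

theorem exists_eq_smul_single_of_not_offVertices (ha : ¬ OffVertices a) :
    ∃ (i : Fin 3) (t : K), a = t • Pi.single i 1 := by
  simp only [OffVertices, not_forall, not_not] at ha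
  obtain ⟨i, hi⟩ := ha
  exact ⟨i, exists_eq_smul_of_crossProduct_eq_zero (by simp) hi⟩

theorem OffVertices.eq_of_apply_eq_zero (ha : OffVertices a) {i j : Fin 3} (hi : a i = 0)
    (hj : a j = 0) : i = j := by
  by_contra hij
  refine ha (2 * (i + j)) (funext fun k => ?_)
  fin_cases i <;> fin_cases j <;> fin_cases k <;> simp_all [crossProduct_apply]

theorem eq_or_eq_add_one_or_eq_add_two (i j : Fin 3) : j = i ∨ j = i + 1 ∨ j = i + 2 := by
  decide +revert

theorem OffVertices.quadrics_eq_zero (ha : OffVertices a) (hη : ∀ i, η i ≠ 0)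
    (hξ : Function.Injective ξ) {i : Fin 3} (h₁ : quadrics ξ η a (i + 1) = 0)
    (h₂ : quadrics ξ η a (i + 2) = 0) : quadrics ξ η a = 0 := by
  have hsingle : quadrics ξ η a = quadrics ξ η a i • Pi.single i 1 := by
    funext j
    rcases eq_or_eq_add_one_or_eq_add_two i j with rfl | rfl | rfl <;> simp [h₁, h₂]
  by_contra hq
  have hqi : quadrics ξ η a i ≠ 0 := fun h => hq (by rw [hsingle, h, zero_smul])
  have horth : ∀ v, v ⬝ᵥ quadrics ξ η a = 0 → v i = 0 := fun v hv => by
    rw [hsingle, dotProduct_smul, dotProduct_single_one, smul_eq_mul] at hv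
    exact (mul_eq_zero.1 hv).resolve_left hqi
  have hone := horth _ (dot_cross_self _ _)
  have hξi := (mul_eq_zero.1 (horth _ (dot_self_cross _ _))).resolve_left (hη i)
  rw [crossProduct_apply, Pi.one_apply, Pi.one_apply, mul_one, mul_one, sub_eq_zero] at hone
  rw [crossProduct_apply, hone, ← mul_sub] at hξi
  have hzero := (mul_eq_zero.1 hξi).resolve_right
    (sub_ne_zero.2 (hξ.ne (by simp)))
  exact absurd (ha.eq_of_apply_eq_zero (hone.trans hzero) hzero) (by simp)

end RowMatrix

section StandardCoordinates

variable {K : Type*} [Field K] {ξ η a b : Fin 3 → K}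

theorem offVertices_of_quintics_ne_zero (h : quintics ξ η a ≠ 0) : OffVertices a := by
  by_contra ha
  obtain ⟨i, t, rfl⟩ := exists_eq_smul_single_of_not_offVertices ha
  refine h (funext fun j => ?_)
  fin_cases i <;> fin_cases j <;> simp [quintics, quadrics_apply]

theorem quadrics_ne_zero_of_quintics_ne_zero (h : quintics ξ η a ≠ 0) : quadrics ξ η a ≠ 0 :=
  fun hq => h (funext fun i => by simp [quintics, hq])

theorem hasEpipolar_quintics (h : quintics ξ η a ≠ 0) :
    HasEpipolar (framePoints ξ) (framePoints η) a (quintics ξ η a) := by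
  have ha := offVertices_of_quintics_ne_zero h
  refine ⟨rowMatrix (quadrics ξ η a) a, ?_, isEpipolar_rowMatrix_iff.2
    ⟨dot_cross_self _ _, dot_self_cross _ _⟩, ?_⟩
  · rw [Ne, rowMatrix_eq_zero_iff ha]
    exact quadrics_ne_zero_of_quintics_ne_zero h
  · rw [rowMatrix_transpose_mulVec, quadrics_mul_quintics, map_smul, LinearMap.smul_apply,
      cross_self, smul_zero]

theorem crossProduct_quintics_eq_zero_of_hasEpipolar (h : quintics ξ η a ≠ 0)
    (hab : HasEpipolar (framePoints ξ) (framePoints η) a b) :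
    crossProduct (quintics ξ η a) b = 0 := by
  have ha := offVertices_of_quintics_ne_zero h
  obtain ⟨F, hF0, hF, hFb⟩ := hab
  obtain ⟨p, rfl⟩ := hF.exists_rowMatrix ha
  obtain ⟨hp, hηp⟩ := isEpipolar_rowMatrix_iff.1 hF
  obtain ⟨c, rfl⟩ := exists_eq_smul_crossProduct_of_dotProduct_eq_zero
    (quadrics_ne_zero_of_quintics_ne_zero h) hηp hp
  have hc : c ≠ 0 := fun hc => hF0 ((rowMatrix_eq_zero_iff ha).2 (by rw [hc, zero_smul]))
  rw [rowMatrix_smul, Matrix.transpose_smul, Matrix.smul_mulVec, rowMatrix_transpose_mulVec] at hFb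
  have hcross : crossProduct a (quadrics ξ η a * b) = 0 := by
    rw [← cross_anticomm, neg_eq_zero]
    exact (smul_eq_zero.1 hFb).resolve_left hc
  rw [crossProduct_quintics, hcross, mul_zero]

/-- The base point of the quintic map that is not one of the five given points. -/
def sixthPoint (ξ η : Fin 3 → K) : Fin 3 → K :=
  crossProduct (crossProduct η ξ) (η * crossProduct η ξ)

/-- Neither `ξ` nor `η` lies on a line through two of the four points of the standard frame, and
`ξ` and `η` represent different points. -/
structure GeneralPosition (ξ η : Fin 3 → K) : Prop where
  left_ne_zero : ∀ i, ξ i ≠ 0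
  right_ne_zero : ∀ i, η i ≠ 0
  left_injective : Function.Injective ξ
  right_injective : Function.Injective η
  crossProduct_ne_zero : crossProduct η ξ ≠ 0

/-- The six base points of the quintic map. -/
def basePoints (ξ η : Fin 3 → K) : Fin 6 → Fin 3 → K :=
  ![Pi.single 0 1, Pi.single 1 1, Pi.single 2 1, 1, ξ, sixthPoint ξ η]

namespace GeneralPosition

variable (h : GeneralPosition ξ η)

include h

theorem symm : GeneralPosition η ξ where
  left_ne_zero := h.right_ne_zero
  right_ne_zero := h.left_ne_zero
  left_injective := h.right_injective
  right_injective := h.left_injective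
  crossProduct_ne_zero := by
    rw [← cross_anticomm, neg_ne_zero]
    exact h.crossProduct_ne_zero

theorem quintics_zero_one_one : ∃ c : K, c ≠ 0 ∧ quintics ξ η ![0, 1, 1] = c • ![0, 1, 1] := by
  refine ⟨ξ 0 * (η 2 - η 1) * (η 0 * (ξ 2 - ξ 1)), mul_ne_zero
    (mul_ne_zero (h.left_ne_zero 0) (sub_ne_zero.2 (h.right_injective.ne (by decide))))
    (mul_ne_zero (h.right_ne_zero 0) (sub_ne_zero.2 (h.left_injective.ne (by decide)))), ?_⟩
  funext i
  fin_cases i <;> simp [quintics, quadrics_apply] <;> grind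

theorem exists_quintics_quintics_ne_zero : ∃ a, quintics η ξ (quintics ξ η a) ≠ 0 := by
  obtain ⟨c, hc, hξη⟩ := h.quintics_zero_one_one
  obtain ⟨d, hd, hηξ⟩ := h.symm.quintics_zero_one_one
  refine ⟨![0, 1, 1], ?_⟩
  rw [hξη, ← one_smul K η, ← one_smul K ξ, quintics_smul, hηξ]
  simp [hc, hd]

theorem exists_quintics_ne_zero : ∃ a, quintics ξ η a ≠ 0 := by
  obtain ⟨a, ha⟩ := h.exists_quintics_quintics_ne_zero
  exact ⟨a, fun ha0 => ha (by rw [ha0, quintics_zero])⟩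

theorem quadrics_apply_ne_zero (ha : OffVertices a) {i : Fin 3} (hi : a i = 0) :
    quadrics ξ η a i ≠ 0 := by
  have hside : quadrics ξ η a i = a (i + 1) * a (i + 2) * (ξ i * (η (i + 2) - η (i + 1))) := by
    rw [quadrics_apply, hi]
    ring
  have hne : ∀ j, j ≠ i → a j ≠ 0 := fun j hj hj0 => hj (ha.eq_of_apply_eq_zero hj0 hi)
  rw [hside]
  exact mul_ne_zero (mul_ne_zero (hne _ (by simp)) (hne _ (by simp)))
    (mul_ne_zero (h.left_ne_zero i) (sub_ne_zero.2 (h.right_injective.ne (by simp))))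

theorem quadrics_eq_zero (ha : OffVertices a) (h₀ : quintics ξ η a = 0) :
    quadrics ξ η a = 0 := by
  by_cases hq : ∃ i, quadrics ξ η a i = 0
  · obtain ⟨i, hi⟩ := hq
    have hai : a i ≠ 0 := fun hai => h.quadrics_apply_ne_zero ha hai hi
    have hprod : a i * quadrics ξ η a (i + 1) * quadrics ξ η a (i + 2) = 0 := congrFun h₀ i
    rw [mul_assoc, mul_eq_zero, or_iff_right hai, mul_eq_zero] at hprod
    rcases hprod with h₁ | h₂
    · refine ha.quadrics_eq_zero h.right_ne_zero h.left_injective (i := i + 2) ?_ ?_ <;>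
        rw [add_assoc] <;> simpa
    · refine ha.quadrics_eq_zero h.right_ne_zero h.left_injective (i := i + 1) ?_ ?_ <;>
        rw [add_assoc] <;> simpa
  · push Not at hq
    have hzero : ∀ i, a i = 0 := fun i =>
      (mul_eq_zero.1 ((mul_eq_zero.1 (congrFun h₀ i)).resolve_right (hq _))).resolve_right (hq _)
    exact absurd (ha.eq_of_apply_eq_zero (hzero 0) (hzero 1)) (by decide)

theorem sixthPoint_ne_zero : sixthPoint ξ η ≠ 0 := fun hzero => by
  obtain ⟨s, hs⟩ := exists_eq_smul_of_crossProduct_eq_zero h.crossProduct_ne_zero hzero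
  obtain ⟨i, hi⟩ := Function.ne_iff.1 h.crossProduct_ne_zero
  have hs_eq : ∀ j, crossProduct η ξ j ≠ 0 → η j = s :=
    fun j hj => mul_right_cancel₀ hj (congrFun hs j)
  have hdot : η ⬝ᵥ crossProduct η ξ = η i * crossProduct η ξ i :=
    Finset.sum_eq_single i (fun j _ hji => mul_eq_zero_of_right _ (of_not_not fun hj =>
      hji (h.right_injective ((hs_eq j hj).trans (hs_eq i hi).symm)))) (by simp)
  exact mul_ne_zero (h.right_ne_zero i) hi (hdot.symm.trans (dot_self_cross η ξ))

theorem exists_eq_smul_sixthPoint (hu : crossProduct a 1 ≠ 0) (hw : crossProduct a ξ ≠ 0)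
    (hq : quadrics ξ η a = 0) : ∃ t : K, a = t • sixthPoint ξ η := by
  have hηw : η * crossProduct a ξ ≠ 0 := fun hzero => hw (funext fun i =>
    (mul_eq_zero.1 (congrFun hzero i)).resolve_left (h.right_ne_zero i))
  obtain ⟨s, hs⟩ := exists_eq_smul_of_crossProduct_eq_zero hηw hq
  have hs0 : s ≠ 0 := fun hs0 => hu (by rw [hs, hs0, zero_smul])
  have hη : η ⬝ᵥ crossProduct a ξ = 0 := by
    have hone : 1 ⬝ᵥ crossProduct a 1 = 0 := dot_cross_self a 1
    rw [hs, dotProduct_smul, smul_eq_zero, or_iff_right hs0] at hone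
    simpa [dotProduct] using hone
  obtain ⟨c, hc⟩ := exists_eq_smul_crossProduct_of_dotProduct_eq_zero h.crossProduct_ne_zero hη
    (dot_cross_self a ξ)
  have hc0 : c ≠ 0 := fun hc0 => hw (by rw [hc, hc0, zero_smul])
  refine exists_eq_smul_crossProduct_of_dotProduct_eq_zero h.sixthPoint_ne_zero ?_ ?_
  · have ha : crossProduct a ξ ⬝ᵥ a = 0 := by rw [dotProduct_comm, dot_self_cross]
    rwa [hc, smul_dotProduct, smul_eq_zero, or_iff_right hc0] at ha
  · have ha : crossProduct a 1 ⬝ᵥ a = 0 := by rw [dotProduct_comm, dot_self_cross]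
    rwa [hs, hc, mul_smul_comm, smul_smul, smul_dotProduct, smul_eq_zero,
      or_iff_right (mul_ne_zero hs0 hc0)] at ha

theorem exists_eq_smul_basePoints (h₀ : quintics ξ η a = 0) :
    ∃ (j : Fin 6) (t : K), a = t • basePoints ξ η j := by
  by_cases ha : OffVertices a
  · have hcollinear : ∀ {v : Fin 3 → K}, v ≠ 0 → crossProduct a v = 0 → ∃ t : K, a = t • v :=
      fun hv hav => exists_eq_smul_of_crossProduct_eq_zero hv
        (by rw [← cross_anticomm, hav, neg_zero])
    by_cases hu : crossProduct a 1 = 0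
    · exact ⟨3, hcollinear one_ne_zero hu⟩
    by_cases hw : crossProduct a ξ = 0
    · exact ⟨4, hcollinear (fun hξ => h.left_ne_zero 0 (congrFun hξ 0)) hw⟩
    exact ⟨5, h.exists_eq_smul_sixthPoint hu hw (h.quadrics_eq_zero ha h₀)⟩
  · obtain ⟨i, t, ht⟩ := exists_eq_smul_single_of_not_offVertices ha
    refine ⟨i.castAdd 3, t, ?_⟩
    fin_cases i <;> exact ht

end GeneralPosition

theorem exists_common_smul_of_crossProduct_eq_zero {u v : Fin 3 → K} (huv : crossProduct u v = 0) :
    ∃ (n : Fin 3 → K) (s t : K), n ≠ 0 ∧ u = s • n ∧ v = t • n := by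
  by_cases hu : u = 0
  · by_cases hv : v = 0
    · exact ⟨1, 0, 0, one_ne_zero, by rw [hu, zero_smul], by rw [hv, zero_smul]⟩
    · exact ⟨v, 0, 1, hv, by rw [hu, zero_smul], (one_smul K v).symm⟩
  · obtain ⟨t, ht⟩ := exists_eq_smul_of_crossProduct_eq_zero hu huv
    exact ⟨u, 1, t, hu, (one_smul K u).symm, ht⟩

theorem OffVertices.exists_isEpipolar_not_smul (ha : OffVertices a) (hq : quadrics ξ η a = 0)
    (F : Matrix (Fin 3) (Fin 3) K) :
    ∃ G, IsEpipolar (framePoints ξ) (framePoints η) a G ∧ ∀ c : K, G ≠ c • F := by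
  obtain ⟨n, s, t, hn, hs, ht⟩ := exists_common_smul_of_crossProduct_eq_zero hq
  obtain ⟨c, d, hcd⟩ := exists_dotProduct_crossProduct_ne_zero hn
  have hrow : ∀ v, IsEpipolar (framePoints ξ) (framePoints η) a (rowMatrix (crossProduct n v) a) :=
    fun v => isEpipolar_rowMatrix_iff.2
      ⟨by rw [ht, smul_dotProduct, dot_self_cross, smul_zero],
        by rw [hs, smul_dotProduct, dot_self_cross, smul_zero]⟩
  by_contra! hc
  obtain ⟨l, hl⟩ := hc _ (hrow c)
  obtain ⟨m, hm⟩ := hc _ (hrow d)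
  have hlm : m • crossProduct n c = l • crossProduct n d := rowMatrix_injective ha <| by
    simp only [rowMatrix_smul, hl, hm, smul_comm l m]
  have hm0 : m = 0 := by
    have hdot := congrArg (d ⬝ᵥ ·) hlm
    simp only [dotProduct_smul, dot_cross_self, smul_zero, smul_eq_zero] at hdot
    exact hdot.resolve_right (by rwa [triple_product_permutation])
  rw [hm0, zero_smul, rowMatrix_eq_zero_iff ha] at hm
  rw [triple_product_permutation, ← cross_anticomm, hm, neg_zero, dotProduct_zero] at hcd
  exact hcd rfl

theorem GeneralPosition.exists_isEpipolar_not_smul (h : GeneralPosition ξ η) (ha : a ≠ 0)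
    (h₀ : quintics ξ η a = 0) (F : Matrix (Fin 3) (Fin 3) K) :
    ∃ G, IsEpipolar (framePoints ξ) (framePoints η) a G ∧ ∀ c : K, G ≠ c • F := by
  by_cases hoff : OffVertices a
  · exact hoff.exists_isEpipolar_not_smul (h.quadrics_eq_zero hoff h₀) F
  · obtain ⟨i, t, ht⟩ := exists_eq_smul_single_of_not_offVertices hoff
    have ht0 : t ≠ 0 := fun ht0 => ha (by rw [ht, ht0, zero_smul])
    refine exists_isEpipolar_not_smul_of_eq_smul (by simp) (i := i.castAdd 2) (t := t⁻¹) ?_ F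
    rw [ht, smul_smul, inv_mul_cancel₀ ht0, one_smul]
    fin_cases i <;> rfl

end StandardCoordinates

section QuinticPlaneMap

section InvertibleMatrix

variable {R n : Type*} [CommRing R] [Fintype n] [DecidableEq n] {G : Matrix n n R}

theorem mulVec_inv_mulVec (hG : IsUnit G.det) (v : n → R) : G.mulVec (G⁻¹.mulVec v) = v := by
  rw [Matrix.mulVec_mulVec, Matrix.mul_nonsing_inv _ hG, Matrix.one_mulVec]

theorem inv_mulVec_mulVec (hG : IsUnit G.det) (v : n → R) : G⁻¹.mulVec (G.mulVec v) = v := by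
  rw [Matrix.mulVec_mulVec, Matrix.nonsing_inv_mul _ hG, Matrix.one_mulVec]

theorem mulVec_eq_zero_iff (hG : IsUnit G.det) {v : n → R} : G.mulVec v = 0 ↔ v = 0 :=
  ⟨fun h => by rw [← inv_mulVec_mulVec hG v, h, Matrix.mulVec_zero],
    fun h => by rw [h, Matrix.mulVec_zero]⟩

end InvertibleMatrix

theorem isHomogeneous_linForm {R σ : Type*} [CommSemiring R] [Fintype σ] (l : σ → R) :
    (linForm l).IsHomogeneous 1 :=
  IsHomogeneous.sum _ _ _ fun i _ => isHomogeneous_C_mul_X (l i) i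

theorem isHomogeneous_quintics {R σ : Type*} [CommRing R] (ξ η : Fin 3 → R)
    {a : Fin 3 → MvPolynomial σ R} (ha : ∀ i, (a i).IsHomogeneous 1) (i : Fin 3) :
    (quintics (C ∘ ξ) (C ∘ η) a i).IsHomogeneous 5 := by
  have hminor : ∀ j k l (s t : R), (C l * (a j * C s - a k * C t)).IsHomogeneous 1 :=
    fun j k l s t => ((ha j).mul (isHomogeneous_C σ s)).sub ((ha k).mul (isHomogeneous_C σ t))
      |>.C_mul l
  have hquadrics : ∀ j, (quadrics (C ∘ ξ) (C ∘ η) a j).IsHomogeneous 2 := fun j => by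
    rw [quadrics_apply]
    exact ((hminor _ _ _ _ _).mul ((ha _).sub (ha _))).sub
      ((hminor _ _ _ _ _).mul ((ha _).sub (ha _)))
  exact ((ha i).mul (hquadrics _)).mul (hquadrics _)

/-- The quintic forms in the coordinates given by `G` and `H`. -/
noncomputable def quinticForm (ξ η : Fin 3 → ℂ) (G H : Matrix (Fin 3) (Fin 3) ℂ) (i : Fin 3) :
    MvPolynomial (Fin 3) ℂ :=
  ∑ j, C (H i j) * quintics (C ∘ ξ) (C ∘ η) (fun k => linForm (G⁻¹ k)) j

theorem eval_quinticForm (ξ η : Fin 3 → ℂ) (G H : Matrix (Fin 3) (Fin 3) ℂ) (i : Fin 3)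
    (v : Fin 3 → ℂ) :
    eval v (quinticForm ξ η G H i) = H.mulVec (quintics ξ η (G⁻¹.mulVec v)) i := by
  have hC : ∀ c : Fin 3 → ℂ, eval v ∘ C ∘ c = c := fun c => _root_.funext fun k => eval_C (c k)
  have hlin : (eval v ∘ fun k => linForm (G⁻¹ k)) = G⁻¹.mulVec v :=
    _root_.funext fun k => eval_linForm _ _
  simp only [quinticForm, map_sum, map_mul, eval_C, map_quintics, hC, hlin]
  rfl

theorem isHomogeneous_quinticForm (ξ η : Fin 3 → ℂ) (G H : Matrix (Fin 3) (Fin 3) ℂ) (i : Fin 3) :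
    (quinticForm ξ η G H i).IsHomogeneous 5 :=
  IsHomogeneous.sum _ _ _ fun j _ =>
    (isHomogeneous_quintics ξ η (fun _ => isHomogeneous_linForm _) j).C_mul (H i j)

theorem finite_setOf_represents {ι : Type*} [Finite ι] (v : ι → Fin 3 → ℂ) :
    {p : P2 | ∃ j, Represents p (v j)}.Finite := by
  rw [Set.ofPred_exists]
  exact Set.finite_iUnion fun j => Set.Subsingleton.finite fun p hp q hq => hp.unique hq

variable {ξ η : Fin 3 → ℂ} {G H : Matrix (Fin 3) (Fin 3) ℂ}

theorem GeneralPosition.exists_represents_basePoints (h : GeneralPosition ξ η)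
    (hG : IsUnit G.det) {p : P2} {v : Fin 3 → ℂ} (hv : Represents p v)
    (h₀ : quintics ξ η (G⁻¹.mulVec v) = 0) :
    ∃ j, Represents p (G.mulVec (basePoints ξ η j)) := by
  obtain ⟨j, t, ht⟩ := h.exists_eq_smul_basePoints h₀
  have htv : v = t • G.mulVec (basePoints ξ η j) := by
    rw [← Matrix.mulVec_smul, ← ht, mulVec_inv_mulVec hG]
  have ht0 : t ≠ 0 := fun ht0 => hv.ne_zero (by rw [htv, ht0, zero_smul])
  rw [htv, Represents.smul_iff ht0] at hv
  exact ⟨j, hv⟩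

/-- The quintic map in the coordinates given by `G` and `H`. -/
noncomputable def quinticPlaneMap (h : GeneralPosition ξ η) (hG : IsUnit G.det)
    (hH : IsUnit H.det) : PlaneRationalMap where
  degree := 5
  form := quinticForm ξ η G H
  homogeneous := isHomogeneous_quinticForm ξ η G H
  reduced := fun q hq => by
    have hzero : ∀ v, (∀ i, eval v (quinticForm ξ η G H i) = 0) →
        quintics ξ η (G⁻¹.mulVec v) = 0 := fun v hv => by
      rw [← mulVec_eq_zero_iff hH]
      funext i
      rw [← eval_quinticForm, hv, Pi.zero_apply]
    refine isUnit_of_forall_dvd_of_finite (by simp) ?_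
      (finite_setOf_represents fun j => G.mulVec (basePoints ξ η j))
      (fun v hv h₀ => h.exists_represents_basePoints hG (represents_mk hv) (hzero v h₀)) hq
    by_contra! hforms
    obtain ⟨a, ha⟩ := h.exists_quintics_ne_zero
    refine ha ?_
    rw [← inv_mulVec_mulVec hG a]
    exact hzero _ fun i => by rw [hforms, map_zero]

variable (h : GeneralPosition ξ η) (hG : IsUnit G.det) (hH : IsUnit H.det)

theorem quinticPlaneMap_evalVec (v : Fin 3 → ℂ) :
    (quinticPlaneMap h hG hH).evalVec v = H.mulVec (quintics ξ η (G⁻¹.mulVec v)) :=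
  _root_.funext fun i => eval_quinticForm ξ η G H i v

theorem mem_quinticPlaneMap_domain_iff {p : P2} {v : Fin 3 → ℂ} (hv : Represents p v) :
    p ∈ (quinticPlaneMap h hG hH).domain ↔ quintics ξ η (G⁻¹.mulVec v) ≠ 0 := by
  rw [PlaneRationalMap.mem_domain_iff hv, quinticPlaneMap_evalVec, Ne, mulVec_eq_zero_iff hH]

theorem finite_compl_quinticPlaneMap_domain : ((quinticPlaneMap h hG hH).domain)ᶜ.Finite := by
  refine (finite_setOf_represents fun j => G.mulVec (basePoints ξ η j)).subset fun p hp => ?_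
  rw [Set.mem_compl_iff, mem_quinticPlaneMap_domain_iff h hG hH (represents_rep p), not_not] at hp
  exact h.exists_represents_basePoints hG (represents_rep p) hp

theorem quinticPlaneMap_sends_iff {p q : P2} {v w : Fin 3 → ℂ} (hv : Represents p v)
    (hw : Represents q w) (h₀ : quintics ξ η (G⁻¹.mulVec v) ≠ 0) :
    (quinticPlaneMap h hG hH).Sends p q ↔
      HasEpipolar (framePoints ξ) (framePoints η) (G⁻¹.mulVec v) (H⁻¹.mulVec w) := by
  rw [PlaneRationalMap.sends_iff hv, quinticPlaneMap_evalVec]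
  refine ⟨fun hsends => ?_, fun hepi => ?_⟩
  · obtain ⟨t, -, ht⟩ := hsends.exists_smul hw
    obtain ⟨F, hF0, hF, hFb⟩ := hasEpipolar_quintics h₀
    refine ⟨F, hF0, hF, ?_⟩
    rw [ht, Matrix.mulVec_smul, inv_mulVec_mulVec hH, Matrix.mulVec_smul, hFb, smul_zero]
  · obtain ⟨t, ht⟩ := exists_eq_smul_of_crossProduct_eq_zero h₀
      (crossProduct_quintics_eq_zero_of_hasEpipolar h₀ hepi)
    have htw : w = t • H.mulVec (quintics ξ η (G⁻¹.mulVec v)) := by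
      rw [← Matrix.mulVec_smul, ← ht, mulVec_inv_mulVec hH]
    have ht0 : t ≠ 0 := fun ht0 => hw.ne_zero (by rw [htw, ht0, zero_smul])
    rwa [htw, Represents.smul_iff ht0] at hw

end QuinticPlaneMap

section StandardCorrespondence

variable {ξ η : Fin 3 → ℂ} {G H : Matrix (Fin 3) (Fin 3) ℂ} {x y : Fin 5 → P2}

theorem mem_cameraCentersVariety_iff_inv_mulVec (hG : IsUnit G.det) (hH : IsUnit H.det)
    (hx : ∀ i, Represents (x i) (G.mulVec (framePoints ξ i)))
    (hy : ∀ i, Represents (y i) (H.mulVec (framePoints η i))) {e : MultiP2 (Fin 2)}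
    {v w : Fin 3 → ℂ} (hv : Represents (e 0) v) (hw : Represents (e 1) w) :
    e ∈ cameraCentersVariety x y ↔
      HasEpipolar (framePoints ξ) (framePoints η) (G⁻¹.mulVec v) (H⁻¹.mulVec w) := by
  rw [← mulVec_inv_mulVec hG v] at hv
  rw [← mulVec_inv_mulVec hH w] at hw
  rw [mem_cameraCentersVariety_iff hx hy hv hw, hasEpipolar_mulVec_iff hG hH]

namespace GeneralPosition

variable (h : GeneralPosition ξ η) (hG : IsUnit G.det) (hH : IsUnit H.det)
  (hx : ∀ i, Represents (x i) (G.mulVec (framePoints ξ i)))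
  (hy : ∀ i, Represents (y i) (H.mulVec (framePoints η i)))

include hx hy

theorem mem_cameraCentersVariety_iff_sends (k : Fin 2) {e : MultiP2 (Fin 2)}
    (he : e k ∈ ((![quinticPlaneMap h hG hH, quinticPlaneMap h.symm hH hG] :
      Fin 2 → PlaneRationalMap) k).domain) :
    e ∈ cameraCentersVariety x y ↔
      ((![quinticPlaneMap h hG hH, quinticPlaneMap h.symm hH hG] : Fin 2 → PlaneRationalMap)
        k).Sends (e k) (e k.rev) := by
  have hv := represents_rep (e 0)
  have hw := represents_rep (e 1)
  rw [mem_cameraCentersVariety_iff_inv_mulVec hG hH hx hy hv hw]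
  fin_cases k
  · exact (quinticPlaneMap_sends_iff h hG hH hv hw
      ((mem_quinticPlaneMap_domain_iff h hG hH hv).1 he)).symm
  · exact Iff.trans ⟨HasEpipolar.symm, HasEpipolar.symm⟩
      (quinticPlaneMap_sends_iff h.symm hH hG hw hv
        ((mem_quinticPlaneMap_domain_iff h.symm hH hG hw).1 he)).symm

theorem exists_conic_of_notMem_domain {e : MultiP2 (Fin 2)} (he : e ∈ cameraCentersVariety x y)
    (h₀ : e 0 ∉ (quinticPlaneMap h hG hH).domain) :
    ∃ Q : MvPolynomial (Fin 3) ℂ, eval (e 1).rep Q = 0 ∧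
      ∀ (w : Fin 3 → ℂ) (b : P2), Represents b w → eval w Q = 0 →
        (![e 0, b] : MultiP2 (Fin 2)) ∈ cameraCentersVariety x y := by
  have hv := represents_rep (e 0)
  have hw := represents_rep (e 1)
  have ha : G⁻¹.mulVec (e 0).rep ≠ 0 := by
    rw [Ne, mulVec_eq_zero_iff (Matrix.isUnit_nonsing_inv_det _ hG)]
    exact hv.ne_zero
  rw [mem_quinticPlaneMap_domain_iff h hG hH hv, not_not] at h₀
  obtain ⟨F, hF0, hF, hFb⟩ :=
    (mem_cameraCentersVariety_iff_inv_mulVec hG hH hx hy hv hw).1 he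
  obtain ⟨F', hF', hne⟩ := h.exists_isEpipolar_not_smul ha h₀ F
  obtain ⟨Q, hQ, hQw⟩ := exists_conic_of_pencil ha hF0 hF hFb hF' hne
  have hsubst : ∀ w, eval w (aeval (fun k => linForm (H⁻¹ k)) Q) = eval (H⁻¹.mulVec w) Q :=
    fun w => by
      rw [eval_aeval_eq_eval]
      simp only [eval_linForm]
      rfl
  refine ⟨aeval (fun k => linForm (H⁻¹ k)) Q, by rw [hsubst, hQ], fun w b hb hwQ => ?_⟩
  exact (mem_cameraCentersVariety_iff_inv_mulVec (e := ![e 0, b]) hG hH hx hy hv hb).2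
    (hQw _ (by rwa [← hsubst]))

theorem exists_mem_cameraCentersVariety_and_mem_domain :
    ∃ e ∈ cameraCentersVariety x y, e 0 ∈ (quinticPlaneMap h hG hH).domain ∧
      e 1 ∈ (quinticPlaneMap h.symm hH hG).domain := by
  obtain ⟨a, hηξ⟩ := h.exists_quintics_quintics_ne_zero
  have hξη : quintics ξ η a ≠ 0 := fun h₀ => hηξ (by rw [h₀, quintics_zero])
  have ha : a ≠ 0 := fun h₀ => hξη (by rw [h₀, quintics_zero])
  obtain ⟨e, he⟩ := exists_representsTuple (v := ![G.mulVec a, H.mulVec (quintics ξ η a)])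
    (Fin.forall_fin_two.2 ⟨mt (mulVec_eq_zero_iff hG).1 ha, mt (mulVec_eq_zero_iff hH).1 hξη⟩)
  have hv : Represents (e 0) (G.mulVec a) := he 0
  have hw : Represents (e 1) (H.mulVec (quintics ξ η a)) := he 1
  refine ⟨e, ?_, ?_, ?_⟩
  · rw [mem_cameraCentersVariety_iff_inv_mulVec hG hH hx hy hv hw, inv_mulVec_mulVec hG,
      inv_mulVec_mulVec hH]
    exact hasEpipolar_quintics hξη
  · rwa [mem_quinticPlaneMap_domain_iff h hG hH hv, inv_mulVec_mulVec hG]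
  · rwa [mem_quinticPlaneMap_domain_iff h.symm hH hG hw, inv_mulVec_mulVec hH]

theorem isBirationalCorrespondence : IsBirationalCorrespondence (cameraCentersVariety x y)
    ![quinticPlaneMap h hG hH, quinticPlaneMap h.symm hH hG] where
  isClosed := isClosed_cameraCentersVariety x y
  mem_iff k _ := h.mem_cameraCentersVariety_iff_sends hG hH hx hy k
  finite := Fin.forall_fin_two.2 ⟨finite_compl_quinticPlaneMap_domain h hG hH,
    finite_compl_quinticPlaneMap_domain h.symm hH hG⟩
  curve _ he h₀ := h.exists_conic_of_notMem_domain hG hH hx hy he h₀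
  exists_common := by
    obtain ⟨e, he, hdomain⟩ := h.exists_mem_cameraCentersVariety_and_mem_domain hG hH hx hy
    exact ⟨e, he, Fin.forall_fin_two.2 hdomain⟩

end GeneralPosition

end StandardCorrespondence

section SeparablePolynomials

section Discriminant

variable {R : Type*} [CommRing R]

/-- The discriminant of `p` as a polynomial of formal degree `N`, up to sign and a power of the
coefficient of `X ^ N`. It also vanishes when the degree of `p` is less than `N`. -/
noncomputable def formalDiscr (N : ℕ) (p : Polynomial R) : R :=
  p.coeff N * Polynomial.resultant p (Polynomial.derivative p) N (N - 1)

theorem map_formalDiscr {S : Type*} [CommRing S] (f : R →+* S) (N : ℕ) (p : Polynomial R) :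
    f (formalDiscr N p) = formalDiscr N (p.map f) := by
  rw [formalDiscr, formalDiscr, map_mul, Polynomial.derivative_map, Polynomial.resultant_map_map,
    Polynomial.coeff_map]

variable {K : Type*} [Field K] [CharZero K]

theorem formalDiscr_ne_zero_iff {N : ℕ} (hN : 0 < N) {p : Polynomial K} (hp : p.natDegree ≤ N) :
    formalDiscr N p ≠ 0 ↔ p.natDegree = N ∧ p.Separable := by
  have hcoeff : p.coeff N ≠ 0 ↔ p.natDegree = N :=
    ⟨fun h => Polynomial.natDegree_eq_of_le_of_coeff_ne_zero hp h, fun h =>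
      Polynomial.coeff_ne_zero_of_eq_degree ((Polynomial.degree_eq_iff_natDegree_eq_of_pos hN).2 h)⟩
  rw [formalDiscr, mul_ne_zero_iff, hcoeff]
  refine and_congr_right fun hdeg => ?_
  have hp0 : p ≠ 0 := by
    rintro rfl
    exact hN.ne' (hdeg.symm.trans Polynomial.natDegree_zero)
  have hderiv : (Polynomial.derivative p).natDegree = N - 1 := by
    rw [← hdeg]
    exact Polynomial.natDegree_eq_of_degree_eq_some
      (Polynomial.degree_derivative (by rw [hdeg]; exact hN.ne'))
  have hres := Polynomial.resultant_eq_zero_iff (f := p) (g := Polynomial.derivative p)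
  rw [hdeg, hderiv] at hres
  rw [Ne, hres, Polynomial.separable_def, not_and_not_right]
  exact ⟨fun h => h (.inl hp0), fun h _ => h⟩

end Discriminant

-- At a double root `t` of `f + s g` the Wronskian of `f` and `g` vanishes and `s = -f(t) / g(t)`.
theorem finite_setOf_not_separable_add_C_mul {K : Type*} [Field K] [IsAlgClosed K]
    {f g : Polynomial K} (h : IsCoprime f g) (hg : Polynomial.derivative g ≠ 0) :
    {s | ¬ (f + Polynomial.C s * g).Separable}.Finite := by
  have hw : f.wronskian g ≠ 0 := fun hw => hg (h.wronskian_eq_zero_iff.1 hw).2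
  refine ((Polynomial.finite_setOfPred_isRoot hw).image fun t => -(f.eval t / g.eval t)).subset
    fun s hs => ?_
  rw [Set.mem_ofPred_eq, Polynomial.separable_def,
    Polynomial.isCoprime_iff_aeval_ne_zero_of_isAlgClosed K K] at hs
  push Not at hs
  obtain ⟨t, hroot, hderiv⟩ := hs
  simp only [Polynomial.coe_aeval_eq_eval, Polynomial.derivative_add, Polynomial.derivative_C_mul,
    Polynomial.eval_add, Polynomial.eval_C_mul] at hroot hderiv
  have hgt : g.eval t ≠ 0 := fun hgt => by
    rw [hgt, mul_zero, add_zero] at hroot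
    have hcop := (Polynomial.isCoprime_iff_aeval_ne_zero_of_isAlgClosed K K f g).1 h t
    simp only [Polynomial.coe_aeval_eq_eval] at hcop
    exact hcop.elim (· hroot) (· hgt)
  refine ⟨t, ?_, ?_⟩
  · rw [Set.mem_ofPred_eq, Polynomial.IsRoot.def, Polynomial.wronskian, Polynomial.eval_sub,
      Polynomial.eval_mul, Polynomial.eval_mul]
    linear_combination (Polynomial.derivative g).eval t * hroot - g.eval t * hderiv
  · field_simp
    linear_combination -hroot

theorem exists_natDegree_add_C_mul_eq_and_separable {K : Type*} [Field K] [IsAlgClosed K]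
    [CharZero K] {f g : Polynomial K} {N : ℕ} (hN : 0 < N) (hf : f.natDegree ≤ N)
    (hg : g.natDegree = N) (h : IsCoprime f g) :
    ∃ s, (f + Polynomial.C s * g).natDegree = N ∧ (f + Polynomial.C s * g).Separable := by
  have hderiv : Polynomial.derivative g ≠ 0 := fun h0 =>
    hN.ne' (hg ▸ Polynomial.derivative_eq_zero.1 h0)
  have hgN : g.coeff N ≠ 0 := Polynomial.coeff_ne_zero_of_eq_degree
    ((Polynomial.degree_eq_iff_natDegree_eq_of_pos hN).2 hg)
  obtain ⟨s, hs⟩ := ((finite_setOf_not_separable_add_C_mul h hderiv).insert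
    (-(f.coeff N / g.coeff N))).infinite_compl.nonempty
  rw [Set.mem_compl_iff, Set.mem_insert_iff, not_or, Set.mem_ofPred_eq, not_not] at hs
  have hle : (f + Polynomial.C s * g).natDegree ≤ N := Polynomial.natDegree_add_le_of_degree_le hf
    ((Polynomial.natDegree_C_mul_le s g).trans hg.le)
  refine ⟨s, Polynomial.natDegree_eq_of_le_of_coeff_ne_zero hle fun h0 => hs.1 ?_, hs.2⟩
  rw [Polynomial.coeff_add, Polynomial.coeff_C_mul] at h0
  field_simp
  linear_combination h0

end SeparablePolynomials

section LineSections

section ParametricLine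

variable {R σ : Type*} [CommSemiring R]

/-- The parametrised line `t ↦ a + t b`, with polynomial coordinates. -/
noncomputable def parametricLine (a b : σ → R) (j : σ) : Polynomial R :=
  Polynomial.C (a j) + Polynomial.C (b j) * Polynomial.X

theorem eval_aeval_parametricLine (f : MvPolynomial σ R) (a b : σ → R) (t : R) :
    (aeval (parametricLine a b) f).eval t = eval (a + t • b) f := by
  have hcoord (j : σ) : (parametricLine a b j).eval t = (a + t • b) j := by
    simp only [parametricLine, Polynomial.eval_add, Polynomial.eval_mul, Polynomial.eval_C,
      Polynomial.eval_X, Pi.add_apply, Pi.smul_apply, smul_eq_mul]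
    rw [mul_comm]
  induction f using MvPolynomial.induction_on with
  | C c => simp
  | add p q hp hq => rw [map_add, Polynomial.eval_add, hp, hq, map_add]
  | mul_X p i hp => rw [map_mul, Polynomial.eval_mul, hp, map_mul, aeval_X, eval_X, hcoord]

theorem natDegree_parametricLine_le (a b : σ → R) (j : σ) :
    (parametricLine a b j).natDegree ≤ 1 := by
  unfold parametricLine
  compute_degree

theorem coeff_prod_pow_parametricLine (a b : σ → R) (d : σ → ℕ) (s : Finset σ) :
    (∏ i ∈ s, parametricLine a b i ^ d i).coeff (∑ i ∈ s, d i) = ∏ i ∈ s, b i ^ d i := by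
  classical
  have hdeg (i : σ) : (parametricLine a b i ^ d i).natDegree ≤ d i := by
    simpa using Polynomial.natDegree_pow_le_of_le (d i) (natDegree_parametricLine_le a b i)
  induction s using Finset.induction_on with
  | empty => simp
  | insert i s hi ih =>
    have hcoeff : (parametricLine a b i ^ d i).coeff (d i) = b i ^ d i := by
      have := Polynomial.coeff_pow_of_natDegree_le (m := d i) (natDegree_parametricLine_le a b i)
      simpa [parametricLine] using this
    rw [Finset.prod_insert hi, Finset.sum_insert hi, Finset.prod_insert hi,
      Polynomial.coeff_mul_add_eq_of_natDegree_le (hdeg i) ((Polynomial.natDegree_prod_le _ _).trans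
        (Finset.sum_le_sum fun j _ => hdeg j)), hcoeff, ih]

theorem coeff_aeval_parametricLine {f : MvPolynomial σ R} {n : ℕ} (hf : f.IsHomogeneous n)
    (a b : σ → R) : (aeval (parametricLine a b) f).coeff n = eval b f := by
  rw [aeval_def, eval₂_eq, Polynomial.finsetSum_coeff, eval_eq]
  refine Finset.sum_congr rfl fun d hd => ?_
  rw [Polynomial.algebraMap_eq, Polynomial.coeff_C_mul, ← coeff_prod_pow_parametricLine a b d,
    ← hf.degree_eq_sum_deg_support hd]

theorem natDegree_aeval_parametricLine_le {f : MvPolynomial σ R} {n : ℕ} (hf : f.IsHomogeneous n)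
    (a b : σ → R) : (aeval (parametricLine a b) f).natDegree ≤ n := by
  simpa using aeval_natDegree_le f hf.totalDegree_le _ (natDegree_parametricLine_le a b)

theorem map_aeval_parametricLine {S : Type*} [CommSemiring S] (F : R →+* S) (f : MvPolynomial σ R)
    (a b : σ → R) : (aeval (parametricLine a b) f).map F =
      aeval (parametricLine (F ∘ a) (F ∘ b)) (map F f) := by
  have hcoord (j : σ) : (parametricLine a b j).map F = parametricLine (F ∘ a) (F ∘ b) j := by
    simp [parametricLine]
  induction f using MvPolynomial.induction_on with
  | C c => simp
  | add p q hp hq => rw [map_add, Polynomial.map_add, hp, hq, map_add, map_add]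
  | mul_X p i hp => rw [map_mul, Polynomial.map_mul, hp, map_mul, map_mul, aeval_X, map_X, aeval_X,
      hcoord]

end ParametricLine

namespace PlaneRationalMap

variable (φ : PlaneRationalMap)

/-- The form whose zeros are the points sent by `φ` to the line with dual coordinates `m`. -/
noncomputable def linePullback (m : Fin 3 → ℂ) : MvPolynomial (Fin 3) ℂ :=
  ∑ i, C (m i) * φ.form i

theorem eval_linePullback (m v : Fin 3 → ℂ) :
    eval v (φ.linePullback m) = m ⬝ᵥ φ.evalVec v := by
  simp [linePullback, dotProduct, evalVec]

theorem isHomogeneous_linePullback (m : Fin 3 → ℂ) :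
    (φ.linePullback m).IsHomogeneous φ.degree :=
  IsHomogeneous.sum _ _ _ fun i _ => (φ.homogeneous i).C_mul (m i)

theorem linePullback_add_smul (m m' : Fin 3 → ℂ) (s : ℂ) :
    φ.linePullback (m + s • m') = φ.linePullback m + C s * φ.linePullback m' := by
  simp only [linePullback, Pi.add_apply, Pi.smul_apply, smul_eq_mul, map_add, map_mul, add_mul,
    mul_assoc, Finset.sum_add_distrib, Finset.mul_sum]

theorem isPolyFun_formalDiscr_linePullback {κ : Type*} {a b m : (κ → Fin 3 → ℂ) → Fin 3 → ℂ}
    (ha : ∀ i, IsPolyFun fun v => a v i) (hb : ∀ i, IsPolyFun fun v => b v i)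
    (hm : ∀ i, IsPolyFun fun v => m v i) (N : ℕ) : IsPolyFun fun v =>
      formalDiscr N (aeval (parametricLine (a v) (b v)) (φ.linePullback (m v))) := by
  choose p hp using ha
  choose q hq using hb
  choose r hr using hm
  refine ⟨formalDiscr N (aeval (parametricLine p q) (∑ i, C (r i) * map C (φ.form i))),
    fun v => ?_⟩
  have hconst : (eval (Function.uncurry v)).comp (C : ℂ →+* _) = .id ℂ :=
    RingHom.ext fun c => eval_C c
  have hform : map (eval (Function.uncurry v)) (∑ i, C (r i) * map C (φ.form i)) =
      φ.linePullback (m v) := by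
    simp only [map_sum, map_mul, map_C, map_map, hconst, map_id, hr, linePullback]
  have hpa : eval (Function.uncurry v) ∘ p = a v := _root_.funext fun i => hp i v
  have hqb : eval (Function.uncurry v) ∘ q = b v := _root_.funext fun i => hq i v
  rw [map_formalDiscr, map_aeval_parametricLine, hform, hpa, hqb]

end PlaneRationalMap

end LineSections

theorem exists_forall_dotProduct_ne_zero {K ι n : Type*} [Field K] [Infinite K] [Fintype n]
    (s : Finset ι) {v : ι → n → K} (hv : ∀ i ∈ s, v i ≠ 0) : ∃ l, ∀ i ∈ s, l ⬝ᵥ v i ≠ 0 := by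
  classical
  obtain ⟨l, hl⟩ := IsPolyFun.exists_ne_zero_forall (κ := Unit) s
    (fun i _ => IsPolyFun.dotProduct (IsPolyFun.coord ()) fun j => .const (v i j)) fun i hi => by
      obtain ⟨j, hj⟩ := Function.ne_iff.1 (hv i hi)
      exact ⟨fun _ => Pi.single j 1, by simpa using hj⟩
  exact ⟨l (), hl⟩

namespace PlaneRationalMap

variable (φ : PlaneRationalMap)

theorem exists_natDegree_eq_and_separable (hdeg : 0 < φ.degree) {a b : Fin 3 → ℂ}
    (hline : ∀ t : ℂ, φ.evalVec (a + t • b) ≠ 0) (hb : φ.evalVec b ≠ 0) :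
    ∃ m, (aeval (parametricLine a b) (φ.linePullback m)).natDegree = φ.degree ∧
      (aeval (parametricLine a b) (φ.linePullback m)).Separable := by
  let res (m : Fin 3 → ℂ) := aeval (parametricLine a b) (φ.linePullback m)
  have hle (m : Fin 3 → ℂ) : (res m).natDegree ≤ φ.degree :=
    natDegree_aeval_parametricLine_le (φ.isHomogeneous_linePullback m) a b
  have heval (m : Fin 3 → ℂ) (t : ℂ) : (res m).eval t = m ⬝ᵥ φ.evalVec (a + t • b) := by
    rw [eval_aeval_parametricLine, eval_linePullback]
  obtain ⟨i, hi⟩ := Function.ne_iff.1 hb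
  -- `res m₀` and `res m₁` span a pencil without base points.
  let m₁ : Fin 3 → ℂ := Pi.single i 1
  have hcoeff : (res m₁).coeff φ.degree ≠ 0 := by
    rwa [coeff_aeval_parametricLine (φ.isHomogeneous_linePullback m₁), eval_linePullback,
      single_one_dotProduct]
  have hres₁ : res m₁ ≠ 0 := fun h => hcoeff (by rw [h, Polynomial.coeff_zero])
  obtain ⟨m₀, hm₀⟩ := exists_forall_dotProduct_ne_zero (res m₁).roots.toFinset fun t _ => hline t
  have hcop : IsCoprime (res m₀) (res m₁) := by
    rw [Polynomial.isCoprime_iff_aeval_ne_zero_of_isAlgClosed ℂ ℂ]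
    intro t
    rw [Polynomial.coe_aeval_eq_eval, heval, or_iff_not_imp_right, not_not]
    exact fun hroot => hm₀ t (Multiset.mem_toFinset.2 ((Polynomial.mem_roots hres₁).2 hroot))
  obtain ⟨s, hs⟩ := exists_natDegree_add_C_mul_eq_and_separable hdeg (hle m₀)
    (Polynomial.natDegree_eq_of_le_of_coeff_ne_zero (hle m₁) hcoeff) hcop
  refine ⟨m₀ + s • m₁, ?_⟩
  rwa [linePullback_add_smul, map_add, map_mul, algHom_C, Polynomial.algebraMap_eq]

end PlaneRationalMap

section ParametrisedLines

variable {R : Type*} [CommRing R]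

theorem crossProduct_crossProduct_self (l c d : Fin 3 → R) :
    crossProduct (crossProduct l c) (crossProduct l d) = (l ⬝ᵥ crossProduct c d) • l := by
  rw [cross_cross_eq_smul_sub_smul, dot_self_cross, zero_smul, zero_sub, ← neg_smul,
    triple_product_permutation, ← cross_anticomm, dotProduct_neg, neg_neg,
    ← triple_product_permutation]

theorem crossProduct_add_smul_add_smul (a b : Fin 3 → R) (t u : R) :
    crossProduct (a + t • b) (a + u • b) = (u - t) • crossProduct a b := by
  simp only [map_add, map_smul, LinearMap.add_apply, LinearMap.smul_apply, cross_self,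
    ← cross_anticomm a b, smul_neg, sub_smul, smul_zero, add_zero, zero_add]
  abel

theorem crossProduct_dotProduct_smul (a b c w : Fin 3 → R) :
    (crossProduct a b ⬝ᵥ c) • w = (crossProduct w b ⬝ᵥ c) • a + (crossProduct a w ⬝ᵥ c) • b +
      (crossProduct a b ⬝ᵥ w) • c := by
  funext i
  fin_cases i <;> simp [cross_apply, dotProduct, Fin.sum_univ_three] <;> ring

theorem exists_eq_smul_add_smul_of_crossProduct_dotProduct_eq_zero {K : Type*} [Field K]
    {a b w : Fin 3 → K} (hab : crossProduct a b ≠ 0) (hw : crossProduct a b ⬝ᵥ w = 0) :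
    ∃ r s : K, w = r • a + s • b := by
  obtain ⟨i, hi⟩ := Function.ne_iff.1 hab
  let c : Fin 3 → K := Pi.single i 1
  have hc : crossProduct a b ⬝ᵥ c ≠ 0 := by rwa [dotProduct_single_one]
  refine ⟨(crossProduct a b ⬝ᵥ c)⁻¹ * (crossProduct w b ⬝ᵥ c),
    (crossProduct a b ⬝ᵥ c)⁻¹ * (crossProduct a w ⬝ᵥ c), ?_⟩
  rw [mul_smul, mul_smul, ← smul_add, eq_inv_smul_iff₀ hc, crossProduct_dotProduct_smul, hw,
    zero_smul, add_zero]

theorem Represents.crossProduct_crossProduct {L : P2} {l c d : Fin 3 → ℂ} (hL : Represents L l)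
    (hl : l ⬝ᵥ crossProduct c d ≠ 0) :
    Represents L (crossProduct (crossProduct l c) (crossProduct l d)) := by
  rw [crossProduct_crossProduct_self]
  exact hL.smul hl

theorem PlaneRationalMap.dotProduct_evalVec_ne_zero_of_natDegree_eq {φ : PlaneRationalMap}
    {a b m : Fin 3 → ℂ} (hne : aeval (parametricLine a b) (φ.linePullback m) ≠ 0)
    (hdeg : (aeval (parametricLine a b) (φ.linePullback m)).natDegree = φ.degree) :
    m ⬝ᵥ φ.evalVec b ≠ 0 := by
  rw [← eval_linePullback, ← coeff_aeval_parametricLine (φ.isHomogeneous_linePullback m), ← hdeg]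
  exact Polynomial.leadingCoeff_ne_zero.2 hne

variable {a b : Fin 3 → ℂ} {L p : P2}
  (hL : Represents L (crossProduct a b))
include hL

theorem add_smul_ne_zero_of_represents_crossProduct (t : ℂ) : a + t • b ≠ 0 := fun h =>
  hL.ne_zero <| by simpa [h] using (crossProduct_add_smul_add_smul a b t (t + 1)).symm

theorem onLine_iff_exists_represents : OnLine L p ↔
    Represents p b ∨ ∃ t : ℂ, Represents p (a + t • b) := by
  have hb : crossProduct a b ⬝ᵥ b = 0 := by rw [dotProduct_comm, dot_cross_self]
  constructor
  · intro h
    have hp := represents_rep p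
    obtain ⟨r, s, hrs⟩ := exists_eq_smul_add_smul_of_crossProduct_dotProduct_eq_zero hL.ne_zero
      ((onLine_iff hL hp).1 h)
    rw [hrs] at hp
    obtain rfl | hr := eq_or_ne r 0
    · rw [zero_smul, zero_add] at hp
      exact .inl ((Represents.smul_iff (left_ne_zero_of_smul hp.ne_zero)).1 hp)
    · refine .inr ⟨r⁻¹ * s, ?_⟩
      rwa [← Represents.smul_iff hr, smul_add, mul_smul, smul_inv_smul₀ hr]
  · rintro (hp | ⟨t, hp⟩)
    · exact (onLine_iff hL hp).2 hb
    · rw [onLine_iff hL hp, dotProduct_add, dotProduct_smul, hb, smul_zero, add_zero,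
        dotProduct_comm, dot_self_cross]

theorem PlaneRationalMap.evalVec_ne_zero_of_forall_onLine_mem_domain {φ : PlaneRationalMap}
    (h : ∀ p, OnLine L p → p ∈ φ.domain) :
    φ.evalVec b ≠ 0 ∧ ∀ t : ℂ, φ.evalVec (a + t • b) ≠ 0 := by
  have hb : b ≠ 0 := fun hb => hL.ne_zero (by rw [hb, map_zero])
  refine ⟨(mem_domain_iff (represents_mk hb)).1 (h _ ?_), fun t =>
    (mem_domain_iff (represents_mk (add_smul_ne_zero_of_represents_crossProduct hL t))).1
      (h _ ?_)⟩
  · exact (onLine_iff_exists_represents hL).2 (.inl (represents_mk _))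
  · exact (onLine_iff_exists_represents hL).2 (.inr ⟨t, represents_mk _⟩)

end ParametrisedLines

namespace IsBirationalCorrespondence

variable {E : Set (MultiP2 (Fin 2))} {φ : Fin 2 → PlaneRationalMap}
  (hE : IsBirationalCorrespondence E φ)
include hE

theorem encard_setOf_onLine_eq_degree {L M : P2} {a b m : Fin 3 → ℂ}
    (hL : Represents L (crossProduct a b)) (hM : Represents M m)
    (hbase : ∀ p, OnLine L p → p ∈ (φ 0).domain)
    (hdeg : (aeval (parametricLine a b) ((φ 0).linePullback m)).natDegree = (φ 0).degree)
    (hsep : (aeval (parametricLine a b) ((φ 0).linePullback m)).Separable) :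
    {e ∈ E | OnLine L (e 0) ∧ OnLine M (e 1)}.encard = (φ 0).degree := by
  have hroot (t : ℂ) : t ∈ (aeval (parametricLine a b) ((φ 0).linePullback m)).roots.toFinset ↔
      m ⬝ᵥ (φ 0).evalVec (a + t • b) = 0 := by
    rw [Multiset.mem_toFinset, Polynomial.mem_roots hsep.ne_zero, Polynomial.IsRoot.def,
      eval_aeval_parametricLine, PlaneRationalMap.eval_linePullback]
  have hvalue := (PlaneRationalMap.evalVec_ne_zero_of_forall_onLine_mem_domain hL hbase).2
  choose e he using fun t => exists_representsTuple_graphLift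
    (add_smul_ne_zero_of_represents_crossProduct hL t) (hvalue t)
  have hinj : Function.Injective e := fun t u htu => by
    have hcross := (representsTuple_graphLift.1 (he t)).1.crossProduct_eq_zero
      (htu ▸ (representsTuple_graphLift.1 (he u)).1)
    rw [crossProduct_add_smul_add_smul, smul_eq_zero_iff_left hL.ne_zero, sub_eq_zero] at hcross
    exact hcross.symm
  have himage : {e ∈ E | OnLine L (e 0) ∧ OnLine M (e 1)} =
      e '' (aeval (parametricLine a b) ((φ 0).linePullback m)).roots.toFinset := by
    ext f
    simp only [Set.mem_ofPred_eq, Set.mem_image, SetLike.mem_coe, hroot]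
    constructor
    · rintro ⟨hf, hfL, hfM⟩
      have hsends := (hE.mem_iff 0 f (hbase _ hfL)).1 hf
      obtain hfb | ⟨t, hft⟩ := (onLine_iff_exists_represents hL).1 hfL
      · exact absurd ((onLine_iff hM ((PlaneRationalMap.sends_iff hfb).1 hsends)).1 hfM)
          (PlaneRationalMap.dotProduct_evalVec_ne_zero_of_natDegree_eq hsep.ne_zero hdeg)
      · exact ⟨t, (onLine_iff hM ((PlaneRationalMap.sends_iff hft).1 hsends)).1 hfM,
          (he t).unique (representsTuple_graphLift.2 ⟨hft, hsends⟩)⟩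
    · rintro ⟨t, ht, rfl⟩
      obtain ⟨het, hsends⟩ := representsTuple_graphLift.1 (he t)
      exact ⟨(hE.mem_iff 0 _ hsends.mem_domain).2 hsends,
        (onLine_iff_exists_represents hL).2 (.inr ⟨t, het⟩),
        (onLine_iff hM ((PlaneRationalMap.sends_iff het).1 hsends)).2 ht⟩
  rw [himage, hinj.injOn.encard_image, Set.encard_coe_eq_coe_finsetCard,
    Multiset.toFinset_card_of_nodup (Polynomial.nodup_roots hsep),
    IsAlgClosed.card_roots_eq_natDegree, hdeg]

theorem hasMultidegree_one_one (hdeg : 0 < (φ 0).degree) :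
    HasMultidegree E 1 1 (φ 0).degree := by
  classical
  obtain ⟨e, -, -⟩ := hE.exists_common
  let base : Finset P2 := (hE.finite 0).toFinset
  have hbase {L : P2} {l : Fin 3 → ℂ} (hL : Represents L l) (hl : ∀ z ∈ base, l ⬝ᵥ z.rep ≠ 0)
      (p : P2) (hp : OnLine L p) : p ∈ (φ 0).domain := by
    by_contra hpdom
    exact hl p ((hE.finite 0).mem_toFinset.2 hpdom) ((onLine_iff hL (represents_rep p)).1 hp)
  obtain ⟨l₀, hl₀⟩ := exists_forall_dotProduct_ne_zero (insert (e 0) base)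
    fun z _ => z.rep_nonzero
  have hl₀_ne : l₀ ≠ 0 := by
    rintro rfl
    exact hl₀ (e 0) (Finset.mem_insert_self _ _) (zero_dotProduct _)
  obtain ⟨c, d, hcd⟩ := exists_dotProduct_crossProduct_ne_zero hl₀_ne
  have hL₀ := represents_mk hl₀_ne
  obtain ⟨hd, ht⟩ := PlaneRationalMap.evalVec_ne_zero_of_forall_onLine_mem_domain 
    (hL₀.crossProduct_crossProduct hcd)
    (hbase hL₀ fun z hz => hl₀ z (Finset.mem_insert_of_mem hz))
  obtain ⟨m₀, hm₀⟩ := (φ 0).exists_natDegree_eq_and_separable hdeg ht hd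
  have hdiscr (a b m : Fin 3 → ℂ) := formalDiscr_ne_zero_iff hdeg
    (natDegree_aeval_parametricLine_le ((φ 0).isHomogeneous_linePullback m) a b)
  have hl (i : Fin 3) : IsPolyFun fun v : Fin 1 ⊕ Fin 1 → Fin 3 → ℂ => v (.inl 0) i := .coord _ _
  refine IsPolyFun.generically
    (((PlaneRationalMap.isPolyFun_formalDiscr_linePullback (φ 0)
      (IsPolyFun.crossProduct hl fun i => .const (c i))
      (IsPolyFun.crossProduct hl fun i => .const (d i))
      (IsPolyFun.coord (.inr 0)) (φ 0).degree).mul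
        (.dotProduct hl fun i => .const (crossProduct c d i))).mul
      (.prod base fun z _ => .dotProduct hl fun i => .const (z.rep i)))
    ⟨Sum.elim (fun _ => l₀) fun _ => m₀, ?_⟩ fun p v hv hne => ?_
  · exact mul_ne_zero (mul_ne_zero ((hdiscr _ _ _).2 hm₀) hcd)
      (Finset.prod_ne_zero_iff.2 fun z hz => hl₀ z (Finset.mem_insert_of_mem hz))
  · obtain ⟨hne, hprod⟩ := mul_ne_zero_iff.1 hne
    obtain ⟨hdiscr_ne, hvcd⟩ := mul_ne_zero_iff.1 hne
    obtain ⟨hnat, hsep⟩ := (hdiscr _ _ _).1 hdiscr_ne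
    simp only [Unique.forall_iff, Fin.default_eq_zero]
    exact hE.encard_setOf_onLine_eq_degree ((hv _).crossProduct_crossProduct hvcd) (hv _)
      (hbase (hv _) (Finset.prod_ne_zero_iff.1 hprod)) hnat hsep

end IsBirationalCorrespondence

section ProjectiveFrames

open Matrix hiding Represents

section CommRing

variable {R : Type*} [CommRing R]

/-- The matrix whose columns are the first three vectors. -/
def vertexMatrix (X : Fin 5 → Fin 3 → R) : Matrix (Fin 3) (Fin 3) R :=
  .of fun i j => X (j.castLE (by decide)) i

/-- The coefficients of the linear relation between the first four vectors. -/
def frameScale (X : Fin 5 → Fin 3 → R) : Fin 3 → R :=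
  (vertexMatrix X).cramer (X 3)

/-- The matrix that takes the standard projective frame to the first four vectors, up to scale. -/
def frameMatrix (X : Fin 5 → Fin 3 → R) : Matrix (Fin 3) (Fin 3) R :=
  vertexMatrix X * diagonal (frameScale X)

/-- Homogeneous coordinates of the fifth vector with respect to the projective frame formed by the
first four. -/
def fifthPoint (X : Fin 5 → Fin 3 → R) : Fin 3 → R :=
  (frameMatrix X).cramer (X 4)

theorem det_frameMatrix (X : Fin 5 → Fin 3 → R) :
    (frameMatrix X).det = (vertexMatrix X).det * ∏ i, frameScale X i := by
  rw [frameMatrix, det_mul, det_diagonal]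

theorem frameMatrix_mulVec_single (X : Fin 5 → Fin 3 → R) (i : Fin 3) :
    frameMatrix X *ᵥ Pi.single i 1 = frameScale X i • X (i.castLE (by decide)) := by
  funext j
  rw [mulVec_single_one, col_apply, frameMatrix, mul_diagonal, mul_comm]
  rfl

theorem frameMatrix_mulVec_one (X : Fin 5 → Fin 3 → R) :
    frameMatrix X *ᵥ 1 = (vertexMatrix X).det • X 3 := by
  have hdiag : diagonal (frameScale X) *ᵥ 1 = frameScale X := by
    funext i
    rw [mulVec_diagonal, Pi.one_apply, mul_one]
  rw [frameMatrix, ← mulVec_mulVec, hdiag, frameScale, mulVec_cramer]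

theorem frameMatrix_mulVec_fifthPoint (X : Fin 5 → Fin 3 → R) :
    frameMatrix X *ᵥ fifthPoint X = (frameMatrix X).det • X 4 :=
  mulVec_cramer _ _

theorem eq_smul_one_of_mulVec_single_of_mulVec_one {n : Type*} [Fintype n] [DecidableEq n]
    {N : Matrix n n R} {s : n → R} {t : R} (hs : ∀ i, N *ᵥ Pi.single i 1 = s i • Pi.single i 1)
    (ht : N *ᵥ 1 = t • 1) : N = t • 1 := by
  have hN : N = diagonal s := by
    refine ext_of_mulVec_single fun i => ?_
    rw [hs, diagonal_mulVec_single, ← Pi.single_smul, smul_eq_mul]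
  have hst : s = fun _ => t := by
    funext i
    simpa [hN, mulVec_diagonal] using congrFun ht i
  rw [hN, hst, smul_one_eq_diagonal]

end CommRing

section Field

variable {K : Type*} [Field K]

theorem vertexMatrix_framePoints (ξ : Fin 3 → K) : vertexMatrix (framePoints ξ) = 1 := by
  ext i j
  fin_cases i <;> fin_cases j <;> rfl

theorem frameMatrix_framePoints (ξ : Fin 3 → K) : frameMatrix (framePoints ξ) = 1 := by
  have hscale : frameScale (framePoints ξ) = fun _ => 1 := by
    rw [frameScale, vertexMatrix_framePoints, cramer_one]
    rfl
  rw [frameMatrix, vertexMatrix_framePoints, hscale, diagonal_one, one_mul]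

theorem fifthPoint_framePoints (ξ : Fin 3 → K) : fifthPoint (framePoints ξ) = ξ := by
  rw [fifthPoint, frameMatrix_framePoints, cramer_one]
  rfl

end Field

theorem framePoints_castSucc (ξ : Fin 3 → ℂ) (i : Fin 4) :
    framePoints ξ i.castSucc = frame i := by
  funext j
  fin_cases i <;> fin_cases j <;> rfl

theorem standardPosition_iff {x : Fin 5 → P2} {G : Matrix (Fin 3) (Fin 3) ℂ} {ξ : Fin 3 → ℂ} :
    StandardPosition x G ξ ↔
      IsUnit G.det ∧ ∀ i, Represents (x i) (G *ᵥ framePoints ξ i) := by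
  rw [Fin.forall_fin_succ', isUnit_iff_ne_zero]
  simp only [framePoints_castSucc]
  rfl

theorem standardPosition_frameMatrix {x : Fin 5 → P2} {X : Fin 5 → Fin 3 → ℂ}
    (hX : ∀ i, Represents (x i) (X i)) (hdet : (frameMatrix X).det ≠ 0) :
    StandardPosition x (frameMatrix X) (fifthPoint X) := by
  obtain ⟨hvertex, hscale⟩ := mul_ne_zero_iff.1 (det_frameMatrix X ▸ hdet)
  have hvertices (i : Fin 3) :
      Represents (x (i.castLE (by decide))) (frameMatrix X *ᵥ Pi.single i 1) := by
    rw [frameMatrix_mulVec_single]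
    exact (hX _).smul (Finset.prod_ne_zero_iff.1 hscale i (Finset.mem_univ i))
  refine standardPosition_iff.2 ⟨hdet.isUnit, fun i => ?_⟩
  fin_cases i
  · exact hvertices 0
  · exact hvertices 1
  · exact hvertices 2
  · exact (frameMatrix_mulVec_one X).symm ▸ (hX 3).smul hvertex
  · exact (frameMatrix_mulVec_fifthPoint X).symm ▸ (hX 4).smul hdet

theorem StandardPosition.exists_smul {x : Fin 5 → P2} {G G' : Matrix (Fin 3) (Fin 3) ℂ}
    {ξ ξ' : Fin 3 → ℂ} (h : StandardPosition x G ξ) (h' : StandardPosition x G' ξ') :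
    ∃ s t : ℂ, s ≠ 0 ∧ t ≠ 0 ∧ G' = s • G ∧ ξ' = t • ξ := by
  obtain ⟨hG, hx⟩ := standardPosition_iff.1 h
  obtain ⟨-, hx'⟩ := standardPosition_iff.1 h'
  have hex (i : Fin 5) : ∃ s : ℂ, s ≠ 0 ∧ (G⁻¹ * G') *ᵥ framePoints ξ' i = s • framePoints ξ i := by
    obtain ⟨s, hs, hs'⟩ := (hx i).exists_smul (hx' i)
    exact ⟨s, hs, by rw [← mulVec_mulVec, hs', mulVec_smul, inv_mulVec_mulVec hG]⟩
  choose s hs hs' using hex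
  have hscalar : G⁻¹ * G' = s 3 • 1 := by
    refine eq_smul_one_of_mulVec_single_of_mulVec_one (s := ![s 0, s 1, s 2]) (fun i => ?_) (hs' 3)
    fin_cases i
    exacts [hs' 0, hs' 1, hs' 2]
  refine ⟨s 3, (s 3)⁻¹ * s 4, hs 3, mul_ne_zero (inv_ne_zero (hs 3)) (hs 4), ?_, ?_⟩
  · rw [← mul_nonsing_inv_cancel_left _ G' hG, hscalar, Matrix.mul_smul, mul_one]
  · have hfifth := hs' 4
    rw [hscalar, smul_mulVec, one_mulVec] at hfifth
    rwa [mul_smul, eq_inv_smul_iff₀ (hs 3)]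

end ProjectiveFrames

section Polynomiality

variable {R κ ι : Type*} [CommRing R] {m : Type*} [Fintype m] [DecidableEq m]

theorem IsPolyFun.cramer {M : (κ → ι → R) → Matrix m m R} {b : (κ → ι → R) → m → R}
    (hM : ∀ i j, IsPolyFun fun v => M v i j) (hb : ∀ i, IsPolyFun fun v => b v i) (i : m) :
    IsPolyFun fun v => (M v).cramer (b v) i := by
  simp only [Matrix.cramer_apply]
  refine .det fun j k => ?_
  obtain rfl | hk := eq_or_ne k i
  · simpa only [Matrix.updateCol_self] using hb j
  · simpa only [Matrix.updateCol_ne hk] using hM j k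

variable {X : (κ → ι → R) → Fin 5 → Fin 3 → R} (hX : ∀ k i, IsPolyFun fun v => X v k i)
include hX

theorem isPolyFun_frameMatrix (i j : Fin 3) : IsPolyFun fun v => frameMatrix (X v) i j := by
  have hvertex (i j : Fin 3) : IsPolyFun fun v => vertexMatrix (X v) i j := hX _ i
  simp only [frameMatrix, Matrix.mul_diagonal]
  exact (hvertex i j).mul (.cramer hvertex (hX 3) j)

theorem isPolyFun_fifthPoint (i : Fin 3) : IsPolyFun fun v => fifthPoint (X v) i :=
  .cramer (isPolyFun_frameMatrix hX) (hX 4) i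

end Polynomiality

section Genericity

theorem GeneralPosition.of_ne_add_one {K : Type*} [Field K] {ξ η : Fin 3 → K}
    (hξ : ∀ i, ξ i ≠ 0 ∧ ξ i ≠ ξ (i + 1)) (hη : ∀ i, η i ≠ 0 ∧ η i ≠ η (i + 1))
    (h : crossProduct η ξ ≠ 0) : GeneralPosition ξ η := by
  have hinj {f : Fin 3 → K} (hf : ∀ i, f i ≠ f (i + 1)) : Function.Injective f := by
    intro i j hij
    obtain rfl | rfl | rfl := eq_or_eq_add_one_or_eq_add_two i j
    · rfl
    · exact absurd hij (hf i)
    · have hcycle : (2 + 1 : Fin 3) = 0 := rfl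
      exact absurd hij.symm (by simpa only [add_assoc, hcycle, add_zero] using hf (i + 2))
  exact ⟨fun i => (hξ i).1, fun i => (hη i).1, hinj fun i => (hξ i).2, hinj fun i => (hη i).2, h⟩

theorem exists_isPolyFun_forall_generalPosition :
    ∃ g : (Fin 2 → Fin 3 → ℂ) → ℂ, IsPolyFun g ∧ (∃ v, g v ≠ 0) ∧
      ∀ v, g v ≠ 0 → GeneralPosition (v 0) (v 1) := by
  have hpoly (k : Fin 2) : IsPolyFun fun v : Fin 2 → Fin 3 → ℂ =>
      ∏ i, v k i * (v k i - v k (i + 1)) :=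
    .prod _ fun i _ => (IsPolyFun.coord k i).mul ((IsPolyFun.coord k i).sub (.coord k (i + 1)))
  refine ⟨_, ((hpoly 0).mul (hpoly 1)).mul
    (IsPolyFun.crossProduct (IsPolyFun.coord 1) (IsPolyFun.coord 0) 0),
    ⟨![![1, 2, 3], ![1, 2, 4]], ?_⟩, fun v hv => ?_⟩
  · simp [Fin.prod_univ_three, cross_apply]
    norm_num
  · simp only [mul_ne_zero_iff, Finset.prod_ne_zero_iff, Finset.mem_univ, true_imp_iff,
      sub_ne_zero] at hv
    exact .of_ne_add_one hv.1.1 hv.1.2 fun h => hv.2 (congrFun h 0)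

theorem generically_standardPosition_and_generalPosition :
    Generically fun D : MultiP2 (Fin 5 ⊕ Fin 5) => ∃ G H ξ η,
      StandardPosition (fun i => D (.inl i)) G ξ ∧ StandardPosition (fun i => D (.inr i)) H η ∧
        GeneralPosition ξ η := by
  obtain ⟨g, hg, ⟨v₀, hv₀⟩, hgeneral⟩ := exists_isPolyFun_forall_generalPosition
  have hX (k i) : IsPolyFun fun v : Fin 5 ⊕ Fin 5 → Fin 3 → ℂ => v (.inl k) i := .coord _ i
  have hY (k i) : IsPolyFun fun v : Fin 5 ⊕ Fin 5 → Fin 3 → ℂ => v (.inr k) i := .coord _ i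
  refine (((IsPolyFun.det (isPolyFun_frameMatrix hX)).mul
    (.det (isPolyFun_frameMatrix hY))).mul
    (hg.comp (Φ := fun v => ![fifthPoint fun k => v (.inl k), fifthPoint fun k => v (.inr k)])
      (Fin.forall_fin_two.2 ⟨isPolyFun_fifthPoint hX, isPolyFun_fifthPoint hY⟩))).generically
    ⟨Sum.elim (framePoints (v₀ 0)) (framePoints (v₀ 1)), ?_⟩ fun D v hD hv => ?_
  · have hv₀' : ![v₀ 0, v₀ 1] = v₀ := FinVec.etaExpand_eq v₀
    simpa [Function.comp_def, frameMatrix_framePoints, fifthPoint_framePoints, hv₀'] using hv₀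
  · obtain ⟨hdet, hgv⟩ := mul_ne_zero_iff.1 hv
    obtain ⟨hdetX, hdetY⟩ := mul_ne_zero_iff.1 hdet
    exact ⟨_, _, _, _, standardPosition_frameMatrix (fun i => hD (.inl i)) hdetX,
      standardPosition_frameMatrix (fun i => hD (.inr i)) hdetY, hgeneral _ hgv⟩

end Genericity

theorem exists_evalVec_quinticPlaneMap_eq_smul {x y : Fin 5 → P2}
    {G G' H H' : Matrix (Fin 3) (Fin 3) ℂ} {ξ ξ' η η' : Fin 3 → ℂ} (h : GeneralPosition ξ η)
    (hG : IsUnit G.det) (hH : IsUnit H.det)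
    (hx : StandardPosition x G ξ) (hx' : StandardPosition x G' ξ')
    (hy : StandardPosition y H η) (hy' : StandardPosition y H' η') :
    ∃ c : ℂ, c ≠ 0 ∧ ∀ v, (quinticPlaneMap h hG hH).evalVec (G'.mulVec v) =
      c • H'.mulVec (quinticMap ξ' η' v) := by
  obtain ⟨s, t, hs, ht, rfl, rfl⟩ := hx.exists_smul hx'
  obtain ⟨s', t', hs', ht', rfl, rfl⟩ := hy.exists_smul hy'
  have hc : s' * (t ^ 2 * t' ^ 2) ≠ 0 := by positivity
  refine ⟨s ^ 5 / (s' * (t ^ 2 * t' ^ 2)), div_ne_zero (pow_ne_zero 5 hs) hc, fun v => ?_⟩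
  have hleft : quintics ξ η (s • v) = s ^ 5 • quintics ξ η v := by
    simpa using quintics_smul 1 1 s ξ η v
  have hright : quintics (t • ξ) (t' • η) v = (t ^ 2 * t' ^ 2) • quintics ξ η v := by
    simpa using quintics_smul t t' 1 ξ η v
  rw [quinticPlaneMap_evalVec, Matrix.smul_mulVec, Matrix.mulVec_smul, inv_mulVec_mulVec hG,
    hleft, quinticMap_eq_quintics, hright, Matrix.smul_mulVec, Matrix.mulVec_smul,
    Matrix.mulVec_smul, smul_smul, smul_smul, mul_assoc, div_mul_cancel₀ _ hc]

theorem mainTheorem9 :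
    Generically fun D : MultiP2 (Fin 5 ⊕ Fin 5) =>
      let x : Fin 5 → P2 := fun i => D (Sum.inl i)
      let y : Fin 5 → P2 := fun i => D (Sum.inr i)
      let E : Set (MultiP2 (Fin 2)) := cameraCentersVariety x y
      -- `E` is a surface
      (IsClosed E ∧ IsIrreducible E ∧ topologicalKrullDim E = 2) ∧
      -- both projections are surjective
      (∀ a : P2, ∃ e ∈ E, e 0 = a) ∧
      (∀ b : P2, ∃ e ∈ E, e 1 = b) ∧
      -- both projections have rational inverses `σ` and `τ`, and the composite `σ 1` of `σ` with
      -- the second projection is a Cremona transformation of degree 5, given by explicit forms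
      (∃ σ τ : Fin 2 → PlaneRationalMap,
        IsRationalInverse E 0 σ ∧ IsRationalInverse E 1 τ ∧
        (σ 1).IsCremona ∧ (σ 1).degree = 5 ∧
        ∀ (G H : Matrix (Fin 3) (Fin 3) ℂ) (ξ η : Fin 3 → ℂ),
          StandardPosition x G ξ → StandardPosition y H η →
          ∃ c : ℂ, c ≠ 0 ∧ ∀ v : Fin 3 → ℂ,
            (σ 1).evalVec (G.mulVec v) = c • H.mulVec (quinticMap ξ η v)) ∧
      -- the multidegrees
      HasMultidegree E 2 0 1 ∧ HasMultidegree E 0 2 1 ∧ HasMultidegree E 1 1 5 := by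
  obtain ⟨U, hU, hdense, hgeneral⟩ := generically_standardPosition_and_generalPosition
  refine ⟨U, hU, hdense, fun D hD => ?_⟩
  obtain ⟨G, H, ξ, η, hx, hy, h⟩ := hgeneral D hD
  obtain ⟨hG, hGx⟩ := standardPosition_iff.1 hx
  obtain ⟨hH, hHy⟩ := standardPosition_iff.1 hy
  have hE := h.isBirationalCorrespondence hG hH hGx hHy
  exact ⟨⟨hE.isClosed, hE.isIrreducible, hE.topologicalKrullDim_eq⟩,
    exists_mem_cameraCentersVariety_apply_zero_eq _ _ le_rfl,
    exists_mem_cameraCentersVariety_apply_one_eq _ _ le_rfl,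
    ⟨_, _, hE.isRationalInverse 0, hE.isRationalInverse 1, hE.isCremona, rfl,
      fun _ _ _ _ hx' hy' => exists_evalVec_quinticPlaneMap_eq_smul h hG hH hx hx' hy hy'⟩,
    hE.hasMultidegree_two_zero, hE.hasMultidegree_zero_two,
    hE.hasMultidegree_one_one (Nat.succ_pos 4)⟩
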